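/- For integers $c,n\ge 1$, real angles $\theta=(\theta_{k,j})_{0\le k<n,\,0\le j<c}$ and unitaries $V_0,\dots,V_{n-1}$ acting on a target register (one distinguished qubit together with an arbitrary finite-dimensional space $W$), consider the multiplexed gate with $c$ controls and $n$ rotations $$U_\theta=\prod_{k=0}^{n-1}U_{\theta_k}V_k,\qquad U_{\theta_k}=\sum_{j=0}^{c-1}|j\rangle\langle j|\otimes e^{2\pi i\theta_{k,j}Z},$$ where $Z$ acts on the distinguished qubit and $V_k$ acts trivially on the control register $|j\rangle$. Circuits consist of Hadamard, phase, CNOT and Toffoli gates and of computational-basis measurements on whose outcomes later operations may depend, and they call each $V_k$ exactly once, as a black box. The value $j$ is encoded in binary in $\lceil\log_2 c\rceil$ qubits. For a precision $b$ the circuits may use, besides the control and target registers, $a$ ancilla qubits that start in and are returned to $|0\rangle$, and a $(b+1)$-qubit register that starts in, and is returned to, the phase-gradient state $2^{-(b+1)/2}\sum_{k=0}^{2^{b+1}-1}e^{-2\pi i k/2^{b+1}}|k\rangle$. The cost of preparing this reusable state is not counted. The Toffoli count of a circuit is the maximum number of Toffoli gates over all measurement outcomes. The diamond distance is $\mathcal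 D_\diamond(\mathcal V,\mathcal V')=\sup_\rho\frac12\|(\mathcal V\otimes\mathcal I)(\rho)-(\mathcal V'\otimes\mathcal I)(\rho)\|_1$ over all finite-dimensional reference systems and states $\rho$. Say that $\theta$ is *implementable with parameters $(\varepsilon,b,a,T)$* if there is a finite random ensemble of angle tables $\Theta$ and circuits, each with $a$ ancillae and Toffoli count at most $T$, independent of $W$ and of the $V_k$, such that: every sampled angle has the form $\Theta_{k,j}=t_{k,j}2^{-b}+s_k2^{-(b+1)}$ with integers $0\le t_{k,j}<2^b$ and a bit $s_k\in\{0,1\}$ that does not depend on $j$; for every choice of $W$ and $V_0,\dots,V_{n-1}$, each sampled circuit performs $U_\Theta$ exactly (restoring ancillae and phase-gradient state); and the averaged channel satisfies $\mathcal D_\diamond\big(U_\theta(\cdot)U_\theta^\dagger,\ \mathbb E[U_\Theta(\cdot)U_\Theta^\dagger]\big)\le\varepsilon$. For $0<\varepsilon<1$ let $b=\big\lceil\tfrac12\log_2\big(\tfrac{n\pi^2}{2\varepsilon}\big)\big\rceil$. 1. There is an absolute constant $C>0$ such that for all $c,n\ge1$, all $\theta$ and all $0<\varepsilon<1$ with $n/\varepsilon\ge2$,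 the table $\theta$ is implementable with parameters $(\varepsilon,b,a,T)$ for some $a$ and some $$T\le n\Big\lceil\tfrac12\log_2\Big(\frac{n\pi^2}{2\varepsilon}\Big)\Big\rceil+C\sqrt{c\,n\log_2(n/\varepsilon)}.$$ 2. (Trade-off between Toffoli and qubit count.) For all $c,n\ge1$, all $\theta$, all $0<\varepsilon<1$, every integer $1\le k\le n$ and all powers of two $1\le\lambda,\lambda'\le c$, the table $\theta$ is implementable with parameters $(\varepsilon,b,a,T)$ where $$T=nb+\Big\lceil\frac nk\Big\rceil\Big(\Big\lceil\frac c\lambda\Big\rceil+\Big\lceil\frac c{\lambda'}\Big\rceil+(\lambda-1)kb+\lambda'\Big),$$ $$a=kb+\max\Big\{\Big\lceil\log_2\frac c\lambda\Big\rceil+(\lambda-1)kb,\ \Big\lceil\log_2\frac c{\lambda'}\Big\rceil+\lambda',\ b\Big\}.$$ -/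

import Mathlib

open Matrix
open scoped Kronecker ENNReal ComplexOrder

namespace QMux

/-! ### Trace distance and diamond distance -/

section Distance

/-- The Schatten `1`-norm: the sum of the singular values. -/
noncomputable def traceNorm {S : Type} [Fintype S] [DecidableEq S] (A : Matrix S S ℂ) : ℝ :=
  ∑ i, √((isHermitian_conjTranspose_mul_self A).eigenvalues i)

/-- The trace distance `½ ‖ρ - σ‖₁`. -/
noncomputable def traceDist {S : Type} [Fintype S] [DecidableEq S] (ρ σ : Matrix S S ℂ) : ℝ :=
  traceNorm (ρ - σ) / 2

/-- Density matrices: positive semidefinite of trace one. -/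
def IsDensity {S : Type} [Fintype S] (ρ : Matrix S S ℂ) : Prop :=
  ρ.PosSemidef ∧ ρ.trace = 1

/-- `Φ ⊗ 𝓘` for a (linear) map `Φ` on the matrices over `S` and a reference system `R`:
`Φ` is applied to each `S`-block of `ρ`. -/
def ampliate {S R : Type} (Φ : Matrix S S ℂ → Matrix S S ℂ) (ρ : Matrix (S × R) (S × R) ℂ) :
    Matrix (S × R) (S × R) ℂ :=
  Matrix.of fun x y => Φ (Matrix.of fun s t => ρ (s, x.2) (t, y.2)) x.1 y.1

/-- The diamond distance: the supremum of the trace distance of `(Φ ⊗ 𝓘) ρ` and `(Ψ ⊗ 𝓘) ρ` over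
all finite-dimensional reference systems and all states `ρ`. -/
noncomputable def diamondDist {S : Type} [Fintype S] [DecidableEq S]
    (Φ Ψ : Matrix S S ℂ → Matrix S S ℂ) : ℝ≥0∞ :=
  ⨆ (r : ℕ) (ρ : Matrix (S × Fin r) (S × Fin r) ℂ) (_ : IsDensity ρ),
    ENNReal.ofReal (traceDist (ampliate Φ ρ) (ampliate Ψ ρ))

/-- The map `ρ ↦ A ρ A†`. -/
noncomputable def conjBy {S T : Type} [Fintype S] (A : Matrix T S ℂ) (ρ : Matrix S S ℂ) :
    Matrix T T ℂ :=
  A * ρ * Aᴴ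

end Distance

/-! ### The multiplexed gate -/

section Multiplexed

/-- Basis labels of the system the gate acts on: the control value `j < c`, the rotated qubit, and
the rest `W` of the target register. -/
abbrev Sys (c : ℕ) (W : Type) : Type := Fin c × (Bool × W)

/-- The multiplexed rotation `∑ⱼ |j⟩⟨j| ⊗ exp(2πi θⱼ Z)`. -/
noncomputable def muxRotation {c : ℕ} (W : Type) [DecidableEq W] (θ : Fin c → ℝ) :
    Matrix (Sys c W) (Sys c W) ℂ :=
  Matrix.diagonal fun s =>
    Complex.exp (2 * Real.pi * Complex.I * θ s.1 * (if s.2.1 then -1 else 1))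

/-- The multiplexed gate `∏ₖ U_{θₖ} Vₖ = U_{θ₀} V₀ U_{θ₁} V₁ ⋯` (as a matrix product), where each
`Vₖ` acts on the target register and trivially on the control register. -/
noncomputable def muxGate {c n : ℕ} {W : Type} [Fintype W] [DecidableEq W]
    (θ : Fin n → Fin c → ℝ) (V : Fin n → Matrix (Bool × W) (Bool × W) ℂ) :
    Matrix (Sys c W) (Sys c W) ℂ :=
  (List.ofFn fun k => muxRotation W (θ k) * ((1 : Matrix (Fin c) (Fin c) ℂ) ⊗ₖ V k)).prod

end Multiplexed

/-! ### Adaptive Clifford + Toffoli circuits -/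

section Circuits

/-- Elementary gates on wires `Q`: Hadamard, phase gate, CNOT (control, target) and Toffoli
(two controls, target). -/
inductive Gate (Q : Type) : Type
  | hadamard (q : Q) : Gate Q
  | phase (q : Q) : Gate Q
  | cnot (a t : Q) (h : a ≠ t) : Gate Q
  | toffoli (a b t : Q) (hab : a ≠ b) (hat : a ≠ t) (hbt : b ≠ t) : Gate Q

/-- Adaptive circuits on wires `Q` that may call `n` black-box unitaries. After a measurement in
the computational basis the remaining circuit depends on the outcome. -/
inductive Circuit (n : ℕ) (Q : Type) : Type
  | done : Circuit n Q
  | gate (g : Gate Q) (rest : Circuit n Q) : Circuit n Q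
  | call (k : Fin n) (rest : Circuit n Q) : Circuit n Q
  | measure (q : Q) (rest : Bool → Circuit n Q) : Circuit n Q

/-- The number of Toffoli gates, in the worst case over the measurement outcomes. -/
def Circuit.toffoliCount {n : ℕ} {Q : Type} : Circuit n Q → ℕ
  | .done => 0
  | .gate (.toffoli _ _ _ _ _ _) rest => rest.toffoliCount + 1
  | .gate _ rest => rest.toffoliCount
  | .call _ rest => rest.toffoliCount
  | .measure _ rest => max (rest false).toffoliCount (rest true).toffoliCount

/-- Whatever the measurement outcomes, the black boxes called by the circuit are those in the list,
in this order. -/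
def Circuit.Calls {n : ℕ} {Q : Type} : Circuit n Q → List (Fin n) → Prop
  | .done, l => l = []
  | .gate _ rest, l => rest.Calls l
  | .call k rest, l => ∃ l', l = k :: l' ∧ rest.Calls l'
  | .measure _ rest, l => ∀ x, (rest x).Calls l

variable {Q W : Type} [Fintype Q] [DecidableEq Q] [Fintype W] [DecidableEq W]

/-- The single-qubit matrix `M` on wire `q`, tensored with the identity. -/
def onWire (W : Type) [DecidableEq W] (q : Q) (M : Matrix Bool Bool ℂ) :
    Matrix ((Q → Bool) × W) ((Q → Bool) × W) ℂ :=
  Matrix.of fun x y =>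
    if x.2 = y.2 ∧ ∀ q', q' ≠ q → x.1 q' = y.1 q' then M (x.1 q) (y.1 q) else 0

/-- The linear extension of the map `|y⟩ ↦ |f y⟩` of computational basis states. -/
def basisMap (W : Type) [DecidableEq W] (f : (Q → Bool) → (Q → Bool)) :
    Matrix ((Q → Bool) × W) ((Q → Bool) × W) ℂ :=
  Matrix.of fun x y => if x.2 = y.2 ∧ x.1 = f y.1 then 1 else 0

/-- The unitary matrix of a gate. -/
noncomputable def Gate.mat (W : Type) [DecidableEq W] :
    Gate Q → Matrix ((Q → Bool) × W) ((Q → Bool) × W) ℂ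
  | .hadamard q => onWire W q (Matrix.of fun x y => (if x && y then -1 else 1) / (√2 : ℝ))
  | .phase q => onWire W q (Matrix.diagonal fun x => if x then Complex.I else 1)
  | .cnot a t _ => basisMap W fun y => Function.update y t (y t ^^ y a)
  | .toffoli a b t _ _ _ => basisMap W fun y => Function.update y t (y t ^^ (y a && y b))

/-- A black-box matrix `V` on the wire `τ` and the space `W`, tensored with the identity. -/
def callMat (τ : Q) (V : Matrix (Bool × W) (Bool × W) ℂ) :
    Matrix ((Q → Bool) × W) ((Q → Bool) × W) ℂ :=
  Matrix.of fun x y =>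
    if ∀ q, q ≠ τ → x.1 q = y.1 q then V (x.1 τ, x.2) (y.1 τ, y.2) else 0

/-- The projection onto the value `x` of the wire `q`. -/
def proj (W : Type) [DecidableEq W] (q : Q) (x : Bool) :
    Matrix ((Q → Bool) × W) ((Q → Bool) × W) ℂ :=
  onWire W q (Matrix.diagonal fun y => if y = x then 1 else 0)

/-- The quantum channel performed by a circuit (outcomes of measurements are averaged over), where
`call k` applies `V k` to the wire `τ` and the space `W`. -/
noncomputable def Circuit.run {n : ℕ} (τ : Q) (V : Fin n → Matrix (Bool × W) (Bool × W) ℂ) :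
    Circuit n Q → Matrix ((Q → Bool) × W) ((Q → Bool) × W) ℂ →
      Matrix ((Q → Bool) × W) ((Q → Bool) × W) ℂ
  | .done, ρ => ρ
  | .gate g rest, ρ => rest.run τ V (conjBy (g.mat W) ρ)
  | .call k rest, ρ => rest.run τ V (conjBy (callMat τ (V k)) ρ)
  | .measure q rest, ρ => ∑ x, (rest x).run τ V (conjBy (proj W q x) ρ)

end Circuits

/-! ### Registers, encoding and implementation -/

section Implementation

/-- Wires: `m` control qubits and the rotated qubit, then `p` qubits of the phase-gradient register
and `a` further qubits. -/
abbrev Wire (m p a : ℕ) : Type := (Fin m ⊕ Unit) ⊕ (Fin p ⊕ Fin a)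

/-- The number with the given binary digits, least significant first. -/
def bitsToNat {p : ℕ} (x : Fin p → Bool) : ℕ := ∑ i, if x i then 2 ^ (i : ℕ) else 0

/-- Amplitudes of the phase-gradient state `2^{-p/2} ∑ₖ exp(-2πi k / 2^p) |k⟩` on `p` qubits. -/
noncomputable def phaseAmp {p : ℕ} (x : Fin p → Bool) : ℂ :=
  Complex.exp (-(2 * Real.pi * Complex.I * bitsToNat x / 2 ^ p)) / (√(2 ^ p) : ℝ)

/-- The isometry `|j⟩|x⟩|w⟩ ↦ |j in binary⟩|x⟩|phase gradient⟩|0⋯0⟩|w⟩`. -/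
noncomputable def encode (c p a : ℕ) (W : Type) [DecidableEq W] :
    Matrix ((Wire (Nat.clog 2 c) p a → Bool) × W) (Sys c W) ℂ :=
  Matrix.of fun f s =>
    if (∀ i, f.1 (.inl (.inl i)) = (s.1 : ℕ).testBit i) ∧ f.1 (.inl (.inr ())) = s.2.1 ∧
        (∀ i, f.1 (.inr (.inr i)) = false) ∧ f.2 = s.2.2
    then phaseAmp fun i => f.1 (.inr (.inl i)) else 0

/-- A finite random ensemble of circuits, with the table of angles that each circuit is meant to
apply. Besides the control and the rotated qubits, the circuits use a `(b + 1)`-qubit phase-gradient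
register and `a` ancilla qubits. -/
structure RandomizedCircuit (c n b a : ℕ) where
  /-- the number of samples -/
  N : ℕ
  /-- the probability of each sample -/
  prob : Fin N → ℝ
  /-- the sampled table of angles -/
  angle : Fin N → Fin n → Fin c → ℝ
  /-- the sampled circuit -/
  circuit : Fin N → Circuit n (Wire (Nat.clog 2 c) (b + 1) a)

/-- The randomized circuit implements the multiplexed gate with angles `θ` to diamond error `ε` by a
`b`-bit randomization of the angles, for arbitrary black-box unitaries `V`. -/
structure RandomizedCircuit.Implements {c n b a : ℕ} (E : RandomizedCircuit c n b a)
    (θ : Fin n → Fin c → ℝ) (ε : ℝ) : Prop where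
  prob_nonneg : ∀ i, 0 ≤ E.prob i
  prob_sum : ∑ i, E.prob i = 1
  /-- Every sampled angle is a `b`-bit fraction, plus a final bit of weight `2^{-(b+1)}` that is the
  same for all control values. -/
  angle_bits : ∀ i k, ∃ s : Bool, ∀ j, ∃ t : ℕ, t < 2 ^ b ∧
    E.angle i k j = t / 2 ^ b + (if s then 1 / 2 ^ (b + 1) else 0)
  /-- Each black box is called once, in the order in which the gate applies them. -/
  calls : ∀ i, (E.circuit i).Calls (List.finRange n).reverse
  /-- Each sampled circuit performs the multiplexed gate with the sampled angles exactly; it returns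
  the ancillae to `|0⟩` and the phase-gradient register to its initial state. -/
  run_exact : ∀ (W : Type) [Fintype W] [DecidableEq W] (V : Fin n → Matrix (Bool × W) (Bool × W) ℂ),
    (∀ k, V k ∈ unitaryGroup (Bool × W) ℂ) → ∀ (i : Fin E.N) (ρ : Matrix (Sys c W) (Sys c W) ℂ),
      (E.circuit i).run (.inl (.inr ())) V (conjBy (encode c (b + 1) a W) ρ) =
        conjBy (encode c (b + 1) a W) (conjBy (muxGate (E.angle i) V) ρ)
  /-- The average over the samples is within diamond distance `ε` of the gate. -/
  error : ∀ (W : Type) [Fintype W] [DecidableEq W] (V : Fin n → Matrix (Bool × W) (Bool × W) ℂ),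
    (∀ k, V k ∈ unitaryGroup (Bool × W) ℂ) →
      diamondDist (conjBy (muxGate θ V))
        (fun ρ => ∑ i, (E.prob i : ℂ) • conjBy (muxGate (E.angle i) V) ρ) ≤ ENNReal.ofReal ε

/-- There is an implementation to diamond error `ε` with `b`-bit angles and `a` ancilla qubits, all
of whose sampled circuits use at most `T` Toffoli gates. -/
def Implementable {c n : ℕ} (θ : Fin n → Fin c → ℝ) (ε : ℝ) (b a T : ℕ) : Prop :=
  ∃ E : RandomizedCircuit c n b a, E.Implements θ ε ∧ ∀ i, (E.circuit i).toffoliCount ≤ T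

/-- `b = ⌈½ log₂(n π² / (2ε))⌉`. -/
noncomputable def bitsFor (n : ℕ) (ε : ℝ) : ℕ :=
  ⌈1 / 2 * Real.logb 2 (n * Real.pi ^ 2 / (2 * ε))⌉₊

/-- `⌈log₂ (c / l)⌉`. -/
noncomputable def ceilLog (c l : ℕ) : ℕ := ⌈Real.logb 2 ((c : ℝ) / l)⌉₊

end Implementation

end QMux

set_option linter.unusedSectionVars false
set_option linter.unnecessarySeqFocus false

/-! The proof combines an approximation argument for random angle tables with an exact synthesis of
every sampled table.

Approximation. The phase of one rotation lies within half a step of a multiple `g` of the grid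
spacing `2π / 2^(b+1)`. A fair coin chooses the parity of the sampled multiple: one parity gives
`g`, the other gives `g + 1` or `g - 1` with a bias. The bias can be tuned so that the mean of the
sampled phase factors is a real nonnegative multiple `m` of the wanted one, with `1 - m ≤ (π / 2^b)²
/ 4` (`exists_rounding`). The coin is fair whatever the angle, so all control values can share it;
this is why the last bit does not depend on `j`. Different `k` are sampled independently, hence the
mean of the gates is the product of the mean factors, at operator distance `δ ≤ n (π / 2^b)² / 4`
from the target. A mixture of unitaries whose mean is `δ`-close to a unitary is a channel at diamond
distance at most `2δ` (`diamondDist_mixture_le`): the second-order term is also controlled by `δ`,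
because the operators are unitary. The definition of `b` makes `2δ ≤ ε`.

Synthesis. The rotations are treated in blocks of `k`. A block loads the `k b` angle bits belonging
to the control value `j`: unary iteration over the high part of `j` writes `λ` candidate registers
at once (about `c / λ` Toffolis), and a controlled swap network brings the right one to the front
(`(λ - 1) k b` Toffolis). Each rotation is then an addition of the angle into the phase-gradient
register, an eigenvector of addition, at fewer than `b` Toffolis; complementing the register under
control of the rotated qubit gives the opposite sign for `Z = -1`. Loaded bits are removed by
measurements in the Hadamard basis, which cost no Toffoli and leave only a sign `(-1)^(F j)`. Such a
sign is diagonal in the control register, so it commutes with the rotations and with the `V k`; the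
signs of all measurements of a block are collected and repaired once, by a one-hot encoding of the
low part of `j` and unary iteration over the high part (`c / λ' + λ'` Toffolis).

Circuits are verified on families of signed basis states `(-1)^(F l) |v l⟩` (`emb`, `Tr`),
coherently in the label `l`; this covers everything except the black boxes and the superposition in
the phase-gradient register, which are added afterwards (`enc`, `Maps`). The first claim is the case
of a single block `k = n`, with `λ ≈ √(c / (n b))` and `λ' ≈ √c`. -/

namespace QMux

/-! ### Composition of circuits -/

section Seq

variable {n : ℕ} {Q : Type}

/-- Run the second circuit after the first, whatever the outcomes of the first. -/
def Circuit.seq : Circuit n Q → Circuit n Q → Circuit n Q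
  | .done, D => D
  | .gate g rest, D => .gate g (rest.seq D)
  | .call k rest, D => .call k (rest.seq D)
  | .measure q rest, D => .measure q fun x => (rest x).seq D

lemma Circuit.toffoliCount_seq (C D : Circuit n Q) :
    (C.seq D).toffoliCount = C.toffoliCount + D.toffoliCount := by
  induction C with
  | done => simp [seq, toffoliCount]
  | gate g rest ih => cases g <;> simp [seq, toffoliCount, ih] <;> omega
  | call k rest ih => simp [seq, toffoliCount, ih]
  | measure q rest ih => simp [seq, toffoliCount, ih, max_add_add_right]

lemma Circuit.Calls.seq {C D : Circuit n Q} {l l' : List (Fin n)} (hC : C.Calls l)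
    (hD : D.Calls l') : (C.seq D).Calls (l ++ l') := by
  induction C generalizing l with
  | done => cases hC; exact hD
  | gate g rest ih => exact ih hC
  | call k rest ih =>
    obtain ⟨l₁, rfl, h⟩ := hC
    exact ⟨l₁ ++ l', rfl, ih h⟩
  | measure q rest ih => exact fun x => ih x (hC x)

lemma Circuit.Calls.seq_nil {C D : Circuit n Q} {l : List (Fin n)} (hC : C.Calls [])
    (hD : D.Calls l) : (C.seq D).Calls l := hC.seq hD

/-! ### Linearity of circuit channels and sequential composition -/

variable {W : Type} [Fintype Q] [DecidableEq Q] [Fintype W] [DecidableEq W]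

lemma conjBy_mul {S T U : Type} [Fintype S] [Fintype T] (A : Matrix U T ℂ) (B : Matrix T S ℂ)
    (ρ : Matrix S S ℂ) : conjBy (A * B) ρ = conjBy A (conjBy B ρ) := by
  simp [conjBy, Matrix.mul_assoc]

lemma conjBy_add {S T : Type} [Fintype S] (A : Matrix T S ℂ) (ρ σ : Matrix S S ℂ) :
    conjBy A (ρ + σ) = conjBy A ρ + conjBy A σ := by
  simp [conjBy, Matrix.mul_add, Matrix.add_mul]

lemma conjBy_smul {S T : Type} [Fintype S] (A : Matrix T S ℂ) (z : ℂ) (ρ : Matrix S S ℂ) :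
    conjBy A (z • ρ) = z • conjBy A ρ := by
  simp [conjBy]

lemma Circuit.run_add (τ : Q) (V : Fin n → Matrix (Bool × W) (Bool × W) ℂ) (C : Circuit n Q)
    (ρ σ : Matrix ((Q → Bool) × W) ((Q → Bool) × W) ℂ) :
    C.run τ V (ρ + σ) = C.run τ V ρ + C.run τ V σ := by
  induction C generalizing ρ σ with
  | done => rfl
  | gate g rest ih => simp [run, conjBy_add, ih]
  | call k rest ih => simp [run, conjBy_add, ih]
  | measure q rest ih => simp only [run, conjBy_add, ih, Finset.sum_add_distrib]

lemma Circuit.run_smul (τ : Q) (V : Fin n → Matrix (Bool × W) (Bool × W) ℂ) (C : Circuit n Q)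
    (z : ℂ) (ρ : Matrix ((Q → Bool) × W) ((Q → Bool) × W) ℂ) :
    C.run τ V (z • ρ) = z • C.run τ V ρ := by
  induction C generalizing ρ with
  | done => rfl
  | gate g rest ih => simp [run, conjBy_smul, ih]
  | call k rest ih => simp [run, conjBy_smul, ih]
  | measure q rest ih => simp only [run, conjBy_smul, ih, Finset.smul_sum]

/-- At a measurement the second circuit is copied into both branches; additivity of its channel
merges the copies into one run on the averaged state. -/
lemma Circuit.run_seq (τ : Q) (V : Fin n → Matrix (Bool × W) (Bool × W) ℂ) (C D : Circuit n Q)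
    (ρ : Matrix ((Q → Bool) × W) ((Q → Bool) × W) ℂ) :
    (C.seq D).run τ V ρ = D.run τ V (C.run τ V ρ) := by
  induction C generalizing ρ with
  | done => rfl
  | gate g rest ih => simp [run, seq, ih]
  | call k rest ih => simp [run, seq, ih]
  | measure q rest ih =>
    simp only [run, seq, ih, Fintype.sum_bool, Circuit.run_add]

end Seq

/-! ### Elementary gates on single wires -/

section OnWire

variable {Q W : Type} [Fintype Q] [DecidableEq Q] [Fintype W] [DecidableEq W]

/-- The Hadamard matrix. -/
noncomputable def hadamardMat : Matrix Bool Bool ℂ :=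
  Matrix.of fun x y => (if x && y then -1 else 1) / (√2 : ℝ)

/-- A one-wire matrix mixes only the two rows whose labels agree off `q`. -/
lemma onWire_mul_apply {T : Type} (q : Q) (M : Matrix Bool Bool ℂ)
    (A : Matrix ((Q → Bool) × W) T ℂ) (f : Q → Bool) (w : W) (t : T) :
    (onWire W q M * A) (f, w) t = ∑ x, M (f q) x * A (Function.update f q x, w) t := by
  rw [Matrix.mul_apply, Fintype.sum_bool]
  have key : ∀ y : (Q → Bool) × W, onWire W q M (f, w) y * A y t =
      (if y = (Function.update f q true, w) then M (f q) true * A y t else 0) +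
      (if y = (Function.update f q false, w) then M (f q) false * A y t else 0) := by
    rintro ⟨g, w'⟩
    simp only [onWire, Matrix.of_apply, Prod.mk.injEq]
    by_cases hw : w = w'
    · subst hw
      by_cases hg : ∀ q', q' ≠ q → f q' = g q'
      · rw [if_pos ⟨rfl, hg⟩]
        have h1 : ∀ x, g = Function.update f q x ↔ g q = x := by
          intro x
          constructor
          · rintro rfl; simp
          · rintro rfl; ext q'
            by_cases h : q' = q
            · subst h; simp
            · simp [h, hg q' h]
        cases hq : g q <;> simp [h1, hq]
      · have h1 : ∀ x, ¬ g = Function.update f q x := by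
          rintro x rfl
          exact hg fun q' h => by simp [h]
        simp [hg, h1]
    · simp [hw, Ne.symm hw]
  simp only [key, Finset.sum_add_distrib, Finset.sum_ite_eq', Finset.mem_univ, if_true]

lemma onWire_mul_onWire (q : Q) (M N : Matrix Bool Bool ℂ) :
    onWire W q M * onWire W q N = onWire W q (M * N) := by
  ext ⟨f, w⟩ ⟨g, w'⟩
  rw [onWire_mul_apply]
  simp only [onWire, Matrix.of_apply, Matrix.mul_apply, Function.update_self]
  have h : ∀ x, (∀ q', q' ≠ q → Function.update f q x q' = g q') ↔ ∀ q', q' ≠ q → f q' = g q' := by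
    intro x
    refine forall_congr' fun q' => forall_congr' fun h => ?_
    rw [Function.update_of_ne h]
  simp only [h]
  split_ifs with h' <;> simp

/-- For an involution, `f = g f'` is equivalent to `f' = g f`, so each row of the product is a
single row of `A`. CNOT and Toffoli are of this kind. -/
lemma basisMap_mul_apply {T : Type} (g : (Q → Bool) → (Q → Bool)) (hg : Function.Involutive g)
    (A : Matrix ((Q → Bool) × W) T ℂ) (f : Q → Bool) (w : W) (t : T) :
    (basisMap W g * A) (f, w) t = A (g f, w) t := by
  rw [Matrix.mul_apply, Finset.sum_eq_single (g f, w)]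
  · simp [basisMap, hg f]
  · rintro ⟨f', w'⟩ _ h
    have : ¬ (w = w' ∧ f = g f') := by
      rintro ⟨rfl, rfl⟩
      exact h (by rw [hg f'])
    simp [basisMap, this]
  · simp

lemma hadamard_mat (q : Q) : Gate.mat W (Gate.hadamard q) = onWire W q hadamardMat := rfl

lemma sqrt_two_inv_sq : ((√2 : ℝ) : ℂ)⁻¹ * ((√2 : ℝ) : ℂ)⁻¹ = 1 / 2 := by
  rw [← mul_inv, ← Complex.ofReal_mul, Real.mul_self_sqrt (by norm_num)]
  norm_num

lemma phase_mul_phase (q : Q) : Gate.mat W (Gate.phase q) * Gate.mat W (Gate.phase q) =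
    onWire W q (Matrix.diagonal fun x => if x then -1 else 1) := by
  simp only [Gate.mat, onWire_mul_onWire, Matrix.diagonal_mul_diagonal]
  congr 2; ext x; cases x <;> simp

lemma hadamard_z_hadamard (q : Q) :
    onWire W q hadamardMat * (onWire W q (Matrix.diagonal fun x => if x then -1 else 1) *
      onWire W q hadamardMat) = onWire W q (Matrix.of fun x y => if x = !y then 1 else 0) := by
  simp only [onWire_mul_onWire]
  congr 1
  ext x y
  have := sqrt_two_inv_sq
  cases x <;> cases y <;> simp [hadamardMat, Matrix.mul_apply, Matrix.diagonal, div_eq_mul_inv, this]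
  all_goals norm_num

lemma cnot_involutive {a t : Q} (h : a ≠ t) :
    Function.Involutive fun y : Q → Bool => Function.update y t (y t ^^ y a) := by
  intro y; ext q
  by_cases hq : q = t
  · subst hq; simp [h]
  · simp [hq]

lemma toffoli_involutive {a b t : Q} (h : a ≠ t) (h' : b ≠ t) :
    Function.Involutive fun y : Q → Bool => Function.update y t (y t ^^ (y a && y b)) := by
  intro y; ext q
  by_cases hq : q = t
  · subst hq; simp [h, h']
  · simp [hq]

/-- Hadamards on the target turn the controlled NOT into a controlled `Z`, which is a sign. -/
lemma hadamard_cnot_hadamard_apply {T : Type} {a t : Q} (h : a ≠ t)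
    (A : Matrix ((Q → Bool) × W) T ℂ) (f : Q → Bool) (w : W) (s : T) :
    (onWire W t hadamardMat * (Gate.mat W (Gate.cnot a t h) * (onWire W t hadamardMat * A)))
      (f, w) s = (if f a && f t then -1 else 1) * A (f, w) s := by
  rw [onWire_mul_apply]
  simp only [Gate.mat, basisMap_mul_apply _ (cnot_involutive h), onWire_mul_apply,
    Function.update_self, Function.update_idem, Function.update_of_ne h]
  have h2 := sqrt_two_inv_sq
  have h3 : ∀ x, f t = x → Function.update f t x = f := fun x hx => by simp [← hx]
  cases ha : f a <;> cases ht : f t <;>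
    simp [hadamardMat, div_eq_mul_inv, h3 _ ht] <;> ring_nf <;>
    rw [pow_two, h2] <;> ring

end OnWire

/-! ### Families of signed basis states -/

section Emb

variable {Q W : Type} [Fintype Q] [DecidableEq Q] [Fintype W] [DecidableEq W]
variable {L : Type} [Fintype L] [DecidableEq L]

/-- The linear map `|l⟩|w⟩ ↦ (-1)^{F l} |v l⟩|w⟩`. -/
def emb (W : Type) [DecidableEq W] (v : L → Q → Bool) (F : L → Bool) :
    Matrix ((Q → Bool) × W) (L × W) ℂ :=
  Matrix.of fun x y => if x.2 = y.2 ∧ x.1 = v y.1 then (if F y.1 then -1 else 1) else 0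

lemma basisMap_mul_emb (g : (Q → Bool) → (Q → Bool)) (hg : Function.Involutive g)
    (v : L → Q → Bool) (F : L → Bool) :
    basisMap W g * emb W v F = emb W (fun l => g (v l)) F := by
  ext ⟨f, w⟩ ⟨l, w'⟩
  rw [basisMap_mul_apply g hg]
  simp only [emb, Matrix.of_apply, hg.eq_iff]

lemma sum_update_emb (q : Q) (v : L → Q → Bool) (F : L → Bool) (f : Q → Bool) (w : W)
    (l : L) (w' : W) (M : Bool → ℂ) :
    ∑ x, M x * emb W v F (Function.update f q x, w) (l, w') =
      if w = w' ∧ ∀ q', q' ≠ q → f q' = v l q' then M (v l q) * (if F l then -1 else 1) else 0 := by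
  have h : ∀ x, Function.update f q x = v l ↔ x = v l q ∧ ∀ q', q' ≠ q → f q' = v l q' := by
    intro x
    rw [Function.update_eq_iff]
  simp only [emb, Matrix.of_apply, h]
  generalize (if F l then (-1 : ℂ) else 1) = s
  by_cases h1 : w = w'
  · by_cases h2 : ∀ q', q' ≠ q → f q' = v l q'
    · rw [if_pos ⟨h1, h2⟩, Finset.sum_eq_single (v l q)]
      · rw [if_pos ⟨h1, rfl, h2⟩]
      · intro b _ hb
        rw [if_neg (fun h => hb h.2.1), mul_zero]
      · simp
    · rw [if_neg (fun h => h2 h.2)]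
      exact Finset.sum_eq_zero fun x _ => by rw [if_neg (fun h => h2 h.2.2), mul_zero]
  · simp [h1]

lemma onWire_mul_emb_apply (q : Q) (M : Matrix Bool Bool ℂ) (v : L → Q → Bool) (F : L → Bool)
    (f : Q → Bool) (w : W) (l : L) (w' : W) :
    (onWire W q M * emb W v F) (f, w) (l, w') =
      if w = w' ∧ ∀ q', q' ≠ q → f q' = v l q' then
        M (f q) (v l q) * (if F l then -1 else 1) else 0 := by
  rw [onWire_mul_apply, sum_update_emb]

lemma not_mul_emb (q : Q) (v : L → Q → Bool) (F : L → Bool) :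
    onWire W q (Matrix.of fun x y => if x = !y then 1 else 0) * emb W v F =
      emb W (fun l => Function.update (v l) q (!v l q)) F := by
  ext ⟨f, w⟩ ⟨l, w'⟩
  rw [onWire_mul_emb_apply]
  simp only [emb, Matrix.of_apply, Function.eq_update_iff]
  by_cases h1 : w = w' <;> by_cases h2 : ∀ q', q' ≠ q → f q' = v l q' <;>
    by_cases h3 : f q = !v l q <;> simp [h1, h2, h3]

lemma z_mul_emb (q : Q) (v : L → Q → Bool) (F : L → Bool) :
    onWire W q (Matrix.diagonal fun x => if x then -1 else 1) * emb W v F =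
      emb W v (fun l => F l ^^ v l q) := by
  ext ⟨f, w⟩ ⟨l, w'⟩
  rw [onWire_mul_emb_apply]
  have h : f = v l ↔ f q = v l q ∧ ∀ q', q' ≠ q → f q' = v l q' := by
    rw [← Function.eq_update_iff, Function.update_eq_self]
  simp only [emb, Matrix.of_apply, h, Matrix.diagonal]
  by_cases h1 : w = w' <;> by_cases h2 : ∀ q', q' ≠ q → f q' = v l q' <;>
    by_cases h3 : f q = v l q <;> simp [h1, h2, h3]
  cases v l q <;> cases F l <;> simp

lemma hcnoth_mul_emb {a t : Q} (h : a ≠ t) (v : L → Q → Bool) (F : L → Bool) :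
    onWire W t hadamardMat * (Gate.mat W (Gate.cnot a t h) *
      (onWire W t hadamardMat * emb W v F)) = emb W v (fun l => F l ^^ (v l a && v l t)) := by
  ext ⟨f, w⟩ ⟨l, w'⟩
  rw [hadamard_cnot_hadamard_apply]
  simp only [emb, Matrix.of_apply]
  by_cases h1 : w = w' <;> by_cases h2 : f = v l <;> simp [h1, h2]
  cases v l a <;> cases v l t <;> cases F l <;> simp

/-- The reason why erasure by measurement works: the bit stored in `q` survives only in the sign,
and the amplitude `1/√2` depends neither on the label nor on the outcome, so the outcome reveals
nothing about the superposition. -/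
lemma proj_hadamard_mul_emb (q : Q) (x : Bool) (v : L → Q → Bool) (F : L → Bool) :
    proj W q x * (onWire W q hadamardMat * emb W v F) =
      ((√2 : ℝ) : ℂ)⁻¹ •
        emb W (fun l => Function.update (v l) q x) (fun l => F l ^^ (x && v l q)) := by
  ext ⟨f, w⟩ ⟨l, w'⟩
  rw [proj, ← Matrix.mul_assoc, onWire_mul_onWire, onWire_mul_emb_apply]
  simp only [Matrix.smul_apply, emb, Matrix.of_apply, Function.eq_update_iff,
    Matrix.diagonal_mul, hadamardMat]
  by_cases h1 : w = w' <;> by_cases h2 : ∀ q', q' ≠ q → f q' = v l q' <;>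
    by_cases h3 : f q = x <;> simp only [h1, h2, h3, true_and, false_and, and_false, if_true,
      if_false, smul_zero, zero_mul]
  · rw [if_pos h2, if_pos h2]
    rcases Bool.eq_false_or_eq_true (v l q) with hy | hy <;>
    rcases Bool.eq_false_or_eq_true (F l) with hz | hz <;>
      cases x <;> simp [hy, hz, div_eq_mul_inv]
  all_goals simp

lemma conjBy_smul_left {S T : Type} [Fintype S] (z : ℂ) (A : Matrix T S ℂ) (ρ : Matrix S S ℂ) :
    conjBy (z • A) ρ = (z * star z) • conjBy A ρ := by
  simp [conjBy, smul_smul, mul_comm]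

/-- The circuit maps the signed basis states `(-1)^{F l} |v l⟩` to `(-1)^{F' l} |v' l⟩`,
coherently over the labels `l`. -/
def Tr {n : ℕ} (C : Circuit n Q) (v : L → Q → Bool) (F : L → Bool) (v' : L → Q → Bool)
    (F' : L → Bool) : Prop :=
  ∀ (W : Type) [Fintype W] [DecidableEq W] (τ : Q) (V : Fin n → Matrix (Bool × W) (Bool × W) ℂ)
    (ρ : Matrix (L × W) (L × W) ℂ),
      C.run τ V (conjBy (emb W v F) ρ) = conjBy (emb W v' F') ρ

/-! ### Gadgets acting on signed basis states -/

variable {n : ℕ} {v v' v'' : L → Q → Bool} {F F' F'' : L → Bool}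

lemma Tr.done : Tr (Circuit.done : Circuit n Q) v F v F := fun _ _ _ _ _ _ => rfl

lemma Tr.seq {C D : Circuit n Q} (hC : Tr C v F v' F') (hD : Tr D v' F' v'' F'') :
    Tr (C.seq D) v F v'' F'' := by
  intro W _ _ τ V ρ
  rw [Circuit.run_seq, hC, hD]

lemma Tr.congr {C : Circuit n Q} (h : Tr C v F v' F') (hv : ∀ l, v' l = v'' l)
    (hF : ∀ l, F' l = F'' l) : Tr C v F v'' F'' := by
  obtain rfl : v' = v'' := funext hv
  obtain rfl : F' = F'' := funext hF
  exact h

lemma Tr.congr_left {C : Circuit n Q} (h : Tr C v' F' v'' F'') (hv : ∀ l, v l = v' l)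
    (hF : ∀ l, F l = F' l) : Tr C v F v'' F'' := by
  obtain rfl : v = v' := funext hv
  obtain rfl : F = F' := funext hF
  exact h

/-- `CNOT` (nothing if the wires agree). -/
def cnotC (a t : Q) : Circuit n Q := if h : a ≠ t then .gate (.cnot a t h) .done else .done

/-- Toffoli gate (nothing if two wires agree). -/
def toffoliC (a b t : Q) : Circuit n Q :=
  if h : a ≠ b ∧ a ≠ t ∧ b ≠ t then .gate (.toffoli a b t h.1 h.2.1 h.2.2) .done else .done

/-- The Pauli `Z` gate. -/
def zC (q : Q) : Circuit n Q := .gate (.phase q) (.gate (.phase q) .done)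

/-- The Pauli `X` gate. -/
def xC (q : Q) : Circuit n Q :=
  .gate (.hadamard q) (.gate (.phase q) (.gate (.phase q) (.gate (.hadamard q) .done)))

/-- The controlled `Z` gate. -/
def czC (a t : Q) : Circuit n Q :=
  .gate (.hadamard t) ((cnotC a t).seq (.gate (.hadamard t) .done))

/-- Measure a wire in the Hadamard basis and reset it to `|0⟩`. -/
def measX (q : Q) (cont : Bool → Circuit n Q) : Circuit n Q :=
  .gate (.hadamard q) (.measure q fun x => if x then (xC q).seq (cont true) else cont false)

/-- Erase a wire by a measurement in the Hadamard basis; `D` repairs the sign. -/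
def eraseC (q : Q) (D : Circuit n Q) : Circuit n Q := measX q fun x => if x then D else .done

lemma Tr.cnot {a t : Q} (h : a ≠ t) :
    Tr (cnotC a t : Circuit n Q) v F (fun l => Function.update (v l) t (v l t ^^ v l a)) F := by
  intro W _ _ τ V ρ
  rw [cnotC, dif_pos h, Circuit.run, Circuit.run, ← conjBy_mul, Gate.mat,
    basisMap_mul_emb _ (cnot_involutive h)]

lemma Tr.toffoli {a b t : Q} (h : a ≠ b) (h' : a ≠ t) (h'' : b ≠ t) :
    Tr (toffoliC a b t : Circuit n Q) v F
      (fun l => Function.update (v l) t (v l t ^^ (v l a && v l b))) F := by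
  intro W _ _ τ V ρ
  rw [toffoliC, dif_pos ⟨h, h', h''⟩, Circuit.run, Circuit.run, ← conjBy_mul, Gate.mat,
    basisMap_mul_emb _ (toffoli_involutive h' h'')]

lemma Tr.z {q : Q} : Tr (zC q : Circuit n Q) v F v (fun l => F l ^^ v l q) := by
  intro W _ _ τ V ρ
  rw [zC, Circuit.run, Circuit.run, Circuit.run, ← conjBy_mul, ← conjBy_mul,
    phase_mul_phase, z_mul_emb]

lemma Tr.x {q : Q} :
    Tr (xC q : Circuit n Q) v F (fun l => Function.update (v l) q (!v l q)) F := by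
  intro W _ _ τ V ρ
  simp only [xC, Circuit.run, ← conjBy_mul]
  rw [← not_mul_emb, ← hadamard_z_hadamard, ← phase_mul_phase, hadamard_mat]
  simp only [Matrix.mul_assoc]

lemma Tr.cz {a t : Q} (h : a ≠ t) :
    Tr (czC a t : Circuit n Q) v F v (fun l => F l ^^ (v l a && v l t)) := by
  intro W _ _ τ V ρ
  simp only [czC, cnotC, dif_pos h, Circuit.seq, Circuit.run, ← conjBy_mul]
  rw [← hcnoth_mul_emb h]
  simp only [hadamard_mat]

/-- Both outcomes have weight `1/2` and, after the reset of the wire, differ only by the sign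
`(-1)^(v l q)`, which the continuation for outcome `1` inherits. -/
lemma run_measX (q : Q) (cont : Bool → Circuit n Q) (τ : Q)
    (V : Fin n → Matrix (Bool × W) (Bool × W) ℂ) (ρ : Matrix (L × W) (L × W) ℂ) :
    (measX q cont).run τ V (conjBy (emb W v F) ρ) =
      ∑ x, (1 / 2 : ℂ) • (cont x).run τ V
        (conjBy (emb W (fun l => Function.update (v l) q false) (fun l => F l ^^ (x && v l q))) ρ) := by
  have h2 : ((√2 : ℝ) : ℂ)⁻¹ * star ((√2 : ℝ) : ℂ)⁻¹ = 1 / 2 := by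
    rw [star_inv₀, Complex.star_def, Complex.conj_ofReal, sqrt_two_inv_sq]
  simp only [measX, Circuit.run, hadamard_mat]
  refine Finset.sum_congr rfl fun x _ => ?_
  rw [← conjBy_mul, ← conjBy_mul, Matrix.mul_assoc, proj_hadamard_mul_emb, conjBy_smul_left, h2,
    Circuit.run_smul]
  cases x with
  | false => simp
  | true =>
    simp only [if_true, Circuit.run_seq]
    rw [Tr.x]
    simp

/-- Outcome `0` already leaves the wanted state and outcome `1` needs only the sign correction `D`;
the two branches then coincide and their weights add up to `1`. An AND computed by a Toffoli is thus
uncomputed with a controlled `Z` and no Toffoli. -/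
lemma Tr.erase {q : Q} {D : Circuit n Q}
    (hD : Tr D (fun l => Function.update (v l) q false) (fun l => F l ^^ v l q)
      (fun l => Function.update (v l) q false) F) :
    Tr (eraseC q D) v F (fun l => Function.update (v l) q false) F := by
  intro W _ _ τ V ρ
  rw [eraseC, run_measX, Fintype.sum_bool]
  simp only [Bool.true_and, Bool.false_and, Bool.xor_false, if_true]
  rw [hD]
  simp only [Circuit.run, Bool.false_eq_true, if_false]
  rw [← add_smul]
  norm_num

@[simp] lemma toffoliCount_cnotC (a t : Q) : (cnotC a t : Circuit n Q).toffoliCount = 0 := by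
  unfold cnotC; split_ifs <;> rfl

lemma toffoliCount_toffoliC (a b t : Q) : (toffoliC a b t : Circuit n Q).toffoliCount ≤ 1 := by
  unfold toffoliC; split_ifs <;> simp [Circuit.toffoliCount]

@[simp] lemma toffoliCount_zC (q : Q) : (zC q : Circuit n Q).toffoliCount = 0 := rfl

@[simp] lemma toffoliCount_xC (q : Q) : (xC q : Circuit n Q).toffoliCount = 0 := rfl

@[simp] lemma toffoliCount_czC (a t : Q) : (czC a t : Circuit n Q).toffoliCount = 0 := by
  simp [czC, Circuit.toffoliCount, Circuit.toffoliCount_seq]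

lemma toffoliCount_measX {q : Q} {cont : Bool → Circuit n Q} {T : ℕ}
    (h : ∀ x, (cont x).toffoliCount ≤ T) : (measX q cont).toffoliCount ≤ T := by
  simp [measX, Circuit.toffoliCount, Circuit.toffoliCount_seq, h]

@[simp] lemma toffoliCount_eraseC (q : Q) (D : Circuit n Q) :
    (eraseC q D).toffoliCount = D.toffoliCount := by
  simp [eraseC, measX, Circuit.toffoliCount, Circuit.toffoliCount_seq]

lemma calls_cnotC (a t : Q) : (cnotC a t : Circuit n Q).Calls [] := by
  unfold cnotC; split_ifs <;> simp [Circuit.Calls]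

lemma calls_toffoliC (a b t : Q) : (toffoliC a b t : Circuit n Q).Calls [] := by
  unfold toffoliC; split_ifs <;> simp [Circuit.Calls]

lemma calls_zC (q : Q) : (zC q : Circuit n Q).Calls [] := rfl

lemma calls_xC (q : Q) : (xC q : Circuit n Q).Calls [] := rfl

lemma calls_czC (a t : Q) : (czC a t : Circuit n Q).Calls [] :=
  (calls_cnotC a t).seq_nil rfl

lemma calls_measX {q : Q} {cont : Bool → Circuit n Q} {l : List (Fin n)}
    (h : ∀ x, (cont x).Calls l) : (measX q cont).Calls l := by
  intro x
  cases x
  · exact h false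
  · exact (calls_xC q).seq_nil (h true)

lemma calls_eraseC {q : Q} {D : Circuit n Q} (h : D.Calls []) : (eraseC q D).Calls [] :=
  calls_measX fun x => by cases x <;> simp [h, Circuit.Calls]

end Emb

/-! ### Addresses of wires -/

/-- Addresses of wires: control bits, the rotated qubit, bits of the phase-gradient register and
ancillae. -/
inductive Ad : Type
  | c (i : ℕ) : Ad
  | z : Ad
  | y (i : ℕ) : Ad
  | x (i : ℕ) : Ad
  deriving DecidableEq

section Address

variable {m r s : ℕ}

/-- The address of a wire. -/
def ad : Wire m r s → Ad
  | .inl (.inl i) => .c i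
  | .inl (.inr _) => .z
  | .inr (.inl i) => .y i
  | .inr (.inr i) => .x i

/-- The wire with a given address, if there is one. -/
def wire (m r s : ℕ) : Ad → Wire m r s
  | .c i => if h : i < m then .inl (.inl ⟨i, h⟩) else .inl (.inr ())
  | .z => .inl (.inr ())
  | .y i => if h : i < r then .inr (.inl ⟨i, h⟩) else .inl (.inr ())
  | .x i => if h : i < s then .inr (.inr ⟨i, h⟩) else .inl (.inr ())

/-- The addresses in use. -/
def Ad.Valid (m r s : ℕ) : Ad → Prop
  | .c i => i < m
  | .z => True
  | .y i => i < r
  | .x i => i < s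

@[simp] lemma Ad.valid_c {i : ℕ} : (Ad.c i).Valid m r s ↔ i < m := Iff.rfl
@[simp] lemma Ad.valid_z : Ad.z.Valid m r s := trivial
@[simp] lemma Ad.valid_y {i : ℕ} : (Ad.y i).Valid m r s ↔ i < r := Iff.rfl
@[simp] lemma Ad.valid_x {i : ℕ} : (Ad.x i).Valid m r s ↔ i < s := Iff.rfl

lemma ad_wire {a : Ad} (h : a.Valid m r s) : ad (wire m r s a) = a := by
  cases a <;> simp_all [wire, ad]

lemma ad_injective : Function.Injective (ad : Wire m r s → Ad) := by
  rintro ((i | i) | (i | i)) ((j | j) | (j | j)) <;> simp [ad, Fin.ext_iff]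

lemma wire_ne {a b : Ad} (ha : a.Valid m r s) (hb : b.Valid m r s) (h : a ≠ b) :
    wire m r s a ≠ wire m r s b := fun e => h (by rw [← ad_wire ha, e, ad_wire hb])

lemma update_comp_ad {a : Ad} (ha : a.Valid m r s) (u : Ad → Bool) (b : Bool) :
    Function.update (fun q : Wire m r s => u (ad q)) (wire m r s a) b =
      fun q => Function.update u a b (ad q) := by
  ext q
  by_cases h : q = wire m r s a
  · subst h; simp [ad_wire ha]
  · have : ad q ≠ a := fun e => h (ad_injective (by rw [e, ad_wire ha]))
    simp [h, this]

/-- Circuits on the wires of the multiplexed gate. -/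
abbrev Circ (n m r s : ℕ) : Type := Circuit n (Wire m r s)

/-! ### Gadgets on addresses, so that positions of wires become arithmetic of natural numbers -/

variable {n : ℕ} {L : Type} [Fintype L] [DecidableEq L]

/-- The version of `Tr` for basis states given on addresses. -/
def TrA (C : Circ n m r s) (v : L → Ad → Bool) (F : L → Bool) (v' : L → Ad → Bool)
    (F' : L → Bool) : Prop :=
  Tr C (fun l q => v l (ad q)) F (fun l q => v' l (ad q)) F'

variable {v v' v'' : L → Ad → Bool} {F F' F'' : L → Bool}

lemma TrA.done : TrA (Circuit.done : Circ n m r s) v F v F := Tr.done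

lemma TrA.seq {C D : Circ n m r s} (hC : TrA C v F v' F') (hD : TrA D v' F' v'' F'') :
    TrA (C.seq D) v F v'' F'' := Tr.seq hC hD

lemma TrA.congr {C : Circ n m r s} (h : TrA C v F v' F') (hv : ∀ l, v' l = v'' l)
    (hF : ∀ l, F' l = F'' l) : TrA C v F v'' F'' := by
  obtain rfl : v' = v'' := funext hv
  obtain rfl : F' = F'' := funext hF
  exact h

lemma TrA.congr_left {C : Circ n m r s} (h : TrA C v' F' v'' F'') (hv : ∀ l, v l = v' l)
    (hF : ∀ l, F l = F' l) : TrA C v F v'' F'' := by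
  obtain rfl : v = v' := funext hv
  obtain rfl : F = F' := funext hF
  exact h

/-- `CNOT` on addresses. -/
def cx (a t : Ad) : Circ n m r s := cnotC (wire m r s a) (wire m r s t)

/-- Pauli `X` with an optional control. -/
def ctrlX : Option Ad → Ad → Circ n m r s
  | none, t => xC (wire m r s t)
  | some a, t => cx a t

/-- `t ⊕= p ∧ b` with an optional control `p`. -/
def ctrlAnd : Option Ad → Ad → Ad → Circ n m r s
  | none, b, t => cx b t
  | some a, b, t => toffoliC (wire m r s a) (wire m r s b) (wire m r s t)

/-- Pauli `Z` with an optional control. -/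
def ctrlZ : Option Ad → Ad → Circ n m r s
  | none, b => zC (wire m r s b)
  | some a, b => czC (wire m r s a) (wire m r s b)

/-- The value of an optional control. -/
def on : Option Ad → (Ad → Bool) → Bool
  | none, _ => true
  | some a, u => u a

/-- Erase the wire with address `a`. -/
def erase (a : Ad) (D : Circ n m r s) : Circ n m r s := eraseC (wire m r s a) D

lemma TrA.cx {a t : Ad} (ha : a.Valid m r s) (ht : t.Valid m r s) (h : a ≠ t) :
    TrA (cx a t : Circ n m r s) v F (fun l => Function.update (v l) t (v l t ^^ v l a)) F := by
  refine Tr.congr (Tr.cnot (wire_ne ha ht h)) (fun l => ?_) fun _ => rfl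
  rw [update_comp_ad ht, ad_wire ha, ad_wire ht]

lemma TrA.x {t : Ad} (ht : t.Valid m r s) :
    TrA (xC (wire m r s t) : Circ n m r s) v F (fun l => Function.update (v l) t (!v l t)) F := by
  refine Tr.congr Tr.x (fun l => ?_) fun _ => rfl
  rw [update_comp_ad ht, ad_wire ht]

lemma TrA.ctrlX {p : Option Ad} {t : Ad} (hp : ∀ a ∈ p, a.Valid m r s ∧ a ≠ t)
    (ht : t.Valid m r s) : TrA (ctrlX p t : Circ n m r s) v F
      (fun l => Function.update (v l) t (v l t ^^ on p (v l))) F := by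
  cases p with
  | none => exact (TrA.x ht).congr (fun l => by simp [on]) fun _ => rfl
  | some a => exact TrA.cx (hp a rfl).1 ht (hp a rfl).2

lemma TrA.toffoli {a b t : Ad} (ha : a.Valid m r s) (hb : b.Valid m r s) (ht : t.Valid m r s)
    (h : a ≠ b) (h' : a ≠ t) (h'' : b ≠ t) :
    TrA (ctrlAnd (some a) b t : Circ n m r s) v F
      (fun l => Function.update (v l) t (v l t ^^ (v l a && v l b))) F := by
  refine Tr.congr (Tr.toffoli (wire_ne ha hb h) (wire_ne ha ht h') (wire_ne hb ht h''))
    (fun l => ?_) fun _ => rfl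
  rw [update_comp_ad ht, ad_wire ha, ad_wire ht, ad_wire hb]

lemma TrA.ctrlAnd {p : Option Ad} {b t : Ad} (hp : ∀ a ∈ p, a.Valid m r s ∧ a ≠ b ∧ a ≠ t)
    (hb : b.Valid m r s) (ht : t.Valid m r s) (hbt : b ≠ t) :
    TrA (ctrlAnd p b t : Circ n m r s) v F
      (fun l => Function.update (v l) t (v l t ^^ (on p (v l) && v l b))) F := by
  cases p with
  | none => exact (TrA.cx hb ht hbt).congr (fun l => by simp [on]) fun _ => rfl
  | some a =>
    obtain ⟨h1, h2, h3⟩ := hp a rfl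
    exact TrA.toffoli h1 hb ht h2 h3 hbt

lemma TrA.ctrlZ {p : Option Ad} {b : Ad} (hp : ∀ a ∈ p, a.Valid m r s ∧ a ≠ b)
    (hb : b.Valid m r s) :
    TrA (ctrlZ p b : Circ n m r s) v F v (fun l => F l ^^ (on p (v l) && v l b)) := by
  cases p with
  | none => exact Tr.congr Tr.z (fun _ => rfl) fun l => by simp [on, ad_wire hb]
  | some a =>
    obtain ⟨h1, h2⟩ := hp a rfl
    exact Tr.congr (Tr.cz (wire_ne h1 hb h2)) (fun _ => rfl)
      fun l => by simp [on, ad_wire hb, ad_wire h1]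

lemma TrA.erase {a : Ad} {D : Circ n m r s} (ha : a.Valid m r s)
    (hD : TrA D (fun l => Function.update (v l) a false) (fun l => F l ^^ v l a)
      (fun l => Function.update (v l) a false) F) :
    TrA (erase a D) v F (fun l => Function.update (v l) a false) F := by
  have e : ∀ l, Function.update (fun q : Wire m r s => v l (ad q)) (wire m r s a) false =
      fun q => Function.update (v l) a false (ad q) := fun l => update_comp_ad ha _ _
  refine Tr.congr (Tr.erase ?_) e fun _ => rfl
  exact Tr.congr (Tr.congr_left hD e fun l => by rw [ad_wire ha]) (fun l => (e l).symm)
    fun _ => rfl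

@[simp] lemma toffoliCount_cx (a t : Ad) : (cx a t : Circ n m r s).toffoliCount = 0 :=
  toffoliCount_cnotC _ _

@[simp] lemma toffoliCount_ctrlX (p : Option Ad) (t : Ad) :
    (ctrlX p t : Circ n m r s).toffoliCount = 0 := by
  cases p <;> simp [ctrlX]

@[simp] lemma toffoliCount_ctrlZ (p : Option Ad) (t : Ad) :
    (ctrlZ p t : Circ n m r s).toffoliCount = 0 := by
  cases p <;> simp [ctrlZ]

lemma toffoliCount_ctrlAnd (p : Option Ad) (b t : Ad) :
    (ctrlAnd p b t : Circ n m r s).toffoliCount ≤ 1 := by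
  cases p <;> simp [ctrlAnd, toffoliCount_toffoliC]

@[simp] lemma toffoliCount_erase (a : Ad) (D : Circ n m r s) :
    (erase a D).toffoliCount = D.toffoliCount := toffoliCount_eraseC _ _

lemma calls_cx (a t : Ad) : (cx a t : Circ n m r s).Calls [] := calls_cnotC _ _

lemma calls_ctrlX (p : Option Ad) (t : Ad) : (ctrlX p t : Circ n m r s).Calls [] := by
  cases p
  · exact calls_xC _
  · exact calls_cx _ _

lemma calls_ctrlAnd (p : Option Ad) (b t : Ad) : (ctrlAnd p b t : Circ n m r s).Calls [] := by
  cases p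
  · exact calls_cx _ _
  · exact calls_toffoliC _ _ _

lemma calls_ctrlZ (p : Option Ad) (b : Ad) : (ctrlZ p b : Circ n m r s).Calls [] := by
  cases p
  · exact calls_zC _
  · exact calls_czC _ _

lemma calls_erase {a : Ad} {D : Circ n m r s} (h : D.Calls []) : (erase a D).Calls [] :=
  calls_eraseC h

/-! ### Unary iteration -/

/-- Unary iteration: runs `leaf p q`, where `p` carries the condition that the control bits from
`β` on have the value `q`, for all `q < N` whose leading bits, above the lowest `d` bits, are `h`. -/
def walk (leaf : Option Ad → ℕ → Circ n m r s) (β κ N : ℕ) : ℕ → Option Ad → ℕ → Circ n m r s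
  | 0, p, h => leaf p h
  | d + 1, p, h =>
    if (2 * h + 1) * 2 ^ d < N then
      (ctrlAnd p (.c (β + d)) (.x (κ + d))).seq <|
      (ctrlX p (.x (κ + d))).seq <|
      (walk leaf β κ N d (some (.x (κ + d))) (2 * h)).seq <|
      (ctrlX p (.x (κ + d))).seq <|
      (walk leaf β κ N d (some (.x (κ + d))) (2 * h + 1)).seq <|
      erase (.x (κ + d)) (ctrlZ p (.c (β + d)))
    else walk leaf β κ N d p (2 * h)

lemma calls_walk {leaf : Option Ad → ℕ → Circ n m r s} (hl : ∀ p q, (leaf p q).Calls [])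
    (β κ N d : ℕ) (p : Option Ad) (h : ℕ) : (walk leaf β κ N d p h).Calls [] := by
  induction d generalizing p h with
  | zero => exact hl p h
  | succ d ih =>
    unfold walk
    split_ifs
    · exact (calls_ctrlAnd _ _ _).seq_nil <| (calls_ctrlX _ _).seq_nil <| (ih _ _).seq_nil <|
        (calls_ctrlX _ _).seq_nil <| (ih _ _).seq_nil <| calls_erase (calls_ctrlZ _ _)
    · exact ih _ _

/-- A binary tree has one branching node fewer than leaves, and each branching node costs at most
one Toffoli since its ancilla is erased by measurement. The minimum is the number of leaves below
the node that lie in range. -/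
lemma toffoliCount_walk {leaf : Option Ad → ℕ → Circ n m r s}
    (hl : ∀ p q, (leaf p q).toffoliCount = 0) (β κ N d : ℕ) (p : Option Ad) (h : ℕ)
    (hN : h * 2 ^ d < N) :
    (walk leaf β κ N d p h).toffoliCount + 1 ≤ min (2 ^ d) (N - h * 2 ^ d) := by
  induction d generalizing p h with
  | zero => simp only [walk, hl]; simp at hN ⊢; omega
  | succ d ih =>
    have e0 : 2 ^ (d + 1) = 2 * 2 ^ d := by ring
    have e1 : (2 * h + 1) * 2 ^ d = 2 * (h * 2 ^ d) + 2 ^ d := by ring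
    have e2 : 2 * h * 2 ^ d = 2 * (h * 2 ^ d) := by ring
    have e3 : h * 2 ^ (d + 1) = 2 * (h * 2 ^ d) := by ring
    unfold walk
    split_ifs with hc
    · simp only [Circuit.toffoliCount_seq, toffoliCount_ctrlX, toffoliCount_erase,
        toffoliCount_ctrlZ]
      have h1 := toffoliCount_ctrlAnd (n := n) (m := m) (r := r) (s := s) p (.c (β + d))
        (.x (κ + d))
      have h2 := ih (some (.x (κ + d))) (2 * h) (by omega)
      have h3 := ih (some (.x (κ + d))) (2 * h + 1) hc
      rw [e1] at h3
      rw [e2] at h2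
      rw [e3, e0]
      omega
    · have h2 := ih p (2 * h) (by omega)
      rw [e2] at h2
      rw [e3, e0]
      omega

/-- Lengthening the prefix `h` of `J` by the bit `d` gives `2 * h + 1` or, in the next lemma, `2 *
h`. -/
lemma testBit_eq_decide_div (J d h : ℕ) :
    ((decide (J / 2 ^ (d + 1) = h)) && J.testBit d) = decide (J / 2 ^ d = 2 * h + 1) := by
  rw [Nat.testBit_eq_decide_div_mod_eq, pow_succ, ← Nat.div_div_eq_div_mul]
  rw [← Bool.decide_and, decide_eq_decide]
  omega

lemma not_testBit_eq_decide_div (J d h : ℕ) :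
    ((decide (J / 2 ^ (d + 1) = h)) && !J.testBit d) = decide (J / 2 ^ d = 2 * h) := by
  rw [Nat.testBit_eq_decide_div_mod_eq, pow_succ, ← Nat.div_div_eq_div_mul, ← decide_not]
  rw [← Bool.decide_and, decide_eq_decide]
  omega

/-- For each label exactly one leaf, `q = J l`, is active, so the whole walk acts as that leaf. The
path ancillae must be invisible to the leaf: `hGx` and `hσ` say that its action commutes with
changing them and that its sign ignores them. The induction goes down the tree, with the invariant
`hon` that the control `p` of a node tells whether `h` is the prefix of `J l`. -/
lemma TrA.walk {leaf : Option Ad → ℕ → Circ n m r s} {β κ N D : ℕ}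
    {G : ℕ → (Ad → Bool) → Ad → Bool} {σ : ℕ → (Ad → Bool) → Bool}
    (hβ : β + D ≤ m) (hκ : κ + D ≤ s)
    (hleaf : ∀ (p : Option Ad) (q : ℕ) (v : L → Ad → Bool) (F : L → Bool),
      (∀ a ∈ p, ∃ e < D, a = .x (κ + e)) →
      TrA (leaf p q) v F (fun l => if on p (v l) then G q (v l) else v l)
        (fun l => F l ^^ (on p (v l) && σ q (v l))))
    (hGc : ∀ q u i, G q u (.c i) = u (.c i))
    (hGx : ∀ q u, ∀ i < D, ∀ b,
      G q (Function.update u (.x (κ + i)) b) = Function.update (G q u) (.x (κ + i)) b)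
    (hσ : ∀ q u, ∀ i < D, ∀ b, σ q (Function.update u (.x (κ + i)) b) = σ q u)
    (d : ℕ) (hd : d ≤ D) (p : Option Ad) (hp : ∀ a ∈ p, ∃ e < D, d ≤ e ∧ a = .x (κ + e)) (h : ℕ)
    (J : L → ℕ) (hJ : ∀ l, J l < N) (v : L → Ad → Bool) (F : L → Bool)
    (hb : ∀ l, ∀ i < D, v l (.c (β + i)) = (J l).testBit i)
    (hx : ∀ l, ∀ i < d, v l (.x (κ + i)) = false)
    (hon : ∀ l, on p (v l) = decide (J l / 2 ^ d = h)) :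
    TrA (walk leaf β κ N d p h) v F
      (fun l => if J l / 2 ^ d = h then G (J l) (v l) else v l)
      (fun l => F l ^^ (decide (J l / 2 ^ d = h) && σ (J l) (v l))) := by
  have hGx' : ∀ q u, ∀ i < D, G q u (.x (κ + i)) = u (.x (κ + i)) := by
    intro q u i hi
    have := congrFun (hGx q u i hi (u (.x (κ + i)))) (.x (κ + i))
    simpa using this
  induction d generalizing p h v F with
  | zero =>
    refine (hleaf p h v F fun a ha => ?_).congr (fun l => ?_) fun l => ?_
    · obtain ⟨e, h1, -, h2⟩ := hp a ha
      exact ⟨e, h1, h2⟩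
    · rw [hon]
      by_cases hc : J l / 2 ^ 0 = h
      · simp only [hc, decide_true, if_true]
        rw [← hc]; simp
      · simp only [hc, decide_false, Bool.false_eq_true, if_false]
    · rw [hon]
      by_cases hc : J l / 2 ^ 0 = h
      · simp only [hc, decide_true, Bool.true_and]
        rw [← hc]; simp
      · simp only [hc, decide_false, Bool.false_and]
  | succ d ih =>
    unfold QMux.walk
    have hdD : d < D := hd
    split_ifs with hN
    · have hpv : ∀ a ∈ p, a.Valid m r s ∧ a ≠ .x (κ + d) ∧ a ≠ .c (β + d) := by
        intro a ha
        obtain ⟨e, h1, h2, rfl⟩ := hp a ha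
        exact ⟨by simp; omega, by simp; omega, by simp⟩
      have hcv : (Ad.c (β + d)).Valid m r s := by simp; omega
      have hxv : (Ad.x (κ + d)).Valid m r s := by simp; omega
      -- Intermediate states: `c` marks the labels whose leaf has been executed and `b` is the
      -- content of the path ancilla of this node. They are kept opaque to avoid unfolding.
      obtain ⟨T, hT⟩ : ∃ T : (L → Bool) → (L → Bool) → L → Ad → Bool, T = fun c b l =>
        Function.update (if c l then G (J l) (v l) else v l) (.x (κ + d)) (b l) := ⟨_, rfl⟩
      obtain ⟨S, hS⟩ : ∃ S : (L → Bool) → L → Bool,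
        S = fun c l => F l ^^ (c l && σ (J l) (v l)) := ⟨_, rfl⟩
      have onT : ∀ c b l, on p (T c b l) = decide (J l / 2 ^ (d + 1) = h) := by
        intro c b l
        rw [← hon]
        cases hpp : p with
        | none => rfl
        | some a =>
          obtain ⟨e, h1, h2, rfl⟩ := hp a hpp
          simp only [on, hT]
          rw [Function.update_of_ne (by simp; omega)]
          split_ifs
          · exact hGx' _ _ _ h1
          · rfl
      have cT : ∀ c b l, ∀ i < D, T c b l (.c (β + i)) = (J l).testBit i := by
        intro c b l i hi
        simp only [hT]
        rw [Function.update_of_ne (by simp), ← hb l i hi]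
        split_ifs
        · exact hGc _ _ _
        · rfl
      have xT : ∀ c b l, ∀ i < d, T c b l (.x (κ + i)) = false := by
        intro c b l i hi
        simp only [hT]
        rw [Function.update_of_ne (by simp; omega), ← hx l i (by omega)]
        split_ifs
        · exact hGx' _ _ _ (by omega)
        · rfl
      have dT : ∀ c b l, T c b l (.x (κ + d)) = b l := by simp [hT]
      have uT : ∀ c b l b', Function.update (T c b l) (.x (κ + d)) (b' l) = T c b' l := by
        simp [hT]
      -- One subtree enlarges the set `c` of finished labels by those with prefix `h'`, which must
      -- not be finished before.
      have sub : ∀ (c : L → Bool) (h' : ℕ) (c' : L → Bool)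
          (_ : ∀ l, c' l = (c l || decide (J l / 2 ^ d = h')))
          (_ : ∀ l, (c l && decide (J l / 2 ^ d = h')) = false),
          TrA (QMux.walk leaf β κ N d (some (.x (κ + d))) h')
            (T c fun l => decide (J l / 2 ^ d = h')) (S c)
            (T c' fun l => decide (J l / 2 ^ d = h')) (S c') := by
        intro c h' c' hc' hcc
        refine (ih (by omega) (some (.x (κ + d))) ?_ h' (T c _) (S c) (cT _ _) (xT _ _) ?_).congr
          (fun l => ?_) fun l => ?_
        · rintro a ⟨⟩
          exact ⟨d, hdD, le_rfl, rfl⟩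
        · intro l
          simp only [on, dT]
        · have h1 := hc' l
          have h2 := hcc l
          by_cases hh : J l / 2 ^ d = h'
          · simp only [hh, decide_true, Bool.and_true, Bool.or_true] at h1 h2
            simp only [hT, h1, h2, hh, if_true, hGx _ _ _ hdD, Bool.false_eq_true, if_false]
          · simp only [hh, decide_false, Bool.or_false] at h1
            simp only [hT, h1, hh, if_false]
        · have h1 := hc' l
          have h2 := hcc l
          by_cases hh : J l / 2 ^ d = h'
          · simp only [hh, decide_true, Bool.and_true, Bool.or_true] at h1 h2
            simp only [hS, hT, h1, h2, hh, hσ _ _ _ hdD]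
            simp
          · simp only [hh, decide_false, Bool.or_false] at h1
            simp [hS, h1, hh]
      have hv : ∀ l, v l = T (fun _ => false) (fun _ => false) l := by
        intro l
        simp only [hT, Bool.false_eq_true, if_false]
        rw [← hx l d (by omega), Function.update_eq_self]
      have hF : ∀ l, F l = S (fun _ => false) l := by simp [hS]
      refine TrA.congr_left ?_ hv hF
      refine TrA.seq (v' := T (fun _ => false) fun l => decide (J l / 2 ^ d = 2 * h + 1))
        (F' := S fun _ => false) ?_ ?_
      · refine (TrA.ctrlAnd (fun a ha => ⟨(hpv a ha).1, (hpv a ha).2.2, (hpv a ha).2.1⟩) hcv hxv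
          (by simp)).congr (fun l => ?_) fun _ => rfl
        rw [onT, cT _ _ _ _ hdD, dT, testBit_eq_decide_div, Bool.false_xor]
        exact uT _ _ l fun l => decide (J l / 2 ^ d = 2 * h + 1)
      refine TrA.seq (v' := T (fun _ => false) fun l => decide (J l / 2 ^ d = 2 * h))
        (F' := S fun _ => false) ?_ ?_
      · refine (TrA.ctrlX (fun a ha => ⟨(hpv a ha).1, (hpv a ha).2.1⟩) hxv).congr
          (fun l => ?_) fun _ => rfl
        rw [onT, dT, ← testBit_eq_decide_div]
        -- Adding the parent control to `p ∧ c` turns it into `p ∧ ¬c`, so one Toffoli serves both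
        -- children.
        rw [show ∀ a b : Bool, ((a && b) ^^ a) = (a && !b) by decide, not_testBit_eq_decide_div]
        exact uT _ _ l fun l => decide (J l / 2 ^ d = 2 * h)
      refine TrA.seq (sub _ _ (fun l => decide (J l / 2 ^ d = 2 * h)) (by simp) (by simp)) ?_
      refine TrA.seq (v' := T (fun l => decide (J l / 2 ^ d = 2 * h))
        fun l => decide (J l / 2 ^ d = 2 * h + 1))
        (F' := S fun l => decide (J l / 2 ^ d = 2 * h)) ?_ ?_
      · refine (TrA.ctrlX (fun a ha => ⟨(hpv a ha).1, (hpv a ha).2.1⟩) hxv).congr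
          (fun l => ?_) fun _ => rfl
        rw [onT, dT, ← not_testBit_eq_decide_div]
        rw [show ∀ a b : Bool, ((a && !b) ^^ a) = (a && b) by decide, testBit_eq_decide_div]
        exact uT _ _ l fun l => decide (J l / 2 ^ d = 2 * h + 1)
      refine TrA.seq (sub _ _ (fun l => decide (J l / 2 ^ (d + 1) = h)) ?_ ?_) ?_
      · intro l
        rw [← not_testBit_eq_decide_div, ← testBit_eq_decide_div]
        cases decide (J l / 2 ^ (d + 1) = h) <;> cases (J l).testBit d <;> rfl
      · intro l
        rw [← not_testBit_eq_decide_div, ← testBit_eq_decide_div]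
        cases decide (J l / 2 ^ (d + 1) = h) <;> cases (J l).testBit d <;> rfl
      -- At the end the ancilla again holds the AND of parent control and control bit, so the
      -- controlled `Z` is the right sign repair.
      · refine TrA.congr (TrA.erase hxv ?_) (fun l => ?_) fun l => ?_
        · refine (TrA.ctrlZ (fun a ha => ⟨(hpv a ha).1, (hpv a ha).2.2⟩) hcv).congr
            (fun _ => rfl) fun l => ?_
          rw [uT _ _ _ fun _ => false, onT, cT _ _ _ _ hdD, dT, testBit_eq_decide_div,
            Bool.xor_assoc, Bool.xor_self, Bool.xor_false]
        · rw [uT _ _ _ fun _ => false]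
          simp only [hT, decide_eq_true_eq]
          rw [← hx l d (by omega)]
          split_ifs
          · rw [← hGx' (J l) (v l) d hdD, Function.update_eq_self]
          · rw [Function.update_eq_self]
        · simp [hS]
    -- The right child is out of range for every label, so the next bit is necessarily `0` and no
    -- branching is needed.
    · have key : ∀ l, J l / 2 ^ d = 2 * h ↔ J l / 2 ^ (d + 1) = h := by
        intro l
        have h1 : J l / 2 ^ d < 2 * h + 1 :=
          (Nat.div_lt_iff_lt_mul (by positivity)).2 (lt_of_lt_of_le (hJ l) (not_lt.1 hN))
        rw [pow_succ, ← Nat.div_div_eq_div_mul]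
        omega
      refine (ih (by omega) p (fun a ha => ?_) (2 * h) v F hb (fun l i hi => hx l i (by omega))
        fun l => ?_).congr (fun l => ?_) fun l => ?_
      · obtain ⟨e, h1, h2, h3⟩ := hp a ha
        exact ⟨e, h1, by omega, h3⟩
      · rw [hon]
        simp only [key]
      · simp only [key]
      · simp only [key]

end Address

section Lookup

variable {n m r s : ℕ} {L : Type} [Fintype L] [DecidableEq L]

/-- The basis state with control value `j`, rotated qubit `z`, phase-gradient bits `y` and ancilla
bits `x`. -/
def st (j : ℕ) (z : Bool) (y x : ℕ → Bool) : Ad → Bool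
  | .c i => j.testBit i
  | .z => z
  | .y i => y i
  | .x i => x i

section st

variable (j : ℕ) (z : Bool) (y x : ℕ → Bool) (i : ℕ)

@[simp] lemma st_c : st j z y x (.c i) = j.testBit i := rfl
@[simp] lemma st_z : st j z y x .z = z := rfl
@[simp] lemma st_y : st j z y x (.y i) = y i := rfl
@[simp] lemma st_x : st j z y x (.x i) = x i := rfl

@[simp] lemma update_st_x (b : Bool) :
    Function.update (st j z y x) (.x i) b = st j z y (Function.update x i b) := by
  ext a
  cases a <;> simp [Function.update_apply]

@[simp] lemma update_st_y (b : Bool) :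
    Function.update (st j z y x) (.y i) b = st j z (Function.update y i b) x := by
  ext a
  cases a <;> simp [Function.update_apply]

end st

/-! ### Sequences of circuits -/

/-- Run the circuits `f 0, …, f (k - 1)` in this order. -/
def steps (f : ℕ → Circ n m r s) : ℕ → Circ n m r s
  | 0 => .done
  | k + 1 => (steps f k).seq (f k)

lemma toffoliCount_steps {f : ℕ → Circ n m r s} {k T : ℕ}
    (h : ∀ i < k, (f i).toffoliCount ≤ T) : (steps f k).toffoliCount ≤ k * T := by
  induction k with
  | zero => simp [steps, Circuit.toffoliCount]
  | succ k ih =>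
    have h1 := ih fun i hi => h i (by omega)
    have h2 := h k (by omega)
    rw [steps, Circuit.toffoliCount_seq, add_one_mul]
    omega

lemma calls_steps {f : ℕ → Circ n m r s} (h : ∀ i, (f i).Calls []) (k : ℕ) :
    (steps f k).Calls [] := by
  induction k with
  | zero => rfl
  | succ k ih => exact ih.seq_nil (h k)

lemma TrA.steps {f : ℕ → Circ n m r s} (k : ℕ) (v : ℕ → L → Ad → Bool) (F : ℕ → L → Bool)
    (h : ∀ i < k, TrA (f i) (v i) (F i) (v (i + 1)) (F (i + 1))) :
    TrA (steps f k) (v 0) (F 0) (v k) (F k) := by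
  induction k with
  | zero => exact TrA.done
  | succ k ih => exact (ih fun i hi => h i (by omega)).seq (h k (by omega))

/-! ### Table lookup -/

/-- The identity or the given circuit. -/
def cond (b : Bool) (C : Circ n m r s) : Circ n m r s := if b then C else .done

lemma calls_cond (b : Bool) {C : Circ n m r s} (h : C.Calls []) : (cond b C).Calls [] := by
  cases b
  · rfl
  · exact h

/-- Add the bits `D 0, …, D (k - 1)` to the first `k` ancillae, with an optional control. -/
def writeBits (k : ℕ) (D : ℕ → Bool) (p : Option Ad) : Circ n m r s :=
  steps (fun i => cond (D i) (ctrlX p (.x i))) k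

/-- The control ancilla lies beyond the `k` written bits, so it keeps its value through all the
steps. -/
lemma TrA.writeBits {k : ℕ} (hk : k ≤ s) (D : ℕ → Bool) {p : Option Ad}
    (hp : ∀ a ∈ p, ∃ i, k ≤ i ∧ i < s ∧ a = .x i) (v : L → Ad → Bool) (F : L → Bool) :
    TrA (writeBits k D p : Circ n m r s) v F
      (fun l => if on p (v l) then
        (fun a => match a with
          | .x i => v l (.x i) ^^ (decide (i < k) && D i)
          | a => v l a) else v l) F := by
  have key := TrA.steps (n := n) (m := m) (r := r) (s := s)
    (f := fun i => cond (D i) (QMux.ctrlX p (.x i))) k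
    (fun k' l => if on p (v l) then
        (fun a => match a with
          | .x i => v l (.x i) ^^ (decide (i < k') && D i)
          | a => v l a) else v l) (fun _ => F) ?_
  · refine TrA.congr_left key (fun l => ?_) fun _ => rfl
    split_ifs
    · ext a; cases a <;> simp
    · rfl
  · intro i hi
    have hon : ∀ l, on p (if on p (v l) then
        (fun a => match a with
          | .x i' => v l (.x i') ^^ (decide (i' < i) && D i')
          | a => v l a) else v l) = on p (v l) := by
      intro l
      split_ifs with h
      · cases hpp : p with
        | none => rfl
        | some a =>
          obtain ⟨i', h1, h2, rfl⟩ := hp a hpp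
          simp [on, show ¬ i' < i by omega]
      · rfl
    cases hD : D i with
    | false =>
      refine TrA.done.congr (fun l => ?_) fun _ => rfl
      congr 1
      ext a
      cases a with
      | x i' =>
        by_cases h : i' = i
        · subst h; simp [hD]
        · simp [show i' < i + 1 ↔ i' < i by omega]
      | _ => rfl
    | true =>
      refine (TrA.ctrlX (fun a ha => ?_) (by simp; omega)).congr (fun l => ?_) fun _ => rfl
      · obtain ⟨i', h1, h2, rfl⟩ := hp a ha
        exact ⟨by simpa, by simp; omega⟩
      · rw [hon]
        ext a
        by_cases h : on p (v l)
        · simp only [h, if_true]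
          by_cases ha : a = .x i
          · subst ha; simp [hD]
          · rw [Function.update_of_ne ha]
            cases a with
            | x i' =>
              have : i' ≠ i := fun e => ha (by rw [e])
              simp [show i' < i + 1 ↔ i' < i by omega]
            | _ => rfl
        · simp [h]

lemma toffoliCount_writeBits (k : ℕ) (D : ℕ → Bool) (p : Option Ad) :
    (writeBits k D p : Circ n m r s).toffoliCount = 0 := by
  have := toffoliCount_steps (n := n) (m := m) (r := r) (s := s)
    (f := fun i => cond (D i) (ctrlX p (.x i))) (k := k) (T := 0)
    fun i _ => by cases h : D i <;> simp [cond, Circuit.toffoliCount]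
  simpa [writeBits] using this

lemma calls_writeBits (k : ℕ) (D : ℕ → Bool) (p : Option Ad) :
    (writeBits k D p : Circ n m r s).Calls [] :=
  calls_steps (fun _ => calls_cond _ (calls_ctrlX _ _)) k

/-- Write the bits `D q 0, …, D q (k - 1)` into the first `k` ancillae, where `q` is the number
formed by the `d` control bits from `β` on. -/
def select (β d N k : ℕ) (D : ℕ → ℕ → Bool) : Circ n m r s :=
  walk (fun p q => writeBits k (D q) p) β k N d none 0

lemma calls_select (β d N k : ℕ) (D : ℕ → ℕ → Bool) :
    (select β d N k D : Circ n m r s).Calls [] :=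
  calls_walk (fun _ _ => calls_writeBits _ _ _) _ _ _ _ _ _

lemma toffoliCount_select {β d N k : ℕ} (D : ℕ → ℕ → Bool) (hN : 0 < N) :
    (select β d N k D : Circ n m r s).toffoliCount + 1 ≤ N := by
  have := toffoliCount_walk (n := n) (m := m) (r := r) (s := s)
    (leaf := fun p q => writeBits k (D q) p) (fun _ _ => toffoliCount_writeBits _ _ _)
    β k N d none 0 (by simpa)
  simp only [zero_mul, Nat.sub_zero] at this
  exact this.trans (min_le_right _ _)

/-- Unary iteration on `j / 2 ^ β`. The root needs no control, since the bound on `j` makes the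
empty prefix correct; the path ancillae follow the `k` data bits. -/
lemma TrA.select {β d N k : ℕ} (D : ℕ → ℕ → Bool) (hβ : β + d ≤ m) (hk : k + d ≤ s)
    (j : L → ℕ) (hj : ∀ l, j l / 2 ^ β < N) (hj' : ∀ l, j l < 2 ^ (β + d))
    (z : L → Bool) (y : L → ℕ → Bool) (F : L → Bool) :
    TrA (select β d N k D : Circ n m r s)
      (fun l => st (j l) (z l) (y l) fun _ => false) F
      (fun l => st (j l) (z l) (y l) fun i => decide (i < k) && D (j l / 2 ^ β) i) F := by
  refine (TrA.walk (D := d) (σ := fun _ _ => false) (G := fun q u a => match a with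
      | .x i => u (.x i) ^^ (decide (i < k) && D q i)
      | a => u a) hβ hk ?_ ?_ ?_ ?_ d le_rfl none (by simp) 0 (fun l => j l / 2 ^ β) hj _ _
      ?_ ?_ ?_).congr (fun l => ?_) fun l => ?_
  · intro p q v F hp
    refine (TrA.writeBits (by omega) (D q) (fun a ha => ?_) v F).congr (fun l => rfl)
      fun l => by simp
    obtain ⟨e, h1, rfl⟩ := hp a ha
    exact ⟨k + e, by omega, by omega, rfl⟩
  · intro q u i; rfl
  · intro q u i _ b
    ext a
    cases a with
    | x i' =>
      by_cases h : i' = k + i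
      · subst h; simp
      · simp [h]
    | _ => simp
  · simp
  · intro l i hi
    simp [Nat.testBit_div_two_pow, add_comm]
  · simp
  · intro l
    simp only [on]
    rw [Nat.div_div_eq_div_mul, ← pow_add, Nat.div_eq_of_lt (hj' l)]
    rfl
  · rw [Nat.div_div_eq_div_mul, ← pow_add, Nat.div_eq_of_lt (hj' l), if_pos rfl]
    ext a
    cases a <;> simp
  · simp

/-! ### The swap network -/

/-- Swap the wires `a` and `b` if the control bit `β` is set. -/
def cswap (β a b : ℕ) : Circ n m r s :=
  (cx (.x b) (.x a)).seq <| (ctrlAnd (some (.c β)) (.x a) (.x b)).seq (cx (.x b) (.x a))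

/-- Controlled swap of the first `M` ancillae with the next `M`. -/
def swapStage (β M : ℕ) : Circ n m r s := steps (fun i => cswap β i (i + M)) M

/-- The effect of `swapStage` on the ancilla bits. -/
def swapBits (b : Bool) (M : ℕ) (x : ℕ → Bool) (i : ℕ) : Bool :=
  if b then (if i < M then x (i + M) else if i < 2 * M then x (i - M) else x i) else x i

lemma toffoliCount_swapStage (β M : ℕ) :
    (swapStage β M : Circ n m r s).toffoliCount ≤ M := by
  refine (toffoliCount_steps (T := 1) fun i _ => ?_).trans (by simp)
  simp [cswap, Circuit.toffoliCount_seq, toffoliCount_ctrlAnd]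

lemma calls_swapStage (β M : ℕ) : (swapStage β M : Circ n m r s).Calls [] :=
  calls_steps (fun _ => (calls_cx _ _).seq_nil <| (calls_ctrlAnd _ _ _).seq_nil (calls_cx _ _)) _

/-- A swap is three XORs, and only the middle one needs the control: if it does nothing, the outer
two cancel. -/
lemma TrA.cswap {β a b : ℕ} (hβ : β < m) (ha : a < s) (hb : b < s) (hab : a ≠ b)
    (j : L → ℕ) (z : L → Bool) (y x : L → ℕ → Bool) (F : L → Bool) :
    TrA (cswap β a b : Circ n m r s) (fun l => st (j l) (z l) (y l) (x l)) F
      (fun l => st (j l) (z l) (y l) fun i =>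
        if (j l).testBit β then (if i = a then x l b else if i = b then x l a else x l i)
        else x l i) F := by
  refine ((TrA.cx (by simpa) (by simpa) (by simpa using hab.symm)).seq
    ((TrA.toffoli (by simpa) (by simpa) (by simpa) (by simp) (by simp) (by simpa)).seq
      (TrA.cx (by simpa) (by simpa) (by simpa using hab.symm)))).congr (fun l => ?_) fun _ => rfl
  simp only [update_st_x, st_x, st_c]
  congr 1
  ext i
  by_cases h1 : i = a
  · subst h1
    simp only [Function.update_self, Function.update_of_ne hab, Function.update_of_ne hab.symm,
      if_true]
    cases (j l).testBit β <;> cases x l i <;> cases x l b <;> rfl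
  · by_cases h2 : i = b
    · subst h2
      simp only [Function.update_self, Function.update_of_ne hab, Function.update_of_ne hab.symm,
        if_true, if_neg h1]
      cases (j l).testBit β <;> cases x l i <;> cases x l a <;> rfl
    · simp [h1, h2]

lemma TrA.swapStage {β M : ℕ} (hβ : β < m) (hM : 2 * M ≤ s)
    (j : L → ℕ) (z : L → Bool) (y x : L → ℕ → Bool) (F : L → Bool) :
    TrA (swapStage β M : Circ n m r s) (fun l => st (j l) (z l) (y l) (x l)) F
      (fun l => st (j l) (z l) (y l) (swapBits ((j l).testBit β) M (x l))) F := by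
  have key := TrA.steps (n := n) (m := m) (r := r) (s := s)
    (f := fun i => QMux.cswap β i (i + M)) M
    (fun k l => st (j l) (z l) (y l) fun i =>
      if (j l).testBit β then (if i < k then x l (i + M) else
        if M ≤ i ∧ i < M + k then x l (i - M) else x l i) else x l i) (fun _ => F) ?_
  · refine (TrA.congr_left key (fun l => ?_) fun _ => rfl).congr (fun l => ?_) fun _ => rfl
    · congr 1
      ext i
      by_cases h : M ≤ i
      · simp [show ¬ i < M by omega]
      · simp [h]
    · congr 1
      ext i
      simp only [swapBits]
      congr 1
      by_cases h : i < M
      · simp [h]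
      · simp [h, show i < M + M ↔ i < 2 * M by omega, show M ≤ i by omega]
  · intro k hk
    refine (TrA.cswap hβ (by omega) (by omega) (by omega) j z y _ F).congr
      (fun l => ?_) fun _ => rfl
    congr 1
    ext i
    cases (j l).testBit β
    · simp
    · simp only [if_true]
      by_cases h1 : i = k
      · subst h1
        rw [if_pos rfl, if_neg (by omega), if_neg (by omega), if_pos (by omega)]
      · rw [if_neg h1]
        by_cases h2 : i = k + M
        · subst h2
          rw [if_pos rfl, if_neg (by omega), if_neg (by omega), if_neg (by omega),
            if_pos (by omega)]
          congr 1; omega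
        · rw [if_neg h2]
          split_ifs <;> first | rfl | (exfalso; omega)

/-- The swap network: moves register `j mod 2 ^ u` to the front, where the registers have `B` bits
each. -/
def swapNet (B : ℕ) : ℕ → Circ n m r s
  | 0 => .done
  | u + 1 => (swapStage u (2 ^ u * B)).seq (swapNet B u)

/-- The effect of `swapNet` on the ancilla bits. -/
def swapNetBits (B j : ℕ) : ℕ → (ℕ → Bool) → ℕ → Bool
  | 0, x => x
  | u + 1, x => swapNetBits B j u (swapBits (j.testBit u) (2 ^ u * B) x)

/-- The stages halve the number of candidate registers, so the cost is a geometric sum. -/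
lemma toffoliCount_swapNet (B u : ℕ) :
    (swapNet B u : Circ n m r s).toffoliCount ≤ (2 ^ u - 1) * B := by
  induction u with
  | zero => simp [swapNet, Circuit.toffoliCount]
  | succ u ih =>
    rw [swapNet, Circuit.toffoliCount_seq]
    have h1 := toffoliCount_swapStage (n := n) (m := m) (r := r) (s := s) u (2 ^ u * B)
    have h2 : 2 ^ (u + 1) - 1 = 2 ^ u + (2 ^ u - 1) := by
      have := Nat.one_le_two_pow (n := u)
      omega
    rw [h2, add_mul]
    omega

lemma calls_swapNet (B u : ℕ) : (swapNet B u : Circ n m r s).Calls [] := by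
  induction u with
  | zero => rfl
  | succ u ih => exact (calls_swapStage _ _).seq_nil ih

lemma TrA.swapNet {B u : ℕ} (hu : u ≤ m) (hB : 2 ^ u * B ≤ s)
    (j : L → ℕ) (z : L → Bool) (y x : L → ℕ → Bool) (F : L → Bool) :
    TrA (swapNet B u : Circ n m r s) (fun l => st (j l) (z l) (y l) (x l)) F
      (fun l => st (j l) (z l) (y l) (swapNetBits B (j l) u (x l))) F := by
  induction u generalizing x with
  | zero => exact TrA.done
  | succ u ih =>
    have h : 2 ^ (u + 1) * B = 2 * (2 ^ u * B) := by ring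
    exact (TrA.swapStage (by omega) (by omega) j z y x F).seq (ih (by omega) (by omega) _)

lemma mod_two_pow_succ_eq (j u : ℕ) :
    j % 2 ^ (u + 1) = (if j.testBit u then 2 ^ u else 0) + j % 2 ^ u := by
  rw [Nat.mod_pow_succ, add_comm, Nat.testBit_eq_decide_div_mod_eq]
  rcases Nat.mod_two_eq_zero_or_one (j / 2 ^ u) with h | h <;> simp [h]

/-- The top bit of `j mod 2 ^ (u + 1)` selects a half of the candidates and moves it to the front;
the remaining bits then select within it. -/
lemma swapNetBits_of_lt {B j u i : ℕ} (x : ℕ → Bool) (hi : i < B) :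
    swapNetBits B j u x i = x (B * (j % 2 ^ u) + i) := by
  induction u generalizing x with
  | zero => simp [swapNetBits, Nat.mod_one]
  | succ u ih =>
    have h : B * (j % 2 ^ u) + i < 2 ^ u * B := by
      have h1 : j % 2 ^ u + 1 ≤ 2 ^ u := Nat.mod_lt _ (by positivity)
      have h2 := Nat.mul_le_mul_left B h1
      rw [mul_comm (2 ^ u)]
      rw [mul_add, mul_one] at h2
      omega
    rw [swapNetBits, ih, swapBits, mod_two_pow_succ_eq]
    cases j.testBit u
    · simp
    · simp only [if_true, if_pos h]
      congr 1
      ring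

lemma swapNetBits_of_ge {B j u i : ℕ} (x : ℕ → Bool) (hi : 2 ^ u * B ≤ i) :
    swapNetBits B j u x i = x i := by
  induction u generalizing x with
  | zero => rfl
  | succ u ih =>
    have h : 2 ^ (u + 1) * B = 2 * (2 ^ u * B) := by ring
    rw [swapNetBits, ih _ (by omega), swapBits]
    split_ifs <;> first | rfl | (exfalso; omega)

end Lookup

section Sign

variable {n m r s : ℕ} {L : Type} [Fintype L] [DecidableEq L]

/-! ### One-hot encoding of the low control bits -/

/-- In a one-hot register, move the position from `a` to `b` if the control bit `β` is set. -/
def moveHot (β a b : ℕ) : Circ n m r s :=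
  (ctrlAnd (some (.c β)) (.x a) (.x b)).seq (cx (.x b) (.x a))

/-- The inverse of `moveHot`, by measurement. -/
def unmoveHot (β a b : ℕ) : Circ n m r s :=
  (cx (.x b) (.x a)).seq (erase (.x b) (ctrlZ (some (.c β)) (.x a)))

/-- The AND sets position `b` when the marker sits at `a` and the control bit is set; the CNOT then
clears `a`. Position `b` has to be empty beforehand. -/
lemma TrA.moveHot {β a b : ℕ} (hβ : β < m) (ha : a < s) (hb : b < s) (hab : a ≠ b)
    (j : L → ℕ) (z : L → Bool) (y : L → ℕ → Bool) (F : L → Bool) (P : L → ℕ)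
    (hP : ∀ l, P l ≠ b) :
    TrA (moveHot β a b : Circ n m r s) (fun l => st (j l) (z l) (y l) fun i => decide (i = P l)) F
      (fun l => st (j l) (z l) (y l) fun i =>
        decide (i = if (j l).testBit β ∧ P l = a then b else P l)) F := by
  refine ((TrA.toffoli (by simpa) (by simpa) (by simpa) (by simp) (by simp) (by simpa)).seq
      (TrA.cx (by simpa) (by simpa) (by simpa using hab.symm))).congr (fun l => ?_) fun _ => rfl
  simp only [update_st_x, st_x, st_c]
  congr 1
  ext i
  have hPl := hP l
  by_cases h1 : i = b
  · subst h1
    simp only [Function.update_self, Function.update_of_ne hab.symm, eq_comm (a := i) (b := P l),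
      hPl, decide_false, Bool.false_xor, eq_comm (a := a) (b := P l)]
    cases (j l).testBit β <;> by_cases h : P l = a <;> simp [h, hab.symm] <;>
      simpa using hPl.symm
  · by_cases h2 : i = a
    · subst h2
      simp only [Function.update_self, Function.update_of_ne hab, eq_comm (a := b) (b := P l),
        hPl, decide_false]
      cases (j l).testBit β <;> by_cases h : i = P l
      · simp [← h]
      · simp [h]
      · simp [← h, hab]
      · simp [h, Ne.symm h]
    · simp only [Function.update_of_ne h1, Function.update_of_ne h2]
      rw [decide_eq_decide]
      split_ifs with h
      · exact ⟨fun e => absurd (e.trans h.2) h2, fun e => absurd e h1⟩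
      · rfl

/-- After the CNOT, `a` is set if the marker was at `a` or `b`. The hypotheses say that the control
bit distinguishes the two cases, so the bit at `b` is the AND of the control bit and `a`, and can be
erased by measurement. -/
lemma TrA.unmoveHot {β a b : ℕ} (hβ : β < m) (ha : a < s) (hb : b < s) (hab : a ≠ b)
    (j : L → ℕ) (z : L → Bool) (y : L → ℕ → Bool) (F : L → Bool) (P : L → ℕ)
    (hP : ∀ l, P l = b → (j l).testBit β = true) (hP' : ∀ l, P l = a → (j l).testBit β = false) :
    TrA (unmoveHot β a b : Circ n m r s)
      (fun l => st (j l) (z l) (y l) fun i => decide (i = P l)) F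
      (fun l => st (j l) (z l) (y l) fun i => decide (i = if P l = b then a else P l)) F := by
  refine ((TrA.cx (by simpa) (by simpa) (by simpa using hab.symm)).seq
    (TrA.erase (by simpa) ((TrA.ctrlZ (by simpa) (by simpa)).congr (fun _ => rfl)
      fun l => ?_))).congr (fun l => ?_) fun _ => rfl
  · have h1 := hP l
    have h2 := hP' l
    simp only [update_st_x, st_x, st_c, on, Function.update_self, Function.update_of_ne hab,
      Function.update_of_ne hab.symm]
    by_cases ha : a = P l
    · have hb : b ≠ P l := fun e => hab (ha.trans e.symm)
      simp [hb, h2 ha.symm]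
    · by_cases hb : b = P l
      · simp [← hb, h1 hb.symm, hab]
      · simp [ha, hb]
  · simp only [update_st_x, st_x]
    congr 1
    ext i
    by_cases h1 : i = b
    · subst h1
      simp only [Function.update_self]
      split_ifs with h
      · simp [hab.symm]
      · simp [Ne.symm h]
    · by_cases h2 : i = a
      · subst h2
        simp only [Function.update_self, Function.update_of_ne hab]
        by_cases hb : P l = b
        · simp [hb, hab]
        · simp [hb, Ne.symm hb]
      · simp only [Function.update_of_ne h1, Function.update_of_ne h2]
        rw [decide_eq_decide]
        split_ifs with h
        · exact ⟨fun e => absurd (e.trans h) h1, fun e => absurd e h2⟩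
        · rfl

/-- Prepare the one-hot encoding of the `u` lowest control bits in the first `2 ^ u` ancillae. -/
def oneHot : ℕ → Circ n m r s
  | 0 => xC (wire m r s (.x 0))
  | u + 1 => (oneHot u).seq (steps (fun i => moveHot u i (i + 2 ^ u)) (2 ^ u))

/-- The inverse of `oneHot`, by measurements. -/
def unHot : ℕ → Circ n m r s
  | 0 => xC (wire m r s (.x 0))
  | u + 1 => (steps (fun i => unmoveHot u i (i + 2 ^ u)) (2 ^ u)).seq (unHot u)

lemma calls_oneHot (u : ℕ) : (oneHot u : Circ n m r s).Calls [] := by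
  induction u with
  | zero => exact calls_xC _
  | succ u ih =>
    exact ih.seq_nil (calls_steps (fun _ => (calls_ctrlAnd _ _ _).seq_nil (calls_cx _ _)) _)

lemma calls_unHot (u : ℕ) : (unHot u : Circ n m r s).Calls [] := by
  induction u with
  | zero => exact calls_xC _
  | succ u ih =>
    exact (calls_steps (fun _ => (calls_cx _ _).seq_nil (calls_erase (calls_ctrlZ _ _))) _).seq_nil
      ih

lemma toffoliCount_oneHot (u : ℕ) : (oneHot u : Circ n m r s).toffoliCount + 1 ≤ 2 ^ u := by
  induction u with
  | zero => simp [oneHot]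
  | succ u ih =>
    have h := toffoliCount_steps (n := n) (m := m) (r := r) (s := s)
      (f := fun i => moveHot u i (i + 2 ^ u)) (k := 2 ^ u) (T := 1) fun i _ => by
        simp [moveHot, Circuit.toffoliCount_seq, toffoliCount_ctrlAnd]
    rw [oneHot, Circuit.toffoliCount_seq, pow_succ]
    omega

lemma toffoliCount_unHot (u : ℕ) : (unHot u : Circ n m r s).toffoliCount = 0 := by
  induction u with
  | zero => simp [unHot]
  | succ u ih =>
    have h := toffoliCount_steps (n := n) (m := m) (r := r) (s := s)
      (f := fun i => unmoveHot u i (i + 2 ^ u)) (k := 2 ^ u) (T := 0) fun i _ => by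
        simp [unmoveHot, Circuit.toffoliCount_seq]
    rw [unHot, Circuit.toffoliCount_seq, ih]
    omega

lemma TrA.oneHot {u : ℕ} (hu : u ≤ m) (hs : 2 ^ u ≤ s)
    (j : L → ℕ) (z : L → Bool) (y : L → ℕ → Bool) (F : L → Bool) :
    TrA (oneHot u : Circ n m r s) (fun l => st (j l) (z l) (y l) fun _ => false) F
      (fun l => st (j l) (z l) (y l) fun i => decide (i = j l % 2 ^ u)) F := by
  induction u with
  | zero =>
    refine (TrA.x (by simp at hs ⊢; omega)).congr (fun l => ?_) fun _ => rfl
    simp only [update_st_x, st_x]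
    congr 1
    ext i
    by_cases h : i = 0
    · subst h; simp [Nat.mod_one]
    · simp [h, Nat.mod_one]
  | succ u ih =>
    rw [pow_succ] at hs
    refine (ih (by omega) (by omega)).seq ?_
    have key := TrA.steps (n := n) (m := m) (r := r) (s := s)
      (f := fun i => QMux.moveHot u i (i + 2 ^ u)) (2 ^ u)
      (fun k l => st (j l) (z l) (y l) fun i => decide (i =
        if (j l).testBit u ∧ j l % 2 ^ u < k then j l % 2 ^ u + 2 ^ u else j l % 2 ^ u))
      (fun _ => F) ?_
    · refine (TrA.congr_left key (fun l => ?_) fun _ => rfl).congr (fun l => ?_) fun _ => rfl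
      · simp
      · congr 1
        have : j l % 2 ^ u < 2 ^ u := Nat.mod_lt _ (by positivity)
        rw [mod_two_pow_succ_eq]
        simp only [this, and_true]
        cases (j l).testBit u <;> simp [add_comm]
    · intro k hk
      refine (TrA.moveHot (by omega) (by omega) (by omega) (by omega) j z y F _ ?_).congr
        (fun l => ?_) fun _ => rfl
      · intro l
        have : j l % 2 ^ u < 2 ^ u := Nat.mod_lt _ (by positivity)
        split_ifs <;> omega
      · congr 1
        ext i
        rw [decide_eq_decide]
        have : j l % 2 ^ u < 2 ^ u := Nat.mod_lt _ (by positivity)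
        cases (j l).testBit u
        · simp
        · simp only [true_and]
          split_ifs <;> omega

lemma TrA.unHot {u : ℕ} (hu : u ≤ m) (hs : 2 ^ u ≤ s)
    (j : L → ℕ) (z : L → Bool) (y : L → ℕ → Bool) (F : L → Bool) :
    TrA (unHot u : Circ n m r s)
      (fun l => st (j l) (z l) (y l) fun i => decide (i = j l % 2 ^ u)) F
      (fun l => st (j l) (z l) (y l) fun _ => false) F := by
  induction u with
  | zero =>
    refine (TrA.x (by simp at hs ⊢; omega)).congr (fun l => ?_) fun _ => rfl
    simp only [update_st_x, st_x]
    congr 1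
    ext i
    by_cases h : i = 0
    · subst h; simp [Nat.mod_one]
    · simp [h, Nat.mod_one]
  | succ u ih =>
    rw [pow_succ] at hs
    refine TrA.seq ?_ (ih (by omega) (by omega))
    have key := TrA.steps (n := n) (m := m) (r := r) (s := s)
      (f := fun i => QMux.unmoveHot u i (i + 2 ^ u)) (2 ^ u)
      (fun k l => st (j l) (z l) (y l) fun i => decide (i =
        if (j l).testBit u ∧ k ≤ j l % 2 ^ u then j l % 2 ^ u + 2 ^ u else j l % 2 ^ u))
      (fun _ => F) ?_
    · refine (TrA.congr_left key (fun l => ?_) fun _ => rfl).congr (fun l => ?_) fun _ => rfl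
      · congr 1
        rw [mod_two_pow_succ_eq]
        cases (j l).testBit u <;> simp [add_comm]
      · congr 1
        have : ¬ 2 ^ u ≤ j l % 2 ^ u := not_le.2 (Nat.mod_lt _ (by positivity))
        simp [this]
    · intro k hk
      refine (TrA.unmoveHot (by omega) (by omega) (by omega) (by omega) j z y F _ ?_ ?_).congr
        (fun l => ?_) fun _ => rfl
      · intro l hl
        have : j l % 2 ^ u < 2 ^ u := Nat.mod_lt _ (by positivity)
        cases h : (j l).testBit u
        · simp only [h, Bool.false_eq_true, false_and, if_false] at hl
          omega
        · rfl
      · intro l hl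
        have : j l % 2 ^ u < 2 ^ u := Nat.mod_lt _ (by positivity)
        cases h : (j l).testBit u
        · rfl
        · simp only [h, true_and] at hl
          split_ifs at hl <;> omega
      · congr 1
        ext i
        rw [decide_eq_decide]
        have : j l % 2 ^ u < 2 ^ u := Nat.mod_lt _ (by positivity)
        cases (j l).testBit u
        · simp only [Bool.false_eq_true, false_and, if_false]
          split_ifs <;> omega
        · simp only [true_and]
          split_ifs <;> omega

/-! ### Sign changes depending on the control value -/

/-- The parity of the bits `f 0, …, f (k - 1)`. -/
def parity (f : ℕ → Bool) : ℕ → Bool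
  | 0 => false
  | k + 1 => parity f k ^^ f k

lemma parity_congr {f g : ℕ → Bool} {k : ℕ} (h : ∀ i < k, f i = g i) : parity f k = parity g k := by
  induction k with
  | zero => rfl
  | succ k ih => rw [parity, parity, ih fun i hi => h i (by omega), h k (by omega)]

/-- A one-hot register picks a single entry of the table `g` out of the parity. -/
lemma parity_and_decide (g : ℕ → Bool) (P k : ℕ) :
    parity (fun i => g i && decide (i = P)) k = (decide (P < k) && g P) := by
  induction k with
  | zero => simp [parity]
  | succ k ih =>
    rw [parity, ih]
    by_cases h : k = P
    · subst h; simp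
    · simp [h, show P < k + 1 ↔ P < k by omega]

/-- The sign `(-1)^{G i}` for the position `i` of the one-hot register. -/
def signBits (k : ℕ) (G : ℕ → Bool) (p : Option Ad) : Circ n m r s :=
  steps (fun i => cond (G i) (ctrlZ p (.x i))) k

lemma TrA.signBits {k : ℕ} (hk : k ≤ s) (G : ℕ → Bool) {p : Option Ad}
    (hp : ∀ a ∈ p, ∃ i, k ≤ i ∧ i < s ∧ a = .x i) (v : L → Ad → Bool) (F : L → Bool) :
    TrA (signBits k G p : Circ n m r s) v F v
      (fun l => F l ^^ (on p (v l) && parity (fun i => G i && v l (.x i)) k)) := by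
  have key := TrA.steps (n := n) (m := m) (r := r) (s := s)
    (f := fun i => cond (G i) (QMux.ctrlZ p (.x i))) k (fun _ => v)
    (fun k l => F l ^^ (on p (v l) && parity (fun i => G i && v l (.x i)) k)) ?_
  · exact TrA.congr_left key (fun l => rfl) fun l => by simp [parity]
  · intro i hi
    cases hG : G i with
    | false => exact TrA.done.congr (fun _ => rfl) fun l => by simp [parity, hG]
    | true =>
      refine (TrA.ctrlZ (fun a ha => ?_) (by simp; omega)).congr (fun _ => rfl) fun l => ?_
      · obtain ⟨i', h1, h2, rfl⟩ := hp a ha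
        exact ⟨by simpa, by simp; omega⟩
      · rw [parity, hG, Bool.true_and, Bool.and_xor_distrib_left, Bool.xor_assoc]

/-- Apply the sign `(-1)^{G j}`, where `j` is the control value. -/
def signFix (m' u N : ℕ) (G : ℕ → Bool) : Circ n m r s :=
  (oneHot u).seq <|
    (walk (fun p q => signBits (2 ^ u) (fun i => G (q * 2 ^ u + i)) p) u (2 ^ u) N (m' - u) none
      0).seq (unHot u)

lemma calls_signFix (m' u N : ℕ) (G : ℕ → Bool) : (signFix m' u N G : Circ n m r s).Calls [] :=
  (calls_oneHot _).seq_nil <| (calls_walk (fun _ _ => calls_steps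
    (fun _ => calls_cond _ (calls_ctrlZ _ _)) _) _ _ _ _ _ _).seq_nil (calls_unHot _)

lemma toffoliCount_signFix {m' u N : ℕ} (G : ℕ → Bool) (hN : 0 < N) :
    (signFix m' u N G : Circ n m r s).toffoliCount ≤ N + 2 ^ u := by
  have h := toffoliCount_walk (n := n) (m := m) (r := r) (s := s)
    (leaf := fun p q => signBits (2 ^ u) (fun i => G (q * 2 ^ u + i)) p) (fun p q => by
      have := toffoliCount_steps (n := n) (m := m) (r := r) (s := s)
        (f := fun i => cond (G (q * 2 ^ u + i)) (ctrlZ p (.x i))) (k := 2 ^ u) (T := 0)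
        fun i _ => by cases h : G (q * 2 ^ u + i) <;> simp [cond, Circuit.toffoliCount]
      simpa [signBits] using this) u (2 ^ u) N (m' - u) none 0 (by simpa)
  simp only [zero_mul, Nat.sub_zero] at h
  have h' := h.trans (min_le_right _ _)
  have h1 := toffoliCount_oneHot (n := n) (m := m) (r := r) (s := s) u
  rw [signFix, Circuit.toffoliCount_seq, Circuit.toffoliCount_seq, toffoliCount_unHot]
  omega

/-- With `j = q 2^u + i`, the one-hot register marks `i` and the walk reaches `q`, where `Z` gates
controlled on the path are applied at the positions with `G (q 2^u + i)` set. Only the marked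
position contributes a sign. -/
lemma TrA.signFix {u N : ℕ} (G : ℕ → Bool) (hu : u ≤ m) (hs : 2 ^ u + (m - u) ≤ s)
    (j : L → ℕ) (hj : ∀ l, j l / 2 ^ u < N) (hj' : ∀ l, j l < 2 ^ m)
    (z : L → Bool) (y : L → ℕ → Bool) (F : L → Bool) :
    TrA (signFix m u N G : Circ n m r s) (fun l => st (j l) (z l) (y l) fun _ => false) F
      (fun l => st (j l) (z l) (y l) fun _ => false) (fun l => F l ^^ G (j l)) := by
  refine (TrA.oneHot hu (by omega) j z y F).seq (TrA.seq ?_ (TrA.unHot hu (by omega) j z y _))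
  have h0 : ∀ l, j l / 2 ^ u / 2 ^ (m - u) = 0 := by
    intro l
    rw [Nat.div_div_eq_div_mul, ← pow_add, Nat.div_eq_of_lt]
    rw [show u + (m - u) = m by omega]
    exact hj' l
  refine (TrA.walk (D := m - u) (G := fun _ u => u)
    (σ := fun q v => parity (fun i => G (q * 2 ^ u + i) && v (.x i)) (2 ^ u))
    (by omega) hs ?_ ?_ ?_ ?_ (m - u) le_rfl none (by simp) 0 (fun l => j l / 2 ^ u) hj _ _
      ?_ ?_ ?_).congr (fun l => ?_) fun l => ?_
  · intro p q v F hp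
    refine (TrA.signBits (by omega) _ (fun a ha => ?_) v F).congr (fun l => by simp)
      fun l => rfl
    obtain ⟨e, h1, rfl⟩ := hp a ha
    exact ⟨2 ^ u + e, by omega, by omega, rfl⟩
  · intro q u i; rfl
  · intro q u i _ b; rfl
  · intro q v i hi b
    refine parity_congr fun i' hi' => ?_
    rw [Function.update_of_ne (by simp; omega)]
  · intro l i hi
    simp [Nat.testBit_div_two_pow, add_comm]
  · intro l i hi
    have : j l % 2 ^ u < 2 ^ u := Nat.mod_lt _ (by positivity)
    simp only [st_x, decide_eq_false_iff_not]
    omega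
  · intro l
    simp [on, h0]
  · simp
  · have : j l % 2 ^ u < 2 ^ u := Nat.mod_lt _ (by positivity)
    simp only [h0, decide_true, Bool.true_and, st_x]
    rw [parity_and_decide, decide_eq_true this, Bool.true_and, mul_comm, Nat.div_add_mod]

end Sign

section Adder

variable {n m r s : ℕ} {L : Type} [Fintype L] [DecidableEq L]

/-! ### Addition into the phase-gradient register -/

/-- The majority of three bits. -/
def maj (c t y : Bool) : Bool := ((t ^^ c) && (y ^^ c)) ^^ c

/-- Ripple-carry addition of the ancilla bits `β + i, …, β + i + k` into the bits `i + 1, …,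
i + k + 1` of the phase-gradient register, with the carry bit `κ + i`. -/
def adder (β κ : ℕ) : ℕ → ℕ → Circ n m r s
  | i, 0 => (cx (.x (β + i)) (.y (i + 1))).seq (cx (.x (κ + i)) (.y (i + 1)))
  | i, k + 1 =>
    (cx (.x (κ + i)) (.x (β + i))).seq <|
    (cx (.x (κ + i)) (.y (i + 1))).seq <|
    (ctrlAnd (some (.x (β + i))) (.y (i + 1)) (.x (κ + (i + 1)))).seq <|
    (cx (.x (κ + i)) (.x (κ + (i + 1)))).seq <|
    (adder β κ (i + 1) k).seq <|
    (cx (.x (κ + i)) (.x (κ + (i + 1)))).seq <|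
    (erase (.x (κ + (i + 1))) (ctrlZ (some (.x (β + i))) (.y (i + 1)))).seq <|
    (cx (.x (κ + i)) (.x (β + i))).seq (cx (.x (β + i)) (.y (i + 1)))

/-- The effect of `adder` on the phase-gradient bits, with carry `c`. -/
def addBits (t : ℕ → Bool) : ℕ → ℕ → Bool → (ℕ → Bool) → ℕ → Bool
  | i, 0, c, y => Function.update y (i + 1) (y (i + 1) ^^ t i ^^ c)
  | i, k + 1, c, y =>
    Function.update (addBits t (i + 1) k (maj c (t i) (y (i + 1))) y) (i + 1)
      (y (i + 1) ^^ t i ^^ c)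

lemma calls_adder (β κ i k : ℕ) : (adder β κ i k : Circ n m r s).Calls [] := by
  induction k generalizing i with
  | zero => exact (calls_cx _ _).seq_nil (calls_cx _ _)
  | succ k ih =>
    exact (calls_cx _ _).seq_nil <| (calls_cx _ _).seq_nil <| (calls_ctrlAnd _ _ _).seq_nil <|
      (calls_cx _ _).seq_nil <| (ih _).seq_nil <| (calls_cx _ _).seq_nil <|
      (calls_erase (calls_ctrlZ _ _)).seq_nil <| (calls_cx _ _).seq_nil (calls_cx _ _)

/-- One AND per computed carry; the top position needs no carry out, hence `k` and not `k + 1`. -/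
lemma toffoliCount_adder (β κ i k : ℕ) : (adder β κ i k : Circ n m r s).toffoliCount ≤ k := by
  induction k generalizing i with
  | zero => simp [adder, Circuit.toffoliCount_seq]
  | succ k ih =>
    have h := toffoliCount_ctrlAnd (n := n) (m := m) (r := r) (s := s) (some (.x (β + i)))
      (.y (i + 1)) (.x (κ + (i + 1)))
    have := ih (i + 1)
    simp only [adder, Circuit.toffoliCount_seq, toffoliCount_cx, toffoliCount_erase,
      toffoliCount_ctrlZ]
    omega

lemma addBits_congr {t t' : ℕ → Bool} {i k : ℕ} (h : ∀ i', i ≤ i' → i' ≤ i + k → t i' = t' i')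
    (c : Bool)
    (y : ℕ → Bool) : addBits t i k c y = addBits t' i k c y := by
  induction k generalizing i c with
  | zero => simp [addBits, h i le_rfl le_rfl]
  | succ k ih => rw [addBits, addBits, h i le_rfl (by omega),
      ih fun i' hi' _ => h i' (by omega) (by omega)]

/-- Bits below position `i + 1` are neither read nor written by the addition that starts there. -/
lemma addBits_update (t : ℕ → Bool) (i k : ℕ) (c : Bool) (y : ℕ → Bool) (e : ℕ) (he : e < i + 1)
    (b : Bool) : addBits t i k c (Function.update y e b) =
      Function.update (addBits t i k c y) e b := by
  induction k generalizing i c with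
  | zero =>
    rw [addBits, addBits, Function.update_of_ne (by omega : i + 1 ≠ e),
      Function.update_comm (by omega : i + 1 ≠ e)]
  | succ k ih =>
    rw [addBits, addBits, Function.update_of_ne (by omega : i + 1 ≠ e),
      Function.update_comm (by omega : i + 1 ≠ e), ih _ _ (by omega)]

lemma addBits_of_lt (t : ℕ → Bool) (i k : ℕ) (c : Bool) (y : ℕ → Bool) (e : ℕ) (he : e < i + 1) :
    addBits t i k c y e = y e := by
  have h := addBits_update t i k c y e he (y e)
  rw [Function.update_eq_self] at h
  rw [h, Function.update_self]

/-- With carry `c`, the next carry is `((t ⊕ c) ∧ (y ⊕ c)) ⊕ c`. The summands are first XORed with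
`c`, one Toffoli makes the AND, and after the recursion the same AND is still available from its
unchanged inputs, so the carry can be erased by measurement. -/
lemma TrA.adder {β κ i k : ℕ} (hβ : β + i + k < κ) (hs : κ + i + k < s) (hr : i + k + 1 < r)
    (j : L → ℕ) (z : L → Bool) (y x : L → ℕ → Bool) (F : L → Bool)
    (hx : ∀ l, ∀ i' < k, x l (κ + (i + 1) + i') = false) :
    TrA (adder β κ i k : Circ n m r s) (fun l => st (j l) (z l) (y l) (x l)) F
      (fun l => st (j l) (z l) (addBits (fun i => x l (β + i)) i k (x l (κ + i)) (y l)) (x l))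
      F := by
  induction k generalizing i y x with
  | zero =>
    refine ((TrA.cx (by simp; omega) (by simp; omega) (by simp)).seq
      (TrA.cx (by simp; omega) (by simp; omega) (by simp))).congr (fun l => ?_) fun _ => rfl
    simp only [update_st_y, st_y, st_x, Function.update_self, Function.update_idem]
    rfl
  | succ k ih =>
    have n1 : κ + (i + 1) ≠ β + i := by omega
    have n2 : κ + i ≠ β + i := by omega
    have n3 : κ + i ≠ κ + (i + 1) := by omega
    unfold QMux.adder
    refine TrA.seq (TrA.cx (by simp; omega) (by simp; omega) (by simp; omega)) ?_
    refine TrA.seq (TrA.cx (by simp; omega) (by simp; omega) (by simp)) ?_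
    refine TrA.seq (TrA.toffoli (by simp; omega) (by simp; omega) (by simp; omega) (by simp)
      (by simp; omega) (by simp)) ?_
    refine TrA.seq (TrA.cx (by simp; omega) (by simp; omega) (by simp)) ?_
    -- `X` and `Y` are the ancilla and register contents right after the recursive call, with the
    -- new carry present and bit `i + 1` still lacking `t`.
    obtain ⟨X, hX⟩ : ∃ X : L → ℕ → Bool, X = fun l => Function.update (Function.update (x l) (β + i)
      (x l (β + i) ^^ x l (κ + i))) (κ + (i + 1)) (maj (x l (κ + i)) (x l (β + i)) (y l (i + 1))) :=
      ⟨_, rfl⟩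
    obtain ⟨Y, hY⟩ : ∃ Y : L → ℕ → Bool, Y = fun l => Function.update
      (addBits (fun i => x l (β + i)) (i + 1) k (maj (x l (κ + i)) (x l (β + i)) (y l (i + 1)))
        (y l)) (i + 1) (y l (i + 1) ^^ x l (κ + i)) := ⟨_, rfl⟩
    have h0 : ∀ l, x l (κ + (i + 1)) = false := fun l => hx l 0 (by omega)
    have hX1 : ∀ l, X l (κ + (i + 1)) = maj (x l (κ + i)) (x l (β + i)) (y l (i + 1)) := by
      simp [hX]
    have hX2 : ∀ l, X l (β + i) = (x l (β + i) ^^ x l (κ + i)) := by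
      intro l; simp only [hX, Function.update_of_ne n1.symm, Function.update_self]
    have hX3 : ∀ l, X l (κ + i) = x l (κ + i) := by
      intro l; simp only [hX, Function.update_of_ne n3, Function.update_of_ne n2]
    have hY1 : ∀ l, Y l (i + 1) = (y l (i + 1) ^^ x l (κ + i)) := by
      simp [hY]
    refine TrA.seq (v' := fun l => st (j l) (z l) (Y l) (X l)) (F' := F) ?_ ?_
    · refine (TrA.congr_left (ih (i := i + 1) (by omega) (by omega) (by omega)
        (fun l => Function.update (y l) (i + 1) (y l (i + 1) ^^ x l (κ + i))) X ?_) (fun l => ?_)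
        fun _ => rfl).congr (fun l => ?_) fun _ => rfl
      · intro l i' hi'
        rw [hX]
        simp only
        rw [Function.update_of_ne (by omega), Function.update_of_ne (by omega), ← hx l (i' + 1)
          (by omega)]
        congr 1; omega
      · simp only [update_st_y, st_y, st_x, update_st_x, Function.update_self,
          Function.update_idem, Function.update_of_ne n1, Function.update_of_ne n2,
          Function.update_of_ne n3, hX, h0, maj, Bool.false_xor]
      · rw [addBits_update _ _ _ _ _ _ (by omega), hX1, hY]
        congr 2
        refine addBits_congr (fun i' h1 h2 => ?_) _ _
        rw [hX]
        simp only
        rw [Function.update_of_ne (by omega), Function.update_of_ne (by omega)]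
    refine TrA.seq (TrA.cx (by simp; omega) (by simp; omega) (by simp)) ?_
    refine TrA.seq (TrA.erase (by simp; omega) ((TrA.ctrlZ (by simp; omega)
      (by simp; omega)).congr (fun _ => rfl) fun l => ?_)) ?_
    · simp only [st_y, st_x, update_st_x, Function.update_self, on,
        Function.update_of_ne n1.symm, Function.update_idem, hX1, hX2, hX3, hY1, maj]
      -- The sign left by erasing the carry is the AND of the two XORed inputs, for all values of
      -- carry, summand and register bit.
      cases F l <;> cases x l (κ + i) <;> cases x l (β + i) <;> cases y l (i + 1) <;> rfl
    refine (TrA.seq (TrA.cx (by simp; omega) (by simp; omega) (by simp; omega))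
      (TrA.cx (by simp; omega) (by simp; omega) (by simp))).congr (fun l => ?_) fun _ => rfl
    simp only [update_st_y, st_y, st_x, update_st_x, Function.update_self, Function.update_idem,
      Function.update_of_ne n1.symm, Function.update_of_ne n3, hX1, hX2, hX3, hY1]
    congr 1
    · rw [addBits, hY]
      simp only [Function.update_idem]
      congr 1
      cases x l (κ + i) <;> cases x l (β + i) <;> cases y l (i + 1) <;> rfl
    · ext e
      by_cases e1 : e = β + i
      · subst e1; simp
      · by_cases e2 : e = κ + (i + 1)
        · subst e2; simp [Function.update_of_ne n1, h0]
        · simp [e1, e2, hX]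

/-! ### Arithmetic meaning of the adder -/

/-- The number with binary digits `f 0, …, f (k - 1)`. -/
def val (f : ℕ → Bool) (k : ℕ) : ℕ := ∑ i ∈ Finset.range k, (f i).toNat * 2 ^ i

lemma val_succ (f : ℕ → Bool) (k : ℕ) :
    val f (k + 1) = (f 0).toNat + 2 * val (fun i => f (i + 1)) k := by
  rw [val, Finset.sum_range_succ', val, Finset.mul_sum, add_comm]
  simp only [pow_zero, mul_one, pow_succ]
  congr 1
  exact Finset.sum_congr rfl fun i _ => by ring

lemma val_succ' (f : ℕ → Bool) (k : ℕ) : val f (k + 1) = val f k + (f k).toNat * 2 ^ k :=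
  Finset.sum_range_succ _ _

/-- `C` is the carry out of the top position, which the circuit discards; the addition is thus
correct modulo `2 ^ (k + 1)`. -/
lemma val_addBits (t : ℕ → Bool) (i k : ℕ) (c : Bool) (y : ℕ → Bool) :
    ∃ C : ℕ, val (fun e => addBits t i k c y (i + 1 + e)) (k + 1) + 2 ^ (k + 1) * C =
      val (fun e => y (i + 1 + e)) (k + 1) + val (fun e => t (i + e)) (k + 1) + c.toNat := by
  induction k generalizing i c with
  | zero =>
    refine ⟨(maj c (t i) (y (i + 1))).toNat, ?_⟩
    simp only [val, addBits, zero_add, Finset.sum_range_one, add_zero, Function.update_self, maj]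
    cases c <;> cases t i <;> cases y (i + 1) <;> rfl
  | succ k ih =>
    obtain ⟨C, hC⟩ := ih (i + 1) (maj c (t i) (y (i + 1)))
    refine ⟨C, ?_⟩
    rw [val_succ, val_succ _ (k + 1), val_succ _ (k + 1)]
    have h1 : val (fun e => addBits t i (k + 1) c y (i + 1 + (e + 1))) (k + 1) =
        val (fun e => addBits t (i + 1) k (maj c (t i) (y (i + 1))) y (i + 1 + 1 + e)) (k + 1) := by
      refine Finset.sum_congr rfl fun e _ => ?_
      simp only [addBits]
      rw [Function.update_of_ne (by omega)]
      congr 3; omega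
    have h2 : val (fun e => y (i + 1 + (e + 1))) (k + 1) =
        val (fun e => y (i + 1 + 1 + e)) (k + 1) :=
      Finset.sum_congr rfl fun e _ => by
        beta_reduce; rw [show i + 1 + (e + 1) = i + 1 + 1 + e by ring]
    have h3 : val (fun e => t (i + (e + 1))) (k + 1) = val (fun e => t (i + 1 + e)) (k + 1) :=
      Finset.sum_congr rfl fun e _ => by
        beta_reduce; rw [show i + (e + 1) = i + 1 + e by ring]
    -- The full-adder identity for the lowest position: sum bit plus twice the majority.
    have h4 : (addBits t i (k + 1) c y (i + 1 + 0)).toNat +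
        2 * (maj c (t i) (y (i + 1))).toNat =
          (y (i + 1 + 0)).toNat + (t (i + 0)).toNat + c.toNat := by
      simp only [add_zero, addBits, Function.update_self, maj]
      cases c <;> cases t i <;> cases y (i + 1) <;> rfl
    rw [h1, h2, h3, pow_succ]
    nlinarith [hC, h4]

/-! ### Addition with a sign controlled by the rotated qubit -/

/-- Complement all bits if `z` is set. -/
def flipBits (z : Bool) (k : ℕ) (y : ℕ → Bool) (i : ℕ) : Bool := y i ^^ (decide (i < k) && z)

/-- Complementing reflects the register, `y ↦ 2^k - 1 - y`, so an addition between two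
complementations is a subtraction. -/
lemma val_flipBits (z : Bool) (k : ℕ) (y : ℕ → Bool) :
    (val (flipBits z k y) k : ℤ) = if z then (2 : ℤ) ^ k - 1 - (val y k : ℤ) else (val y k : ℤ) := by
  have hg : ∀ k' ≤ k, (val (flipBits z k y) k' : ℤ) =
      if z then (2 : ℤ) ^ k' - 1 - (val y k' : ℤ) else (val y k' : ℤ) := by
    intro k' hk'
    induction k' with
    | zero => cases z <;> simp [val]
    | succ k' ih =>
      have h := ih (by omega)
      rw [val_succ', val_succ', Nat.cast_add, h]
      cases z
      · simp [flipBits]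
      · cases hy : y k' <;> simp [flipBits, hy, show k' < k by omega, pow_succ] <;> ring
  exact hg k le_rfl

/-- Complement the phase-gradient register if the rotated qubit is set. -/
def flip (k : ℕ) : Circ n m r s := steps (fun i => cx .z (.y i)) k

lemma TrA.flip {k : ℕ} (hk : k ≤ r) (j : L → ℕ) (z : L → Bool) (y x : L → ℕ → Bool)
    (F : L → Bool) :
    TrA (flip k : Circ n m r s) (fun l => st (j l) (z l) (y l) (x l)) F
      (fun l => st (j l) (z l) (flipBits (z l) k (y l)) (x l)) F := by
  have key := TrA.steps (n := n) (m := m) (r := r) (s := s) (f := fun i => QMux.cx .z (.y i)) k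
    (fun k l => st (j l) (z l) (flipBits (z l) k (y l)) (x l)) (fun _ => F) ?_
  · refine TrA.congr_left key (fun l => ?_) fun _ => rfl
    congr 1
    ext i; simp [flipBits]
  · intro i hi
    refine (TrA.cx (by simp) (by simp; omega) (by simp)).congr (fun l => ?_) fun _ => rfl
    simp only [update_st_y, st_y, st_z]
    congr 1
    ext e
    by_cases h : e = i
    · subst h; simp [flipBits]
    · simp [flipBits, h, show e < i + 1 ↔ e < i by omega]

lemma toffoliCount_flip (k : ℕ) : (flip k : Circ n m r s).toffoliCount = 0 := by
  have := toffoliCount_steps (n := n) (m := m) (r := r) (s := s) (f := fun i => cx .z (.y i))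
    (k := k) (T := 0) fun i _ => by simp
  simpa [flip] using this

lemma calls_flip (k : ℕ) : (flip k : Circ n m r s).Calls [] := calls_steps (fun _ => calls_cx _ _) _

/-- Rotation by the angle with the `b + 1` ancilla bits from `β` on, and the final bit `f`, using
the `b + 1` ancillae from `κ` on. -/
def rotC (β κ b : ℕ) (f : Bool) : Circ n m r s :=
  (flip (b + 2)).seq <|
  (cond f (cx (.y 0) (.x κ))).seq <|
  (adder β κ 0 b).seq <|
  (cond f ((cx (.y 0) (.x κ)).seq (xC (wire m r s (.y 0))))).seq (flip (b + 2))

/-- The effect of `rotC` on the phase-gradient bits. -/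
def rotBits (b : ℕ) (f z : Bool) (t y : ℕ → Bool) : ℕ → Bool :=
  flipBits z (b + 2) (Function.update (addBits t 0 b (f && flipBits z (b + 2) y 0)
    (flipBits z (b + 2) y)) 0 (flipBits z (b + 2) y 0 ^^ f))

lemma toffoliCount_rotC (β κ b : ℕ) (f : Bool) :
    (rotC β κ b f : Circ n m r s).toffoliCount ≤ b := by
  have h := toffoliCount_adder (n := n) (m := m) (r := r) (s := s) β κ 0 b
  cases f <;> simpa [rotC, Circuit.toffoliCount_seq, toffoliCount_flip, cond,
    Circuit.toffoliCount] using h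

lemma calls_rotC (β κ b : ℕ) (f : Bool) : (rotC β κ b f : Circ n m r s).Calls [] :=
  (calls_flip _).seq_nil <| (calls_cond _ (calls_cx _ _)).seq_nil <| (calls_adder _ _ _ _).seq_nil <|
    (calls_cond _ ((calls_cx _ _).seq_nil (calls_xC _))).seq_nil (calls_flip _)

/-- The final bit `f` is classical, so adding it to register bit `0` produces the carry `f ∧ y₀` by
a CNOT at most. When `f` is set, bit `0` is unchanged until after the main addition and can clear
this carry before being flipped itself. -/
lemma TrA.rotC {β κ b : ℕ} (f : Bool) (hβ : β + b < κ) (hs : κ + b < s) (hr : b + 2 ≤ r)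
    (j : L → ℕ) (z : L → Bool) (y x : L → ℕ → Bool) (F : L → Bool)
    (hx : ∀ l, ∀ i ≤ b, x l (κ + i) = false) :
    TrA (rotC β κ b f : Circ n m r s) (fun l => st (j l) (z l) (y l) (x l)) F
      (fun l => st (j l) (z l) (rotBits b f (z l) (fun i => x l (β + i)) (y l)) (x l)) F := by
  have h0 : ∀ l, x l κ = false := fun l => hx l 0 (by omega)
  refine TrA.seq (TrA.flip (by omega) j z y x F) ?_
  obtain ⟨Y, hY⟩ : ∃ Y : L → ℕ → Bool, Y = fun l => flipBits (z l) (b + 2) (y l) := ⟨_, rfl⟩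
  refine TrA.congr_left (v' := fun l => st (j l) (z l) (Y l) (x l)) ?_ (fun l => by rw [hY])
    fun _ => rfl
  refine TrA.seq (v' := fun l => st (j l) (z l) (Y l) (Function.update (x l) κ (f && Y l 0)))
    (F' := F) ?_ ?_
  · cases f with
    | false =>
      refine TrA.done.congr (fun l => ?_) fun _ => rfl
      rw [Bool.false_and, ← h0 l, Function.update_eq_self, hY]
    | true =>
      refine (TrA.cx (by simp; omega) (by simp; omega) (by simp)).congr (fun l => ?_) fun _ => rfl
      simp [h0, hY]
  refine TrA.seq (v' := fun l => st (j l) (z l)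
    (addBits (fun i => x l (β + i)) 0 b (f && Y l 0) (Y l)) (Function.update (x l) κ (f && Y l 0)))
    (F' := F) ?_ ?_
  · refine (TrA.adder (by omega) (by omega) (by omega) j z Y _ F ?_).congr
      (fun l => ?_) fun _ => rfl
    · intro l i hi
      rw [Function.update_of_ne (by omega), ← hx l (i + 1) (by omega)]
      congr 1; omega
    · congr 1
      rw [addBits_congr (t' := fun i => x l (β + i))]
      · simp
      · intro i _ hi
        rw [Function.update_of_ne (by omega)]
  refine TrA.seq (v' := fun l => st (j l) (z l)
    (Function.update (addBits (fun i => x l (β + i)) 0 b (f && Y l 0) (Y l)) 0 (Y l 0 ^^ f)) (x l))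
    (F' := F) ?_ ?_
  · have e : ∀ l, addBits (fun i => x l (β + i)) 0 b (f && Y l 0) (Y l) 0 = Y l 0 :=
      fun l => addBits_of_lt _ _ _ _ _ _ (by omega)
    cases f with
    | false =>
      refine TrA.done.congr (fun l => ?_) fun _ => rfl
      have := e l
      simp only [Bool.false_and, Bool.xor_false] at this ⊢
      rw [Function.update_eq_self_iff.2 (h0 l).symm, Function.update_eq_self_iff.2 this.symm]
    | true =>
      refine ((TrA.cx (by simp; omega) (by simp; omega) (by simp)).seq
        (TrA.x (by simp; omega))).congr (fun l => ?_) fun _ => rfl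
      have := e l
      simp only [Bool.true_and] at this
      have h1 : Function.update (x l) κ false = x l := Function.update_eq_self_iff.2 (h0 l).symm
      simp [this, h1]
  · refine (TrA.flip (by omega) j z _ x F).congr (fun l => ?_) fun _ => rfl
    rw [hY, rotBits]

lemma val_rotBits (b : ℕ) (f z : Bool) (t y : ℕ → Bool) :
    (val (rotBits b f z t y) (b + 2) : ℤ) ≡
      val y (b + 2) + (if z then -1 else 1) * (2 * val t (b + 1) + f.toNat) [ZMOD 2 ^ (b + 2)] := by
  have h := val_flipBits z (b + 2) y
  have h' := val_flipBits z (b + 2) (Function.update (addBits t 0 b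
    (f && flipBits z (b + 2) y 0) (flipBits z (b + 2) y)) 0 (flipBits z (b + 2) y 0 ^^ f))
  rw [rotBits, h']
  generalize flipBits z (b + 2) y = Y at *
  obtain ⟨C, hC⟩ := val_addBits t 0 b (f && Y 0) Y
  have e1 : val (Function.update (addBits t 0 b (f && Y 0) Y) 0 (Y 0 ^^ f)) (b + 2) +
      2 ^ (b + 2) * C = val Y (b + 2) + 2 * val t (b + 1) + f.toNat := by
    rw [val_succ, val_succ Y]
    simp only [zero_add, add_comm 1] at hC
    simp only [Function.update_self, Function.update_of_ne (Nat.succ_ne_zero _)]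
    -- Half-adder identity at the bottom bit, where the summand is `f`.
    have : (Y 0 ^^ f).toNat + 2 * (f && Y 0).toNat = (Y 0).toNat + f.toNat := by
      cases f <;> cases Y 0 <;> rfl
    rw [pow_succ]
    nlinarith [hC, this]
  have e2 : (val (Function.update (addBits t 0 b (f && Y 0) Y) 0 (Y 0 ^^ f)) (b + 2) : ℤ) +
      2 ^ (b + 2) * C = val Y (b + 2) + 2 * val t (b + 1) + f.toNat := by exact_mod_cast e1
  refine Int.ModEq.symm ((Int.modEq_iff_dvd).2 ?_)
  cases z
  · exact ⟨-C, by simp only [Bool.false_eq_true, if_false] at h ⊢; linarith⟩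
  · exact ⟨C, by simp only [if_true] at h ⊢; linarith⟩

end Adder

/-! ### Numbers and bits -/

lemma val_testBit (t k : ℕ) : val (fun i => t.testBit i) k = t % 2 ^ k := by
  induction k with
  | zero => simp [val, Nat.mod_one]
  | succ k ih =>
    rw [val_succ', ih, mod_two_pow_succ_eq, add_comm]
    cases t.testBit k <;> simp

lemma val_injective {f g : ℕ → Bool} {k : ℕ} (h : val f k = val g k) : ∀ i < k, f i = g i := by
  induction k generalizing f g with
  | zero => intro i hi; omega
  | succ k ih =>
    rw [val_succ, val_succ] at h
    have h0 : f 0 = g 0 := by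
      cases hf : f 0 <;> cases hg : g 0 <;> simp [hf, hg] at h ⊢ <;> omega
    have h1 := ih (f := fun i => f (i + 1)) (g := fun i => g (i + 1)) (by rw [h0] at h; omega)
    intro i hi
    cases i with
    | zero => exact h0
    | succ i => exact h1 i (by omega)

lemma val_lt (f : ℕ → Bool) (k : ℕ) : val f k < 2 ^ k := by
  induction k with
  | zero => simp [val]
  | succ k ih =>
    rw [val_succ', pow_succ]
    have : (f k).toNat * 2 ^ k ≤ 1 * 2 ^ k := Nat.mul_le_mul_right _ (Bool.toNat_le _)
    omega

/-- Extend a finite sequence of bits by zeros. -/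
def extB {r : ℕ} (y : Fin r → Bool) (i : ℕ) : Bool := if h : i < r then y ⟨i, h⟩ else false

lemma bitsToNat_eq_val {r : ℕ} (y : Fin r → Bool) : bitsToNat y = val (extB y) r := by
  rw [bitsToNat, val, ← Fin.sum_univ_eq_sum_range]
  refine Finset.sum_congr rfl fun i _ => ?_
  simp only [extB, i.2, dif_pos]
  cases y i <;> simp

/-- Phase kickback: the amplitude is a character of `ℤ / 2^r`, so shifting the register by `M`
amounts to a global factor. Working modulo `2 ^ r` is harmless because `exp (2πi q) = 1` for
integers `q`. -/
lemma phaseAmp_eq_mul_exp {r : ℕ} {y y' : Fin r → Bool} {M : ℤ}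
    (h : (bitsToNat y' : ℤ) ≡ bitsToNat y + M [ZMOD 2 ^ r]) :
    phaseAmp y = phaseAmp y' * Complex.exp (2 * Real.pi * Complex.I * (M / 2 ^ r)) := by
  obtain ⟨q, hq⟩ := (Int.modEq_iff_dvd).1 h
  have hq' : (bitsToNat y : ℂ) = bitsToNat y' - M + 2 ^ r * q := by
    have : (bitsToNat y : ℤ) = bitsToNat y' - M + 2 ^ r * q := by linarith
    exact_mod_cast this
  have h2 : (2 : ℂ) ^ r ≠ 0 := by positivity
  rw [phaseAmp, phaseAmp, div_mul_eq_mul_div, ← Complex.exp_add, hq']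
  congr 1
  rw [show -(2 * (Real.pi : ℂ) * Complex.I * (bitsToNat y' - M + 2 ^ r * q) / 2 ^ r) =
    -(2 * Real.pi * Complex.I * bitsToNat y' / 2 ^ r) + 2 * Real.pi * Complex.I * (M / 2 ^ r) +
      (-q : ℤ) * (2 * Real.pi * Complex.I) by field_simp; push_cast; ring]
  rw [Complex.exp_add _ ((-q : ℤ) * _), Complex.exp_int_mul_two_pi_mul_I, mul_one]

/-! ### Encoded states -/

section Encoded

variable {c n m r s : ℕ} {W : Type} [Fintype W] [DecidableEq W]

/-- Labels of the basis states: control value, rotated qubit and phase-gradient register. -/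
abbrev Lab (c r : ℕ) : Type := Fin c × Bool × (Fin r → Bool)

/-- The basis states with the ancilla bits `x j` for the control value `j`. -/
def labSt (x : ℕ → ℕ → Bool) (l : Lab c r) : Ad → Bool :=
  st l.1 l.2.1 (extB l.2.2) (x l.1)

/-- The phase-gradient state in the third factor. -/
noncomputable def gradient (c r : ℕ) (W : Type) [DecidableEq W] :
    Matrix (Lab c r × W) (Sys c W) ℂ :=
  Matrix.of fun l t => if l.1.1 = t.1 ∧ l.1.2.1 = t.2.1 ∧ l.2 = t.2.2 then phaseAmp l.1.2.2 else 0

/-- The version of `encode` with ancilla bits `x j` and sign `(-1)^{F j}` for the control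
value `j`. -/
noncomputable def enc (c m r s : ℕ) (W : Type) [DecidableEq W] (x : ℕ → ℕ → Bool) (F : ℕ → Bool) :
    Matrix ((Wire m r s → Bool) × W) (Sys c W) ℂ :=
  Matrix.of fun f t =>
    if (∀ i, f.1 (.inl (.inl i)) = (t.1 : ℕ).testBit i) ∧ f.1 (.inl (.inr ())) = t.2.1 ∧
        (∀ i, f.1 (.inr (.inr i)) = x t.1 i) ∧ f.2 = t.2.2
    then (if F t.1 then -1 else 1) * phaseAmp fun i => f.1 (.inr (.inl i)) else 0

lemma encode_eq_enc (c a r : ℕ) : encode c r a W =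
    enc c (Nat.clog 2 c) r a W (fun _ _ => false) (fun _ => false) := by
  ext f t
  simp [encode, enc]

lemma eq_st_iff (f : Wire m r s → Bool) (j : ℕ) (z : Bool) (y : Fin r → Bool) (x : ℕ → Bool) :
    (f = fun q => st j z (extB y) x (ad q)) ↔ (y = fun i => f (.inr (.inl i))) ∧
      (∀ i, f (.inl (.inl i)) = j.testBit i) ∧ f (.inl (.inr ())) = z ∧
        ∀ i, f (.inr (.inr i)) = x i := by
  constructor
  · rintro rfl
    simp [ad, extB]
  · rintro ⟨rfl, h1, h2, h3⟩
    ext q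
    rcases q with ((i | i) | (i | i))
    · simp [ad, h1]
    · simp [ad, ← h2]
    · simp [ad, extB]
    · simp [ad, h3]

/-- If the register is permuted by a bijection under which the amplitudes change only by the factor
`D`, reindexing the superposition gives the same phase-gradient state times `D`. This converts an
addition into a diagonal gate on control and rotated qubit. -/
lemma emb_mul_gradient (G : Fin c → Bool → (Fin r → Bool) → Fin r → Bool)
    (hG : ∀ j z, Function.Bijective (G j z)) (D : Sys c W → ℂ)
    (hD : ∀ j z w y, phaseAmp y = phaseAmp (G j z y) * D (j, z, w)) (x : ℕ → ℕ → Bool)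
    (F : ℕ → Bool) :
    emb W (fun (l : Lab c r) (q : Wire m r s) =>
        st l.1 l.2.1 (extB (G l.1 l.2.1 l.2.2)) (x l.1) (ad q)) (fun l => F l.1) *
      gradient c r W = enc c m r s W x F * Matrix.diagonal D := by
  ext ⟨f, w⟩ ⟨j, z, w'⟩
  obtain ⟨y, hy⟩ := (hG j z).2 fun i => f (.inr (.inl i))
  rw [Matrix.mul_diagonal, Matrix.mul_apply, Finset.sum_eq_single ((j, z, y), w')]
  · simp only [emb, gradient, enc, Matrix.of_apply, eq_st_iff, hy, true_and, and_true, if_true]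
    rw [hD j z w' y, hy]
    by_cases h : w = w' <;> simp only [h, true_and, and_true, and_false, false_and, if_false,
      zero_mul]
    split_ifs <;> simp
  · rintro ⟨⟨j', z', y'⟩, w''⟩ - h
    simp only [emb, gradient, Matrix.of_apply, eq_st_iff]
    by_cases h1 : j' = j ∧ z' = z ∧ w'' = w'
    · obtain ⟨rfl, rfl, rfl⟩ := h1
      rw [if_neg, zero_mul]
      rintro ⟨-, h2, -⟩
      exact h (by rw [(hG j' z').1 (h2.trans hy.symm)])
    · rw [if_neg h1, mul_zero]
  · simp

lemma enc_eq_emb_mul_gradient (x : ℕ → ℕ → Bool) (F : ℕ → Bool) :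
    enc c m r s W x F =
      emb W (fun (l : Lab c r) (q : Wire m r s) => labSt x l (ad q)) (fun l => F l.1) *
        gradient c r W := by
  have := emb_mul_gradient (m := m) (s := s) (W := W) (c := c) (r := r) (fun _ _ y => y)
    (fun _ _ => Function.bijective_id) (fun _ => 1) (by simp) x F
  rw [Matrix.diagonal_one, Matrix.mul_one] at this
  exact this.symm

/-- Ancilla contents and sign depend on the control value alone, so a black box on the target passes
through the encoding even while loaded bits and unrepaired signs are present. -/
lemma callMat_mul_enc (V : Matrix (Bool × W) (Bool × W) ℂ) (x : ℕ → ℕ → Bool) (F : ℕ → Bool) :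
    callMat (Sum.inl (Sum.inr ()) : Wire m r s) V * enc c m r s W x F =
      enc c m r s W x F * ((1 : Matrix (Fin c) (Fin c) ℂ) ⊗ₖ V) := by
  ext ⟨f, w⟩ ⟨j, z, w'⟩
  rw [Matrix.mul_apply, Matrix.mul_apply,
    Finset.sum_eq_single (Function.update f (.inl (.inr ())) z, w'),
    Finset.sum_eq_single (j, f (.inl (.inr ())), w)]
  · simp only [callMat, enc, Matrix.of_apply, Matrix.kroneckerMap_apply, Matrix.one_apply_eq,
      Function.update_self, one_mul]
    rw [if_pos fun q hq => by rw [Function.update_of_ne hq]]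
    simp [mul_comm]
  · rintro ⟨j', z', w''⟩ - h
    simp only [enc, Matrix.of_apply, Matrix.kroneckerMap_apply]
    by_cases hj : j' = j
    · subst hj
      rw [if_neg, zero_mul]
      rintro ⟨-, h2, -, h3⟩
      exact h (by rw [h2, h3])
    · simp [Matrix.one_apply_ne hj]
  · simp
  · rintro ⟨g, w''⟩ - h
    simp only [enc, callMat, Matrix.of_apply]
    by_cases hg : ∀ q, q ≠ Sum.inl (Sum.inr ()) → f q = g q
    · rw [if_neg (c := _ ∧ _), mul_zero]
      rintro ⟨-, h2, -, h3⟩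
      refine h ?_
      rw [h3, Prod.mk.injEq, Function.eq_update_iff]
      exact ⟨⟨h2, fun q hq => (hg q hq).symm⟩, rfl⟩
    · rw [if_neg hg, zero_mul]
  · simp

/-! ### Circuits acting on encoded states -/

/-- The circuit performs `E ρ E† ↦ E' ρ E'†`. -/
def Maps {T Q : Type} [Fintype Q] [DecidableEq Q] [Fintype T] (τ : Q)
    (V : Fin n → Matrix (Bool × W) (Bool × W) ℂ) (C : Circuit n Q)
    (E E' : Matrix ((Q → Bool) × W) T ℂ) : Prop :=
  ∀ ρ, C.run τ V (conjBy E ρ) = conjBy E' ρ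

variable {τ : Wire m r s} {V : Fin n → Matrix (Bool × W) (Bool × W) ℂ} {C D : Circ n m r s}
variable {T T' : Type} [Fintype T] [Fintype T']

lemma Maps.mul {E E' : Matrix ((Wire m r s → Bool) × W) T ℂ} (h : Maps τ V C E E')
    (M : Matrix T T' ℂ) : Maps τ V C (E * M) (E' * M) := by
  intro ρ
  rw [conjBy_mul, h, conjBy_mul]

lemma Maps.seq {E E' E'' : Matrix ((Wire m r s → Bool) × W) T ℂ} (h : Maps τ V C E E')
    (h' : Maps τ V D E' E'') : Maps τ V (C.seq D) E E'' := by
  intro ρ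
  rw [Circuit.run_seq, h, h']

lemma TrA.maps {v v' : Lab c r → Ad → Bool} {F F' : Lab c r → Bool} (h : TrA C v F v' F') :
    Maps τ V C (emb W (fun l q => v l (ad q)) F * gradient c r W)
      (emb W (fun l q => v' l (ad q)) F' * gradient c r W) := by
  intro ρ
  rw [conjBy_mul, conjBy_mul]
  exact h W τ V _

lemma TrA.maps_enc {x x' : ℕ → ℕ → Bool} {F F' : ℕ → Bool}
    (h : TrA C (labSt (c := c) (r := r) x) (fun l => F l.1) (labSt x') (fun l => F' l.1)) :
    Maps τ V C (enc c m r s W x F) (enc c m r s W x' F') := by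
  rw [enc_eq_emb_mul_gradient, enc_eq_emb_mul_gradient]
  exact h.maps

lemma Maps.call {V : Fin n → Matrix (Bool × W) (Bool × W) ℂ} (k : Fin n) (x : ℕ → ℕ → Bool)
    (F : ℕ → Bool) :
    Maps (.inl (.inr ())) V (Circuit.call k .done) (enc c m r s W x F)
      (enc c m r s W x F * ((1 : Matrix (Fin c) (Fin c) ℂ) ⊗ₖ V k)) := by
  intro ρ
  rw [Circuit.run, Circuit.run, ← conjBy_mul, callMat_mul_enc]

lemma rotBits_of_ge {b : ℕ} (f z : Bool) (t y : ℕ → Bool) (i : ℕ) (hi : b + 2 ≤ i)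
    (hy : y i = false) : rotBits b f z t y i = false := by
  have h : ∀ (k i' : ℕ) (c : Bool) (y : ℕ → Bool), i' + k + 1 < i → addBits t i' k c y i = y i := by
    intro k
    induction k with
    | zero => intro i' c y h; rw [addBits, Function.update_of_ne (by omega)]
    | succ k ih =>
      intro i' c y h
      rw [addBits, Function.update_of_ne (by omega), ih _ _ _ (by omega)]
  rw [rotBits, flipBits, Function.update_of_ne (by omega), h _ _ _ _ (by omega), flipBits]
  simp [hy, show ¬ i < b + 2 by omega]

/-- The circuit adds `± (2 t + f)` to a register of `b + 2` bits, and `(2 t + f) / 2^(b+2)` is the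
angle; the sign is that of `Z`. By phase kickback this is the multiplexed rotation. -/
lemma Maps.rotC {b β κ : ℕ} (f : Bool) (hβ : β + b < κ) (hs : κ + b < s) (x : ℕ → ℕ → Bool)
    (F : ℕ → Bool) (hx : ∀ j, ∀ i ≤ b, x j (κ + i) = false) {θ : Fin c → ℝ} (t : ℕ → ℕ)
    (ht : ∀ j, t j < 2 ^ (b + 1)) (hxt : ∀ j : Fin c, ∀ i ≤ b, x j (β + i) = (t j).testBit i)
    (hθ : ∀ j, θ j = (t j : ℝ) / 2 ^ (b + 1) + if f then 1 / 2 ^ (b + 2) else 0)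
    {τ : Wire m (b + 2) s} :
    Maps τ V (rotC β κ b f : Circ n m (b + 2) s) (enc c m (b + 2) s W x F)
      (enc c m (b + 2) s W x F * muxRotation W θ) := by
  obtain ⟨G, hG⟩ : ∃ G : Fin c → Bool → (Fin (b + 2) → Bool) → Fin (b + 2) → Bool,
    G = fun (j : Fin c) z y (i : Fin (b + 2)) => rotBits b f z (fun i => x j (β + i)) (extB y) i := ⟨_, rfl⟩
  have hext : ∀ j z y, extB (G j z y) = rotBits b f z (fun i => x j (β + i)) (extB y) := by
    intro j z y
    ext i
    by_cases hi : i < b + 2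
    · simp [extB, hi, hG]
    · rw [rotBits_of_ge _ _ _ _ _ (by omega) (by simp [extB, hi])]
      simp [extB, hi]
  have hval : ∀ j z y, (bitsToNat (G j z y) : ℤ) ≡
      bitsToNat y + (if z then -1 else 1) * (2 * t j + f.toNat) [ZMOD 2 ^ (b + 2)] := by
    intro j z y
    rw [bitsToNat_eq_val, bitsToNat_eq_val, hext]
    have h1 : val (fun i => x j (β + i)) (b + 1) = t j := by
      rw [← Nat.mod_eq_of_lt (ht j), ← val_testBit]
      refine Finset.sum_congr rfl fun i hi => ?_
      beta_reduce
      rw [hxt j i (by simp at hi; omega)]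
    have := val_rotBits b f z (fun i => x j (β + i)) (extB y)
    rwa [h1] at this
  -- A shift modulo `2 ^ (b + 2)` is injective on the register values, which all lie below that
  -- modulus.
  have hbij : ∀ j z, Function.Bijective (G j z) := by
    intro j z
    refine (Finite.injective_iff_bijective).1 fun y y' h => ?_
    have h1 := (hval j z y).symm.trans ((congrArg (fun y => (bitsToNat y : ℤ)) h ▸
      hval j z y' : (bitsToNat (G j z y) : ℤ) ≡ _ [ZMOD _]))
    have h2 := Int.ModEq.add_right_cancel' _ h1
    rw [bitsToNat_eq_val, bitsToNat_eq_val] at h2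
    have h3 : (val (extB y) (b + 2) : ℤ) = val (extB y') (b + 2) := by
      have b1 := val_lt (extB y) (b + 2)
      have b2 := val_lt (extB y') (b + 2)
      have : ((val (extB y) (b + 2) : ℤ)) % 2 ^ (b + 2) = (val (extB y') (b + 2)) % 2 ^ (b + 2) := h2
      rwa [Int.emod_eq_of_lt (by positivity) (by exact_mod_cast b1),
        Int.emod_eq_of_lt (by positivity) (by exact_mod_cast b2)] at this
    have h4 := val_injective (Int.natCast_inj.1 h3)
    ext i
    simpa [extB] using h4 i i.2
  have hθ' : ∀ j, (θ j : ℂ) = (2 * t j + f.toNat) / 2 ^ (b + 2) := by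
    intro j
    have : θ j = (2 * t j + f.toNat) / 2 ^ (b + 2) := by
      rw [hθ, pow_succ (2 : ℝ) (b + 1)]
      cases f <;> simp <;> field_simp
    rw [this]
    push_cast
    rfl
  have key := emb_mul_gradient (m := m) (s := s) G hbij
    (fun t : Sys c W => Complex.exp (2 * Real.pi * Complex.I * θ t.1 * (if t.2.1 then -1 else 1)))
    (fun j z w y => by
      rw [phaseAmp_eq_mul_exp (hval j z y)]
      congr 2
      rw [hθ']
      cases z <;> push_cast <;> ring) x F
  have tr := (TrA.rotC (n := n) (m := m) (r := b + 2) (s := s) f hβ hs le_rfl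
    (fun l : Lab c (b + 2) => (l.1 : ℕ)) (fun l => l.2.1) (fun l => extB l.2.2) (fun l => x l.1)
    (fun l => F l.1) (fun l => hx _)).maps (W := W) (τ := τ) (V := V)
  rw [muxRotation, ← key, enc_eq_emb_mul_gradient]
  simp only [hext]
  exact tr

/-- The sign caused by the outcome is not repaired here but handed to the continuation, which has to
reach the same state `E` in both cases. -/
lemma Maps.measX {i : ℕ} (hi : i < s) {cont : Bool → Circ n m r s} (x : ℕ → ℕ → Bool)
    (F : ℕ → Bool) (M : Matrix (Sys c W) T ℂ) {E : Matrix ((Wire m r s → Bool) × W) T ℂ}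
    (h : ∀ o, Maps τ V (cont o) (enc c m r s W (fun j => Function.update (x j) i false)
      (fun j => F j ^^ (o && x j i)) * M) E) :
    Maps τ V (measX (wire m r s (.x i)) cont) (enc c m r s W x F * M) E := by
  intro ρ
  have hi' : (Ad.x i).Valid m r s := hi
  have e : ∀ o, emb W (fun (l : Lab c r) =>
        Function.update (fun q => labSt x l (ad q)) (wire m r s (.x i)) false)
        (fun l => F l.1 ^^ (o && labSt x l (ad (wire m r s (.x i))))) * gradient c r W =
      enc c m r s W (fun j => Function.update (x j) i false) (fun j => F j ^^ (o && x j i)) := by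
    intro o
    rw [enc_eq_emb_mul_gradient]
    simp only [update_comp_ad hi', ad_wire hi', labSt, update_st_x, st_x]
  rw [enc_eq_emb_mul_gradient, Matrix.mul_assoc, conjBy_mul, run_measX]
  have h' : ∀ o, (cont o).run τ V (conjBy (emb W (fun (l : Lab c r) =>
        Function.update (fun q => labSt x l (ad q)) (wire m r s (.x i)) false)
        (fun l => F l.1 ^^ (o && labSt x l (ad (wire m r s (.x i))))))
          (conjBy (gradient c r W * M) ρ)) = conjBy E ρ := by
    intro o
    rw [← h o ρ, ← e, ← conjBy_mul, Matrix.mul_assoc]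
  simp only [h', Fintype.sum_bool, ← add_smul]
  norm_num

end Encoded

section Assembly

variable {c n m r s : ℕ}

/-! ### Erasing the ancillae -/

/-- Erase the `k` ancillae from `a` on, with contents `x j` for the control value `j`, by
measurements. The sign `F j` is updated and passed to the remaining circuit. -/
def measAll (x : ℕ → ℕ → Bool) (a : ℕ) (cont : (ℕ → Bool) → Circ n m r s) :
    ℕ → (ℕ → Bool) → Circ n m r s
  | 0, F => cont F
  | k + 1, F => measX (wire m r s (.x (a + k))) fun o =>
      measAll x a cont k fun j => F j ^^ (o && x j (a + k))

lemma calls_measAll {x : ℕ → ℕ → Bool} {a : ℕ} {cont : (ℕ → Bool) → Circ n m r s}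
    {l : List (Fin n)} (h : ∀ F, (cont F).Calls l) (k : ℕ) (F : ℕ → Bool) :
    (measAll x a cont k F).Calls l := by
  induction k generalizing F with
  | zero => exact h F
  | succ k ih => exact calls_measX fun o => ih _

lemma toffoliCount_measAll {x : ℕ → ℕ → Bool} {a T : ℕ} {cont : (ℕ → Bool) → Circ n m r s}
    (h : ∀ F, (cont F).toffoliCount ≤ T) (k : ℕ) (F : ℕ → Bool) :
    (measAll x a cont k F).toffoliCount ≤ T := by
  induction k generalizing F with
  | zero => exact h F
  | succ k ih => exact toffoliCount_measX fun o => ih _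

variable {W : Type} [Fintype W] [DecidableEq W] {T : Type} [Fintype T]

/-- Each outcome adds the measured bit, a known function of `j`, to the pending sign. The
continuation is therefore required to work for every sign function `F`. -/
lemma Maps.measAll {τ : Wire m r s} {V : Fin n → Matrix (Bool × W) (Bool × W) ℂ} {a k : ℕ}
    (hk : a + k ≤ s) {cont : (ℕ → Bool) → Circ n m r s} (x : ℕ → ℕ → Bool)
    (M : Matrix (Sys c W) T ℂ) {E : Matrix ((Wire m r s → Bool) × W) T ℂ}
    (h : ∀ F, Maps τ V (cont F)
      (enc c m r s W (fun j i => decide (i < a) && x j i) F * M) E) (F : ℕ → Bool) :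
    Maps τ V (measAll x a cont k F)
      (enc c m r s W (fun j i => decide (i < a + k) && x j i) F * M) E := by
  induction k generalizing F with
  | zero => exact h F
  | succ k ih =>
    refine Maps.measX (by omega) _ F M fun o => ?_
    convert ih (by omega) (fun j => F j ^^ (o && x j (a + k))) using 3
    · ext j i
      by_cases hi : i = a + k
      · subst hi; simp
      · rw [Function.update_of_ne hi]
        congr 2
        exact propext ⟨fun h => by omega, fun h => by omega⟩
    · simp

/-! ### One block of rotations -/

/-- The bits of the angles of the rotations in the list `l`. -/
def dataBit (b : ℕ) (t : Fin n → ℕ → ℕ) (l : List (Fin n)) (j i : ℕ) : Bool :=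
  match l[i / b]? with
  | some κ => (t κ j).testBit (i % b)
  | none => false

/-- Load the bits `D j i`, `i < B`, for the control value `j`, by a lookup of `2 ^ u` registers at a
time. -/
def load (m' c' B u : ℕ) (D : ℕ → ℕ → Bool) : Circ n m r s :=
  (select u (m' - u) (c' ⌈/⌉ 2 ^ u) (2 ^ u * B)
    fun q i => D (q * 2 ^ u + i / B) (i % B)).seq (swapNet B u)

/-- The ancilla bits after `load`. -/
def loadBits (B u : ℕ) (D : ℕ → ℕ → Bool) (j : ℕ) : ℕ → Bool :=
  swapNetBits B j u fun i => decide (i < 2 ^ u * B) && D (j / 2 ^ u * 2 ^ u + i / B) (i % B)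

lemma calls_load (m' c' B u : ℕ) (D : ℕ → ℕ → Bool) :
    (load m' c' B u D : Circ n m r s).Calls [] :=
  (calls_select _ _ _ _ _).seq_nil (calls_swapNet _ _)

lemma ceilDiv_pos {c' : ℕ} (hc : 0 < c') (u : ℕ) : 0 < c' ⌈/⌉ 2 ^ u := by
  by_contra h
  have : c' ⌈/⌉ 2 ^ u ≤ 0 := by omega
  rw [ceilDiv_le_iff_le_mul (by positivity)] at this
  simp at this
  omega

lemma div_lt_ceilDiv {j c' : ℕ} (hj : j < c') (u : ℕ) : j / 2 ^ u < c' ⌈/⌉ 2 ^ u := by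
  by_contra h
  rw [not_lt, ceilDiv_le_iff_le_mul (by positivity)] at h
  have := Nat.mul_div_le j (2 ^ u)
  omega

lemma toffoliCount_load {m' c' B u : ℕ} (hc : 0 < c') (D : ℕ → ℕ → Bool) :
    (load m' c' B u D : Circ n m r s).toffoliCount ≤ c' ⌈/⌉ 2 ^ u + (2 ^ u - 1) * B := by
  rw [load, Circuit.toffoliCount_seq]
  have h1 := toffoliCount_select (n := n) (m := m) (r := r) (s := s) (β := u) (d := m' - u)
    (N := c' ⌈/⌉ 2 ^ u) (k := 2 ^ u * B) (fun q i => D (q * 2 ^ u + i / B) (i % B))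
    (ceilDiv_pos hc u)
  have h2 := toffoliCount_swapNet (n := n) (m := m) (r := r) (s := s) B u
  omega

/-- The lookup wrote the rows `q 2^u + i'` for the quotient `q` of `j`; the swap network selects `i'
= j mod 2^u`, and quotient and remainder recombine to `j`. -/
lemma loadBits_of_lt {B u j i : ℕ} (D : ℕ → ℕ → Bool) (hi : i < B) :
    loadBits B u D j i = D j i := by
  have h : B * (j % 2 ^ u) + i < 2 ^ u * B := by
    have h1 : j % 2 ^ u + 1 ≤ 2 ^ u := Nat.mod_lt _ (by positivity)
    have h2 := Nat.mul_le_mul_left B h1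
    rw [mul_comm (2 ^ u)]
    rw [mul_add, mul_one] at h2
    omega
  rw [loadBits, swapNetBits_of_lt _ hi, decide_eq_true h, Bool.true_and,
    Nat.mul_add_div (by omega), Nat.div_eq_of_lt hi, add_zero, Nat.mul_add_mod,
    Nat.mod_eq_of_lt hi, Nat.div_add_mod']

lemma loadBits_of_ge {B u j i : ℕ} (D : ℕ → ℕ → Bool) (hi : 2 ^ u * B ≤ i) :
    loadBits B u D j i = false := by
  rw [loadBits, swapNetBits_of_ge _ hi, decide_eq_false (by omega), Bool.false_and]

lemma Maps.load {B u : ℕ} {τ : Wire m r s} {V : Fin n → Matrix (Bool × W) (Bool × W) ℂ}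
    (hc : c ≤ 2 ^ m) (hu : u ≤ m) (hs : 2 ^ u * B + (m - u) ≤ s)
    (D : ℕ → ℕ → Bool) (F : ℕ → Bool) :
    Maps τ V (load m c B u D) (enc c m r s W (fun _ _ => false) F)
      (enc c m r s W (loadBits B u D) F) := by
  refine TrA.maps_enc ?_
  refine (TrA.select (L := Lab c r) (N := c ⌈/⌉ 2 ^ u)
    (fun q i => D (q * 2 ^ u + i / B) (i % B)) (by omega) hs (fun l => (l.1 : ℕ))
    (fun l => div_lt_ceilDiv l.1.2 u) (fun l => ?_) (fun l => l.2.1) (fun l => extB l.2.2)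
    fun l => F l.1).seq (TrA.swapNet hu (by omega) _ _ _ _ _)
  rw [show u + (m - u) = m by omega]
  exact l.1.2.trans_le hc

/-- Perform the rotations in the list `l`, the first of which has its bits at position `pos`. -/
def rots (B b : ℕ) (f : Fin n → Bool) : List (Fin n) → ℕ → Circ n m r s
  | [], _ => .done
  | κ :: l, pos => .call κ ((rotC (pos * (b + 1)) B b (f κ)).seq (rots B b f l (pos + 1)))

lemma calls_rots (B b : ℕ) (f : Fin n → Bool) (l : List (Fin n)) (pos : ℕ) :
    (rots B b f l pos : Circ n m r s).Calls l := by
  induction l generalizing pos with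
  | nil => rfl
  | cons κ l ih => exact ⟨l, rfl, (calls_rotC _ _ _ _).seq_nil (ih _)⟩

lemma toffoliCount_rots (B b : ℕ) (f : Fin n → Bool) (l : List (Fin n)) (pos : ℕ) :
    (rots B b f l pos : Circ n m r s).toffoliCount ≤ l.length * b := by
  induction l generalizing pos with
  | nil => simp [rots, Circuit.toffoliCount]
  | cons κ l ih =>
    have h1 := ih (pos + 1)
    have h2 := toffoliCount_rotC (n := n) (m := m) (r := r) (s := s) (pos * (b + 1)) B b (f κ)
    rw [rots, Circuit.toffoliCount, Circuit.toffoliCount_seq, List.length_cons, add_one_mul]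
    omega

/-- The product of the gates in a list, the first of which is applied first. -/
noncomputable def gates (θ : Fin n → Fin c → ℝ) (V : Fin n → Matrix (Bool × W) (Bool × W) ℂ)
    (l : List (Fin n)) : Matrix (Sys c W) (Sys c W) ℂ :=
  (l.reverse.map fun k => muxRotation W (θ k) * ((1 : Matrix (Fin c) (Fin c) ℂ) ⊗ₖ V k)).prod

lemma gates_append (θ : Fin n → Fin c → ℝ) (V : Fin n → Matrix (Bool × W) (Bool × W) ℂ)
    (l l' : List (Fin n)) : gates θ V (l ++ l') = gates θ V l' * gates θ V l := by
  simp [gates]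

lemma gates_finRange (θ : Fin n → Fin c → ℝ) (V : Fin n → Matrix (Bool × W) (Bool × W) ℂ) :
    gates θ V (List.finRange n).reverse = muxGate θ V := by
  rw [gates, List.reverse_reverse, muxGate, List.ofFn_eq_map]

/-- The rotation at position `pos + e` reads its `b + 1` bits from the corresponding slot of the
loaded data. Rotations leave the ancillae intact, so the encoding is the same before and after each
gate; the carries use the clean ancillae from `B` on. -/
lemma Maps.rots {b B : ℕ} (f : Fin n → Bool) (t : Fin n → ℕ → ℕ)
    (ht : ∀ κ j, t κ j < 2 ^ (b + 1)) {θ : Fin n → Fin c → ℝ}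
    (hθ : ∀ κ j, θ κ j = (t κ j : ℝ) / 2 ^ (b + 1) + if f κ then 1 / 2 ^ (b + 2) else 0)
    (V : Fin n → Matrix (Bool × W) (Bool × W) ℂ) (hs : B + b < s) (l : List (Fin n)) (pos : ℕ)
    (hl : (pos + l.length) * (b + 1) ≤ B) (x : ℕ → ℕ → Bool) (hx : ∀ j i, B ≤ i → x j i = false)
    (hxt : ∀ j i e (h : e < l.length), i < b + 1 →
      x j ((pos + e) * (b + 1) + i) = (t l[e] j).testBit i) (F : ℕ → Bool) :
    Maps (.inl (.inr ())) V (rots B b f l pos : Circ n m (b + 2) s) (enc c m (b + 2) s W x F)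
      (enc c m (b + 2) s W x F * gates θ V l) := by
  induction l generalizing pos with
  | nil =>
    intro ρ
    simp [QMux.rots, Circuit.run, gates]
  | cons κ l ih =>
    have e1 : gates θ V (κ :: l) = (muxRotation W (θ κ) *
        ((1 : Matrix (Fin c) (Fin c) ℂ) ⊗ₖ V κ) |> fun M => gates θ V l * M) := by
      simp [gates]
    have e2 : (QMux.rots B b f (κ :: l) pos : Circ n m (b + 2) s) = (Circuit.call κ .done).seq
      ((QMux.rotC (pos * (b + 1)) B b (f κ)).seq (QMux.rots B b f l (pos + 1))) := rfl
    have hlen : (pos + 1) * (b + 1) ≤ B := by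
      refine le_trans (Nat.mul_le_mul_right _ ?_) hl
      simp
    rw [e1, e2]
    beta_reduce
    rw [← Matrix.mul_assoc, ← Matrix.mul_assoc]
    refine (Maps.call κ x F).seq (Maps.mul ?_ _)
    refine Maps.seq (Maps.rotC (f κ) (by rw [add_one_mul] at hlen; omega) (by omega) x F
      (fun j i _ => hx j _ (by omega)) (t κ) (ht κ) ?_ (hθ κ)) ?_
    · intro j i hi
      have := hxt j i 0 (by simp) (by omega)
      simpa using this
    · refine Maps.mul (ih (pos + 1) (le_trans (Nat.mul_le_mul_right _ ?_) hl) fun j i e h hi => ?_) _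
      · simp; omega
      · have := hxt j i (e + 1) (by simpa using h) hi
        rw [show pos + (e + 1) = pos + 1 + e by ring] at this
        simpa using this

/-- One lookup of the bits of the angles in `l`, followed by the rotations and by the erasure of the
bits. -/
def block (m' c' B b u u' : ℕ) (f : Fin n → Bool) (t : Fin n → ℕ → ℕ) (l : List (Fin n))
    (rest : Circ n m r s) : Circ n m r s :=
  (load m' c' B u (dataBit (b + 1) t l)).seq <|
  -- The unused candidate registers are cleared before the rotations, which frees their ancillae for
  -- the carries. Their sign `F` stays pending and is repaired together with that of the data bits.
  measAll (loadBits B u (dataBit (b + 1) t l)) B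
    (fun F => (rots B b f l 0).seq <|
      measAll (loadBits B u (dataBit (b + 1) t l)) 0
        (fun F' => (signFix m' u' (c' ⌈/⌉ 2 ^ u') F').seq rest) B F)
    (2 ^ u * B - B) fun _ => false

lemma calls_block (m' c' B b u u' : ℕ) (f : Fin n → Bool) (t : Fin n → ℕ → ℕ) (l l' : List (Fin n))
    {rest : Circ n m r s} (h : rest.Calls l') :
    (block m' c' B b u u' f t l rest).Calls (l ++ l') :=
  (calls_load _ _ _ _ _).seq_nil <| calls_measAll (fun _ => (calls_rots _ _ _ _ _).seq <|
    calls_measAll (fun _ => (calls_signFix _ _ _ _).seq_nil h) _ _) _ _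

lemma toffoliCount_block {m' c' B b u u' : ℕ} (hc : 0 < c') (f : Fin n → Bool)
    (t : Fin n → ℕ → ℕ) (l : List (Fin n)) (rest : Circ n m r s) :
    (block m' c' B b u u' f t l rest).toffoliCount ≤
      (c' ⌈/⌉ 2 ^ u + c' ⌈/⌉ 2 ^ u' + (2 ^ u - 1) * B + 2 ^ u') + l.length * b +
        rest.toffoliCount := by
  have h1 := toffoliCount_load (n := n) (m := m) (r := r) (s := s) (m' := m') (B := B) (u := u) hc
    (dataBit (b + 1) t l)
  have h2 : ∀ F', ((signFix m' u' (c' ⌈/⌉ 2 ^ u') F').seq rest).toffoliCount ≤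
      c' ⌈/⌉ 2 ^ u' + 2 ^ u' + rest.toffoliCount := fun F' => by
    rw [Circuit.toffoliCount_seq]
    have := toffoliCount_signFix (n := n) (m := m) (r := r) (s := s) (m' := m') (u := u')
      F' (ceilDiv_pos hc u')
    omega
  have h3 := fun F => toffoliCount_measAll (x := loadBits B u (dataBit (b + 1) t l)) (a := 0) h2 B F
  have h4 : ∀ F, ((rots B b f l 0).seq <|
      measAll (loadBits B u (dataBit (b + 1) t l)) 0
        (fun F' => (signFix m' u' (c' ⌈/⌉ 2 ^ u') F').seq rest) B F).toffoliCount ≤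
      l.length * b + (c' ⌈/⌉ 2 ^ u' + 2 ^ u' + rest.toffoliCount) := fun F => by
    rw [Circuit.toffoliCount_seq]
    have := toffoliCount_rots (n := n) (m := m) (r := r) (s := s) B b f l 0
    have := h3 F
    omega
  have h5 := toffoliCount_measAll (x := loadBits B u (dataBit (b + 1) t l)) (a := B) h4
    (2 ^ u * B - B) fun _ => false
  rw [block, Circuit.toffoliCount_seq]
  omega

/-- The pending sign commutes with all gates of the block, so a single `signFix` at the end restores
the clean encoding. `M` accumulates the gates already performed. -/
lemma Maps.block {B b u u' : ℕ} (f : Fin n → Bool) (t : Fin n → ℕ → ℕ)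
    (ht : ∀ κ j, t κ j < 2 ^ (b + 1)) {θ : Fin n → Fin c → ℝ}
    (hθ : ∀ κ j, θ κ j = (t κ j : ℝ) / 2 ^ (b + 1) + if f κ then 1 / 2 ^ (b + 2) else 0)
    (V : Fin n → Matrix (Bool × W) (Bool × W) ℂ) (l : List (Fin n)) (hl : l.length * (b + 1) ≤ B)
    (hc : c ≤ 2 ^ m) (hu : u ≤ m) (hu' : u' ≤ m)
    (hs : 2 ^ u * B + (m - u) ≤ s) (hs' : 2 ^ u' + (m - u') ≤ s) (hsb : B + b < s)
    {rest : Circ n m (b + 2) s} (M : Matrix (Sys c W) T ℂ)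
    {E : Matrix ((Wire m (b + 2) s → Bool) × W) T ℂ}
    (hrest : Maps (.inl (.inr ())) V rest
      (enc c m (b + 2) s W (fun _ _ => false) (fun _ => false) * (gates θ V l * M)) E) :
    Maps (.inl (.inr ())) V (block m c B b u u' f t l rest)
      (enc c m (b + 2) s W (fun _ _ => false) (fun _ => false) * M) E := by
  have hB : B ≤ 2 ^ u * B := Nat.le_mul_of_pos_left _ (by positivity)
  have hx : ∀ j i, B ≤ i → (decide (i < B) && loadBits B u (dataBit (b + 1) t l) j i) = false := by
    intro j i hi
    rw [decide_eq_false (by omega), Bool.false_and]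
  refine (Maps.mul (Maps.load hc hu hs (dataBit (b + 1) t l) _) M).seq ?_
  -- The loaded bits vanish beyond `2 ^ u * B`, so truncating there changes nothing; this is the
  -- form expected by the erasure.
  have e1 : ∀ F, enc c m (b + 2) s W (loadBits B u (dataBit (b + 1) t l)) F = enc c m (b + 2) s W
      (fun j i => decide (i < B + (2 ^ u * B - B)) && loadBits B u (dataBit (b + 1) t l) j i)
      F := by
    intro F
    congr 1
    ext j i
    by_cases hi : i < 2 ^ u * B
    · rw [decide_eq_true (by omega), Bool.true_and]
    · rw [loadBits_of_ge _ (by omega), Bool.and_false]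
  rw [e1]
  refine Maps.measAll (by omega) _ M (fun F => ?_) _
  refine (Maps.mul (Maps.rots f t ht hθ V hsb l 0 (by simpa using hl) _ hx ?_ F) M).seq ?_
  · intro j i e h hi
    have h1 : (0 + e) * (b + 1) + i < B := by
      have := Nat.mul_le_mul_right (b + 1) (show e + 1 ≤ l.length from h)
      rw [add_one_mul] at this
      rw [zero_add]
      omega
    rw [decide_eq_true h1, Bool.true_and, loadBits_of_lt _ h1, dataBit, zero_add, mul_comm e,
      Nat.mul_add_div (by omega), Nat.div_eq_of_lt hi, add_zero, Nat.mul_add_mod,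
      Nat.mod_eq_of_lt hi, List.getElem?_eq_getElem h]
  rw [Matrix.mul_assoc]
  have e2 := Maps.measAll (n := n) (τ := (.inl (.inr ()) : Wire m (b + 2) s)) (V := V) (a := 0)
    (k := B) (by omega)
    (cont := fun F' => (signFix m u' (c ⌈/⌉ 2 ^ u') F').seq rest)
    (loadBits B u (dataBit (b + 1) t l)) (gates θ V l * M) (E := E) (fun F' => ?_) F
  · simpa only [zero_add] using e2
  · simp only [Nat.not_lt_zero, decide_false, Bool.false_and]
    refine Maps.seq (Maps.mul (TrA.maps_enc (F' := fun _ => false) ?_) _) hrest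
    refine (TrA.signFix (L := Lab c (b + 2)) F' hu' hs' (fun l => (l.1 : ℕ))
      (fun l => div_lt_ceilDiv l.1.2 u') (fun l => l.1.2.trans_le hc) (fun l => l.2.1)
      (fun l => extB l.2.2) fun l => F' l.1).congr (fun _ => rfl) fun l => by simp

/-- All rotations of a list, in `N` blocks of at most `k`. -/
def blocks (m' c' k b u u' : ℕ) (f : Fin n → Bool) (t : Fin n → ℕ → ℕ) :
    ℕ → List (Fin n) → Circ n m r s
  | 0, _ => .done
  | N + 1, l => block m' c' (k * (b + 1)) b u u' f t (l.take k)
      (blocks m' c' k b u u' f t N (l.drop k))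

lemma calls_blocks (m' c' k b u u' : ℕ) (f : Fin n → Bool) (t : Fin n → ℕ → ℕ) (N : ℕ)
    (l : List (Fin n)) (hl : l.length ≤ N * k) :
    (blocks m' c' k b u u' f t N l : Circ n m r s).Calls l := by
  induction N generalizing l with
  | zero =>
    have : l = [] := by simpa using hl
    subst this
    rfl
  | succ N ih =>
    have := calls_block m' c' (k * (b + 1)) b u u' f t (l.take k) _
      (ih (l.drop k) (by rw [add_one_mul] at hl; simp; omega) : Circuit.Calls _ _)
    rwa [List.take_append_drop] at this

lemma toffoliCount_blocks {m' c' k b u u' : ℕ} (hc : 0 < c') (f : Fin n → Bool)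
    (t : Fin n → ℕ → ℕ) (N : ℕ) (l : List (Fin n)) :
    (blocks m' c' k b u u' f t N l : Circ n m r s).toffoliCount ≤
      l.length * b +
        N * (c' ⌈/⌉ 2 ^ u + c' ⌈/⌉ 2 ^ u' + (2 ^ u - 1) * (k * (b + 1)) + 2 ^ u') := by
  induction N generalizing l with
  | zero => simp [blocks, Circuit.toffoliCount]
  | succ N ih =>
    have h1 := toffoliCount_block (n := n) (m := m) (r := r) (s := s) (m' := m')
      (B := k * (b + 1)) (b := b) (u := u) (u' := u') hc f t (l.take k)
      (blocks m' c' k b u u' f t N (l.drop k))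
    have h2 := ih (l.drop k)
    have h3 : l.length * b = (l.take k).length * b + (l.drop k).length * b := by
      rw [← add_mul, ← List.length_append, List.take_append_drop]
    rw [blocks, add_one_mul]
    omega

lemma Maps.blocks {k b u u' : ℕ} (f : Fin n → Bool) (t : Fin n → ℕ → ℕ)
    (ht : ∀ κ j, t κ j < 2 ^ (b + 1)) {θ : Fin n → Fin c → ℝ}
    (hθ : ∀ κ j, θ κ j = (t κ j : ℝ) / 2 ^ (b + 1) + if f κ then 1 / 2 ^ (b + 2) else 0)
    (V : Fin n → Matrix (Bool × W) (Bool × W) ℂ)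
    (hc : c ≤ 2 ^ m) (hu : u ≤ m) (hu' : u' ≤ m)
    (hs : 2 ^ u * (k * (b + 1)) + (m - u) ≤ s) (hs' : 2 ^ u' + (m - u') ≤ s)
    (hsb : k * (b + 1) + b < s) (N : ℕ) (l : List (Fin n)) (hl : l.length ≤ N * k)
    (M : Matrix (Sys c W) T ℂ) :
    Maps (.inl (.inr ())) V (blocks m c k b u u' f t N l : Circ n m (b + 2) s)
      (enc c m (b + 2) s W (fun _ _ => false) (fun _ => false) * M)
      (enc c m (b + 2) s W (fun _ _ => false) (fun _ => false) * (gates θ V l * M)) := by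
  induction N generalizing l M with
  | zero =>
    have : l = [] := by simpa using hl
    subst this
    intro ρ
    simp [QMux.blocks, Circuit.run, gates]
  | succ N ih =>
    refine Maps.block f t ht hθ V (l.take k) (Nat.mul_le_mul_right _ (by simp)) hc hu hu' hs hs'
      hsb M ?_
    have := ih (l.drop k) (by rw [add_one_mul] at hl; simp; omega) (gates θ V (l.take k) * M)
    rwa [← Matrix.mul_assoc (gates θ V (l.drop k)), ← gates_append,
      List.take_append_drop] at this

/-- A circuit that performs the multiplexed gate for a table of binary angles. -/
theorem exists_circuit {k b u u' a : ℕ} (hc : 1 ≤ c) (hk : 1 ≤ k) (hb : 1 ≤ b)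
    (hu : 2 ^ u ≤ c) (hu' : 2 ^ u' ≤ c)
    (ha : 2 ^ u * (k * b) + (Nat.clog 2 c - u) ≤ a) (ha' : 2 ^ u' + (Nat.clog 2 c - u') ≤ a)
    (hab : k * b + b ≤ a) (θ : Fin n → Fin c → ℝ) (f : Fin n → Bool)
    (hθ : ∀ κ j, ∃ t : ℕ, t < 2 ^ b ∧
      θ κ j = t / 2 ^ b + if f κ then 1 / 2 ^ (b + 1) else 0) :
    ∃ C : Circ n (Nat.clog 2 c) (b + 1) a, C.Calls (List.finRange n).reverse ∧
      C.toffoliCount ≤ n * b + (n ⌈/⌉ k) *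
        (c ⌈/⌉ 2 ^ u + c ⌈/⌉ 2 ^ u' + (2 ^ u - 1) * (k * b) + 2 ^ u') ∧
      ∀ (W : Type) [Fintype W] [DecidableEq W] (V : Fin n → Matrix (Bool × W) (Bool × W) ℂ)
        (ρ : Matrix (Sys c W) (Sys c W) ℂ),
        C.run (.inl (.inr ())) V (conjBy (encode c (b + 1) a W) ρ) =
          conjBy (encode c (b + 1) a W) (conjBy (muxGate θ V) ρ) := by
  -- With precision `b + 1` the adder costs `b` Toffolis and needs a register of `b + 2` qubits.
  obtain ⟨b, rfl⟩ := Nat.exists_eq_add_of_le' hb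
  choose t ht hθ using hθ
  have hn : (List.finRange n).reverse.length ≤ (n ⌈/⌉ k) * k := by
    rw [List.length_reverse, List.length_finRange, mul_comm]
    exact (ceilDiv_le_iff_le_mul hk).1 le_rfl
  have hm : c ≤ 2 ^ Nat.clog 2 c := Nat.le_pow_clog (by norm_num) c
  have hum : ∀ u, 2 ^ u ≤ c → u ≤ Nat.clog 2 c := fun u h =>
    (Nat.pow_le_pow_iff_right (by norm_num)).1 (h.trans hm)
  -- Table rows with index at least `c` belong to no control value and are filled with zeros.
  refine ⟨blocks (Nat.clog 2 c) c k b u u' f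
    (fun κ j => if h : j < c then t κ ⟨j, h⟩ else 0) (n ⌈/⌉ k) (List.finRange n).reverse,
    calls_blocks _ _ _ _ _ _ _ _ _ _ hn, ?_, ?_⟩
  · refine (toffoliCount_blocks hc _ _ _ _).trans ?_
    rw [List.length_reverse, List.length_finRange]
    gcongr
    omega
  · intro W _ _ V ρ
    have := Maps.blocks (c := c) (m := Nat.clog 2 c) (s := a) (k := k) (b := b) (u := u) (u' := u') f
      (fun κ j => if h : j < c then t κ ⟨j, h⟩ else 0) (fun κ j => ?_) (θ := θ)
      (fun κ j => ?_) V hm (hum u hu) (hum u' hu') ha ha' (by omega) (n ⌈/⌉ k) _ hn 1 ρ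
    · rw [Matrix.mul_one, Matrix.mul_one, gates_finRange] at this
      rw [encode_eq_enc, this, conjBy_mul]
    · split_ifs
      · exact ht _ _
      · positivity
    · simp [hθ]

end Assembly

/-! ### Mixtures of unitaries close to a unitary -/

section Mixture

open scoped Matrix.Norms.L2Operator

variable {S : Type} [Fintype S] [DecidableEq S]

/-- Duality of trace norm and operator norm, by an explicit dual element: with `AᴴA = U diag(λ) Uᴴ`,
the matrix `K = U diag(λ^(-1/2)) Uᴴ Aᴴ` is a contraction and `tr (K A) = ∑ √λᵢ`. -/
lemma traceNorm_le_of_forall (A : Matrix S S ℂ) {B : ℝ}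
    (h : ∀ K : Matrix S S ℂ, ‖K‖ ≤ 1 → ‖(K * A).trace‖ ≤ B) : traceNorm A ≤ B := by
  have hH := isHermitian_conjTranspose_mul_self A
  obtain ⟨U, hU⟩ : ∃ U : Matrix S S ℂ, U = (hH.eigenvectorUnitary : Matrix S S ℂ) := ⟨_, rfl⟩
  obtain ⟨lam, hl⟩ : ∃ lam : S → ℝ, lam = hH.eigenvalues := ⟨_, rfl⟩
  have hUU : Uᴴ * U = 1 := by
    rw [hU]; exact Unitary.coe_star_mul_self hH.eigenvectorUnitary
  have hspec : Aᴴ * A = U * diagonal (fun i => (lam i : ℂ)) * Uᴴ := by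
    rw [hU, hl]
    conv_lhs => rw [hH.spectral_theorem, Unitary.conjStarAlgAut_apply]
    rfl
  have hpos : ∀ i, 0 ≤ lam i := by
    intro i
    rw [hl]
    exact (posSemidef_conjTranspose_mul_self A).eigenvalues_nonneg i
  -- The convention `0⁻¹ = 0` makes this a pseudo-inverse, so singular `A` needs no separate
  -- treatment.
  obtain ⟨d, hd⟩ : ∃ d : S → ℂ, d = fun i => (((√(lam i))⁻¹ : ℝ) : ℂ) := ⟨_, rfl⟩
  have hd1 : ∀ i, d i * lam i = ((√(lam i) : ℝ) : ℂ) := by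
    intro i
    have h : (√(lam i))⁻¹ * lam i = √(lam i) := by
      rcases (hpos i).eq_or_lt with h0 | h0
      · simp [← h0]
      · have := Real.sqrt_pos.2 h0
        field_simp
        rw [Real.sq_sqrt (hpos i)]
    rw [hd, ← h, Complex.ofReal_mul]
  have key := h (U * diagonal d * Uᴴ * Aᴴ) ?_
  · have : (U * diagonal d * Uᴴ * Aᴴ * A).trace = ((traceNorm A : ℝ) : ℂ) := by
      rw [Matrix.mul_assoc _ Aᴴ, hspec]
      have e : U * diagonal d * Uᴴ * (U * diagonal (fun i => (lam i : ℂ)) * Uᴴ) =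
          U * diagonal (fun i => d i * lam i) * Uᴴ := by
        rw [← diagonal_mul_diagonal]
        calc _ = U * diagonal d * (Uᴴ * U) * diagonal (fun i => (lam i : ℂ)) * Uᴴ := by
              simp only [Matrix.mul_assoc]
          _ = _ := by rw [hUU]; simp only [Matrix.mul_assoc, Matrix.one_mul]
      rw [e, trace_mul_comm, ← Matrix.mul_assoc, hUU, Matrix.one_mul, trace_diagonal]
      simp only [hd1, traceNorm, ← hl]
      push_cast
      rfl
    rw [this, Complex.norm_real] at key
    exact (le_abs_self _).trans key
  -- `K Kᴴ` is diagonal in the basis `U` with entries `0` or `1`, whence `‖K‖ ≤ 1` by the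
  -- C*-identity.
  · have hK : (U * diagonal d * Uᴴ * Aᴴ) * (U * diagonal d * Uᴴ * Aᴴ)ᴴ =
        U * diagonal (fun i => d i * lam i * d i) * Uᴴ := by
      have hdd : star d = d := by
        ext i
        rw [hd, Pi.star_apply, Complex.star_def, Complex.conj_ofReal]
      simp only [conjTranspose_mul, conjTranspose_conjTranspose, diagonal_conjTranspose, hdd]
      rw [← diagonal_mul_diagonal, ← diagonal_mul_diagonal]
      calc _ = U * diagonal d * Uᴴ * (Aᴴ * A) * U * diagonal d * Uᴴ := by
            simp only [Matrix.mul_assoc]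
        _ = U * diagonal d * (Uᴴ * U) * diagonal (fun i => (lam i : ℂ)) * (Uᴴ * U) *
              diagonal d * Uᴴ := by
            rw [hspec]; simp only [Matrix.mul_assoc]
        _ = _ := by rw [hUU]; simp only [Matrix.mul_assoc, Matrix.one_mul]
    have hnU : ‖U‖ ≤ 1 := by
      have h1 := l2_opNorm_conjTranspose_mul_self U
      rw [hUU] at h1
      have h2 : ‖(1 : Matrix S S ℂ)‖ ≤ 1 := by
        rw [← diagonal_one, l2_opNorm_diagonal]
        exact (pi_norm_le_iff_of_nonneg zero_le_one).2 fun i => by simp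
      nlinarith [norm_nonneg U]
    have hnU' : ‖Uᴴ‖ ≤ 1 := by rwa [l2_opNorm_conjTranspose]
    have h3 : ‖diagonal fun i => d i * lam i * d i‖ ≤ 1 := by
      rw [l2_opNorm_diagonal]
      refine (pi_norm_le_iff_of_nonneg zero_le_one).2 fun i => ?_
      rw [hd1, hd, ← Complex.ofReal_mul, Complex.norm_real, Real.norm_eq_abs,
        abs_of_nonneg (by positivity)]
      exact mul_inv_le_one
    have h4 := l2_opNorm_conjTranspose_mul_self (U * diagonal d * Uᴴ * Aᴴ)ᴴ
    rw [conjTranspose_conjTranspose, hK, l2_opNorm_conjTranspose] at h4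
    have h5 : ‖U * diagonal (fun i => d i * lam i * d i) * Uᴴ‖ ≤ 1 := by
      have := (l2_opNorm_mul U (diagonal fun i => d i * lam i * d i)).trans
        (mul_le_one₀ hnU (norm_nonneg _) h3)
      exact (l2_opNorm_mul _ _).trans (mul_le_one₀ this (norm_nonneg _) hnU')
    nlinarith [norm_nonneg (U * diagonal d * Uᴴ * Aᴴ)]

/-- Writing `ρ = BᴴB`, the trace becomes a sum of `⟨e, X e⟩` over vectors `e` given by the rows of
`B`, whose squared norms sum to `tr ρ`. -/
lemma norm_trace_mul_le (X : Matrix S S ℂ) {ρ : Matrix S S ℂ} (hρ : ρ.PosSemidef) :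
    ‖(X * ρ).trace‖ ≤ ‖X‖ * ρ.trace.re := by
  obtain ⟨B, rfl⟩ : ∃ B : Matrix S S ℂ, ρ = Bᴴ * B := by
    open scoped MatrixOrder in
    obtain ⟨B, hB⟩ := CStarAlgebra.nonneg_iff_eq_star_mul_self.1 hρ.nonneg
    exact ⟨B, hB⟩
  rw [← Matrix.mul_assoc, trace_mul_comm, trace_mul_comm Bᴴ, trace, trace, Complex.re_sum,
    Finset.mul_sum]
  refine (norm_sum_le _ _).trans (Finset.sum_le_sum fun i _ => ?_)
  obtain ⟨e, he⟩ : ∃ e : EuclideanSpace ℂ S, e = WithLp.toLp 2 fun s => star (B i s) := ⟨_, rfl⟩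
  have h1 : (B * (X * Bᴴ)) i i = inner ℂ e (WithLp.toLp 2 (X *ᵥ e)) := by
    rw [he, EuclideanSpace.inner_eq_star_dotProduct]
    simp [Matrix.mul_apply, dotProduct, mulVec, mul_comm]
  have h2 : ((B * Bᴴ) i i).re = ‖e‖ ^ 2 := by
    rw [EuclideanSpace.norm_sq_eq, Matrix.mul_apply, Complex.re_sum, he]
    refine Finset.sum_congr rfl fun s _ => ?_
    simp [← Complex.normSq_eq_norm_sq, Complex.mul_conj]
  simp only [diag_apply]
  rw [h1, h2]
  calc _ ≤ ‖e‖ * ‖WithLp.toLp 2 (X *ᵥ e)‖ := norm_inner_le_norm _ _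
    _ ≤ ‖e‖ * (‖X‖ * ‖e‖) := by
        gcongr
        exact l2_opNorm_mulVec X e
    _ = _ := by ring

/-- Tensoring with the identity is a *-homomorphism of C*-algebras, hence contractive. -/
lemma l2_opNorm_kronecker_one_le (A : Matrix S S ℂ) (r : ℕ) :
    ‖A ⊗ₖ (1 : Matrix (Fin r) (Fin r) ℂ)‖ ≤ ‖A‖ := by
  let φ : Matrix S S ℂ →⋆ₙₐ[ℂ] Matrix (S × Fin r) (S × Fin r) ℂ :=
    { toFun := fun A => A ⊗ₖ 1
      map_smul' := fun c A => smul_kronecker c A 1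
      map_zero' := zero_kronecker _
      map_add' := fun A B => add_kronecker A B 1
      map_mul' := fun A B => by rw [← mul_kronecker_mul, Matrix.one_mul]
      map_star' := fun A => by
        rw [star_eq_conjTranspose, star_eq_conjTranspose, conjTranspose_kronecker,
          conjTranspose_one] }
  exact NonUnitalStarAlgHom.norm_apply_le φ A

lemma l2_opNorm_le_one_of_unitary {U : Matrix S S ℂ} (hU : U ∈ unitaryGroup S ℂ) : ‖U‖ ≤ 1 := by
  have h1 := l2_opNorm_conjTranspose_mul_self U
  rw [← star_eq_conjTranspose, (mem_unitaryGroup_iff'.1 hU)] at h1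
  have h2 : ‖(1 : Matrix S S ℂ)‖ ≤ 1 := by
    rw [← diagonal_one, l2_opNorm_diagonal]
    exact (pi_norm_le_iff_of_nonneg zero_le_one).2 fun i => by simp
  nlinarith [norm_nonneg U]

lemma kronecker_one_mem_unitaryGroup {U : Matrix S S ℂ} (hU : U ∈ unitaryGroup S ℂ) (r : ℕ) :
    U ⊗ₖ (1 : Matrix (Fin r) (Fin r) ℂ) ∈ unitaryGroup (S × Fin r) ℂ :=
  kronecker_mem_unitary hU (one_mem _)

lemma ampliate_conjBy (A : Matrix S S ℂ) {r : ℕ} (ρ : Matrix (S × Fin r) (S × Fin r) ℂ) :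
    ampliate (conjBy A) ρ = conjBy (A ⊗ₖ (1 : Matrix (Fin r) (Fin r) ℂ)) ρ := by
  ext x y
  simp [ampliate, conjBy, Matrix.mul_apply, Fintype.sum_prod_type, Matrix.one_apply,
    apply_ite, Finset.sum_ite_eq]

/-- Expanding `U i = V - (V - U i)` leaves two terms linear in the mean deviation `D` and one
positive quadratic term. Each linear term contributes at most `‖D‖`; the quadratic one contributes
its trace, which unitarity expresses through `D` as well and bounds by `2 ‖D‖`. The individual
deviations `V - U i` need not be small. -/
lemma traceNorm_conjBy_sub_sum_le {ι : Type} [Fintype ι] {V : Matrix S S ℂ}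
    (hV : V ∈ unitaryGroup S ℂ) {U : ι → Matrix S S ℂ} (hU : ∀ i, U i ∈ unitaryGroup S ℂ)
    {p : ι → ℝ} (hp : ∀ i, 0 ≤ p i) (hp1 : ∑ i, p i = 1) {ρ : Matrix S S ℂ} (hρ : IsDensity ρ) :
    traceNorm (conjBy V ρ - ∑ i, (p i : ℂ) • conjBy (U i) ρ) ≤
      4 * ‖V - ∑ i, (p i : ℂ) • U i‖ := by
  obtain ⟨D, hD⟩ : ∃ D, D = V - ∑ i, (p i : ℂ) • U i := ⟨_, rfl⟩
  have hp1' : ∑ i, (p i : ℂ) = 1 := by rw [← Complex.ofReal_sum, hp1, Complex.ofReal_one]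
  have hVn := l2_opNorm_le_one_of_unitary hV
  have hVn' : ‖Vᴴ‖ ≤ 1 := by rwa [l2_opNorm_conjTranspose]
  have hVV : Vᴴ * V = 1 := mem_unitaryGroup_iff'.1 hV
  have htr : ρ.trace.re = 1 := by rw [hρ.2, Complex.one_re]
  have hDi : ∑ i, (p i : ℂ) • (V - U i) = D := by
    simp only [smul_sub, Finset.sum_sub_distrib]
    rw [← Finset.sum_smul, hp1', one_smul, hD]
  have hDi' : ∑ i, (p i : ℂ) • (V - U i)ᴴ = Dᴴ := by
    rw [← hDi, conjTranspose_sum]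
    refine Finset.sum_congr rfl fun i _ => ?_
    rw [conjTranspose_smul, Complex.star_def, Complex.conj_ofReal]
  have hsplit : conjBy V ρ - ∑ i, (p i : ℂ) • conjBy (U i) ρ =
      D * ρ * Vᴴ + V * ρ * Dᴴ - ∑ i, (p i : ℂ) • conjBy (V - U i) ρ := by
    have e (i) : conjBy (U i) ρ = conjBy V ρ - (V - U i) * ρ * Vᴴ - V * ρ * (V - U i)ᴴ +
        conjBy (V - U i) ρ := by
      simp only [conjBy, conjTranspose_sub, Matrix.mul_sub, Matrix.sub_mul]
      abel
    simp only [fun i => e i, smul_add, smul_sub, Finset.sum_add_distrib, Finset.sum_sub_distrib]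
    rw [← Finset.sum_smul, hp1', one_smul, ← hDi']
    nth_rw 1 [← hDi]
    simp only [Finset.sum_mul, Finset.mul_sum, Matrix.smul_mul, Matrix.mul_smul]
    abel
  -- From `UᴴU = VᴴV = 1`: the square `(V - U)ᴴ(V - U)` is `2 - VᴴU - UᴴV`, which is linear in `V -
  -- U`.
  have hsq : ∑ i, (p i : ℂ) • ((V - U i)ᴴ * (V - U i)) = Vᴴ * D + Dᴴ * V := by
    have e (i) : (V - U i)ᴴ * (V - U i) = Vᴴ * (V - U i) + (V - U i)ᴴ * V := by
      have : (U i)ᴴ * U i = 1 := mem_unitaryGroup_iff'.1 (hU i)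
      simp only [conjTranspose_sub, Matrix.mul_sub, Matrix.sub_mul, this, hVV]
      abel
    simp only [fun i => e i, smul_add, Finset.sum_add_distrib]
    rw [← hDi', ← hDi]
    simp only [Finset.sum_mul, Finset.mul_sum, Matrix.smul_mul, Matrix.mul_smul]
  rw [← hD]
  refine traceNorm_le_of_forall _ fun K hK => ?_
  have hA {A B : Matrix S S ℂ} (hA : ‖A‖ ≤ 1) (hB : ‖B‖ ≤ ‖D‖) : ‖A * B‖ ≤ ‖D‖ :=
    (l2_opNorm_mul A B).trans (by nlinarith [norm_nonneg B])
  have hB {A B : Matrix S S ℂ} (hA : ‖A‖ ≤ 1) (hB : ‖B‖ ≤ ‖D‖) : ‖B * A‖ ≤ ‖D‖ :=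
    (l2_opNorm_mul B A).trans (by nlinarith [norm_nonneg B])
  have hDn : ‖Dᴴ‖ ≤ ‖D‖ := (l2_opNorm_conjTranspose D).le
  have h1 : ‖(K * (D * ρ * Vᴴ)).trace‖ ≤ ‖D‖ := by
    have e : (K * (D * ρ * Vᴴ)).trace = ((Vᴴ * (K * D)) * ρ).trace := by
      rw [← Matrix.mul_assoc K, trace_mul_comm]
      simp only [Matrix.mul_assoc]
    rw [e]
    refine (norm_trace_mul_le _ hρ.1).trans ?_
    rw [htr, mul_one]
    exact hA hVn' (hA hK le_rfl)
  have h2 : ‖(K * (V * ρ * Dᴴ)).trace‖ ≤ ‖D‖ := by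
    have e : (K * (V * ρ * Dᴴ)).trace = ((Dᴴ * K * V) * ρ).trace := by
      rw [← Matrix.mul_assoc K, trace_mul_comm]
      simp only [Matrix.mul_assoc]
    rw [e]
    refine (norm_trace_mul_le _ hρ.1).trans ?_
    rw [htr, mul_one]
    exact hB hVn (hB hK hDn)
  have h3 : ‖(K * ∑ i, (p i : ℂ) • conjBy (V - U i) ρ).trace‖ ≤ 2 * ‖D‖ := by
    have e (i) : (conjBy (V - U i) ρ).trace.re = (((V - U i)ᴴ * (V - U i)) * ρ).trace.re := by
      rw [conjBy, trace_mul_comm, Matrix.mul_assoc]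
    have e2 : ∑ i, p i * (conjBy (V - U i) ρ).trace.re = ((Vᴴ * D + Dᴴ * V) * ρ).trace.re := by
      rw [← hsq, Finset.sum_mul, trace_sum, Complex.re_sum]
      refine Finset.sum_congr rfl fun i _ => ?_
      rw [e, Matrix.smul_mul, trace_smul, smul_eq_mul, Complex.re_ofReal_mul]
    rw [Finset.mul_sum, trace_sum]
    -- Each summand is positive semidefinite, so the contraction `K` can be dropped at the price of
    -- its trace.
    calc _ ≤ ∑ i, p i * (conjBy (V - U i) ρ).trace.re := by
          refine (norm_sum_le _ _).trans (Finset.sum_le_sum fun i _ => ?_)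
          rw [Matrix.mul_smul, trace_smul, norm_smul, Complex.norm_real, Real.norm_of_nonneg (hp i)]
          refine mul_le_mul_of_nonneg_left ?_ (hp i)
          have hpos : (conjBy (V - U i) ρ).PosSemidef := hρ.1.mul_mul_conjTranspose_same _
          refine (norm_trace_mul_le K hpos).trans ?_
          have : 0 ≤ (conjBy (V - U i) ρ).trace.re := (Complex.le_def.1 hpos.trace_nonneg).1
          nlinarith
      _ ≤ ‖((Vᴴ * D + Dᴴ * V) * ρ).trace‖ := by
          rw [e2]
          exact Complex.re_le_norm _
      _ ≤ ‖Vᴴ * D + Dᴴ * V‖ := by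
          refine (norm_trace_mul_le _ hρ.1).trans ?_
          rw [htr, mul_one]
      _ ≤ ‖D‖ + ‖D‖ := (norm_add_le _ _).trans (add_le_add (hA hVn' le_rfl) (hB hVn hDn))
      _ = 2 * ‖D‖ := by ring
  rw [hsplit, Matrix.mul_sub, Matrix.mul_add, trace_sub, trace_add]
  refine (norm_sub_le _ _).trans ?_
  have := norm_add_le (K * (D * ρ * Vᴴ)).trace (K * (V * ρ * Dᴴ)).trace
  linarith

/-- The trace-norm bound applies on every reference system because tensoring with the identity
preserves unitarity and does not increase the norm of the mean deviation. The halved trace norm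
turns `4` into `2`. -/
theorem diamondDist_mixture_le {ι : Type} [Fintype ι] {V : Matrix S S ℂ}
    (hV : V ∈ unitaryGroup S ℂ) {U : ι → Matrix S S ℂ} (hU : ∀ i, U i ∈ unitaryGroup S ℂ)
    {p : ι → ℝ} (hp : ∀ i, 0 ≤ p i) (hp1 : ∑ i, p i = 1) :
    diamondDist (conjBy V) (fun ρ => ∑ i, (p i : ℂ) • conjBy (U i) ρ) ≤
      ENNReal.ofReal (2 * ‖V - ∑ i, (p i : ℂ) • U i‖) := by
  refine iSup_le fun r => iSup_le fun ρ => iSup_le fun hρ => ENNReal.ofReal_le_ofReal ?_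
  have h1 : ampliate (fun ρ => ∑ i, (p i : ℂ) • conjBy (U i) ρ) ρ =
      ∑ i, (p i : ℂ) • conjBy (U i ⊗ₖ (1 : Matrix (Fin r) (Fin r) ℂ)) ρ := by
    simp only [← ampliate_conjBy]
    ext x y
    simp [ampliate, Matrix.sum_apply]
  have h2 : V ⊗ₖ (1 : Matrix (Fin r) (Fin r) ℂ) -
      ∑ i, (p i : ℂ) • U i ⊗ₖ (1 : Matrix (Fin r) (Fin r) ℂ) =
      (V - ∑ i, (p i : ℂ) • U i) ⊗ₖ (1 : Matrix (Fin r) (Fin r) ℂ) := by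
    ext x y
    simp only [Matrix.sub_apply, Matrix.sum_apply, Matrix.smul_apply, kroneckerMap_apply, sub_mul,
      Finset.sum_mul, smul_eq_mul, mul_assoc]
  have h3 := traceNorm_conjBy_sub_sum_le (kronecker_one_mem_unitaryGroup hV r)
    (fun i => kronecker_one_mem_unitaryGroup (hU i) r) hp hp1 hρ
  rw [h2] at h3
  have h4 := l2_opNorm_kronecker_one_le (V - ∑ i, (p i : ℂ) • U i) r
  rw [traceDist, ampliate_conjBy, h1]
  linarith

end Mixture

/-! ### Randomized rounding of an angle -/

section Rounding

/-- The angle `t / 2^b`, plus a final bit `s`. -/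
noncomputable def bitAngle (b : ℕ) (s : Bool) (t : ℕ) : ℝ :=
  t / 2 ^ b + if s then 1 / 2 ^ (b + 1) else 0

/-- Angles matter modulo `1`: with `G = s + 2 q`, the digit `t` is `q` reduced modulo `2 ^ b`. -/
lemma exists_bitAngle_exp (b : ℕ) (G : ℤ) (s : Bool) (hG : (2 : ℤ) ∣ G - s.toNat) :
    ∃ t : ℕ, t < 2 ^ b ∧ Complex.exp (2 * Real.pi * Complex.I * bitAngle b s t) =
      Complex.exp ((Real.pi / 2 ^ b * G : ℝ) * Complex.I) := by
  obtain ⟨q, hq⟩ := hG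
  have hpos : (0 : ℤ) < 2 ^ b := by positivity
  have h1 := Int.emod_add_mul_ediv q (2 ^ b)
  have h0 := Int.emod_nonneg q hpos.ne'
  have h2 := Int.emod_lt_of_pos q hpos
  obtain ⟨t, ht⟩ := Int.eq_ofNat_of_zero_le h0
  rw [ht] at h1 h2
  refine ⟨t, by exact_mod_cast h2, ?_⟩
  rw [Complex.exp_eq_exp_iff_exists_int]
  refine ⟨-(q / 2 ^ b), ?_⟩
  have hG' : (G : ℂ) = s.toNat + 2 * (t + 2 ^ b * ((q / 2 ^ b : ℤ) : ℂ)) := by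
    have : G = s.toNat + 2 * (t + 2 ^ b * (q / 2 ^ b)) := by rw [h1]; omega
    rw [this]
    push_cast
    rfl
  rw [bitAngle]
  push_cast
  rw [hG']
  cases s <;> simp [pow_succ] <;> field_simp <;> ring

/-- Let `2y` be the grid spacing of the phases and `z` the offset from the nearest grid point, `|z|
≤ y`. Weight `1/2` on offset `0` and weights `r/2`, `(1-r)/2` on `± 2y` give the mean `m exp(iz)`
when `m cos z = cos² y` and `m sin z = (r - 1/2) sin 2y`. Solving gives `m` and `r`; `|z| ≤ y`
ensures that they lie in `[0, 1]`, and `1 - m ≤ sin² y ≤ y²`. Offset `0` has the parity of `g` and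
offsets `± 2y` the other one, so either value of `s` has total weight `1/2`. -/
lemma exists_rounding (b : ℕ) (hb : 1 ≤ b) (θ : ℝ) :
    ∃ (r m : ℝ) (t : Bool → Bool → ℕ), 0 ≤ r ∧ r ≤ 1 ∧ m ≤ 1 ∧ 0 ≤ m ∧
      1 - m ≤ (Real.pi / 2 ^ b) ^ 2 / 4 ∧ (∀ s x, t s x < 2 ^ b) ∧
      ∑ s : Bool, ∑ x : Bool, (((if x then r else 1 - r) / 2 : ℝ) : ℂ) *
        Complex.exp (2 * Real.pi * Complex.I * bitAngle b s (t s x)) =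
          m * Complex.exp (2 * Real.pi * Complex.I * θ) := by
  obtain ⟨y, hy⟩ : ∃ y : ℝ, y = Real.pi / 2 ^ b / 2 := ⟨_, rfl⟩
  obtain ⟨g, hg⟩ : ∃ g : ℤ, g = round (θ * 2 ^ (b + 1)) := ⟨_, rfl⟩
  obtain ⟨z, hz⟩ : ∃ z : ℝ, z = (θ * 2 ^ (b + 1) - g) * (2 * y) := ⟨_, rfl⟩
  have hh : Real.pi / 2 ^ b = 2 * y := by rw [hy]; ring
  have hy0 : 0 < y := by rw [hy]; positivity
  -- At least one bit of precision keeps `y` and `z` in the range where the cosines are positive and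
  -- `sin (y ± z) ≥ 0`.
  have hy4 : y ≤ Real.pi / 4 := by
    have h2 : (2 : ℝ) ≤ 2 ^ b := by
      calc (2 : ℝ) = 2 ^ 1 := by norm_num
        _ ≤ 2 ^ b := pow_le_pow_right₀ (by norm_num) hb
    have : Real.pi / 2 ^ b ≤ Real.pi / 2 := by gcongr
    linarith
  have hpi := Real.pi_pos
  have hzy : |z| ≤ y := by
    have := abs_sub_round (θ * 2 ^ (b + 1))
    rw [← hg] at this
    rw [hz, abs_mul, abs_of_pos (by positivity : 0 < 2 * y)]
    nlinarith
  obtain ⟨hz1, hz2⟩ := abs_le.1 hzy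
  have hcy : 0 < Real.cos y := Real.cos_pos_of_mem_Ioo ⟨by linarith, by linarith⟩
  have hsy : 0 < Real.sin y := Real.sin_pos_of_pos_of_lt_pi hy0 (by linarith)
  have hcz : 0 < Real.cos z := Real.cos_pos_of_mem_Ioo ⟨by linarith, by linarith⟩
  have hcyz : Real.cos y ≤ Real.cos z := by
    rw [← Real.cos_abs z]
    exact Real.cos_le_cos_of_nonneg_of_le_pi (abs_nonneg z) (by linarith) hzy
  have hs1 : 0 ≤ Real.sin y * Real.cos z - Real.cos y * Real.sin z := by
    rw [← Real.sin_sub]; exact Real.sin_nonneg_of_nonneg_of_le_pi (by linarith) (by linarith)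
  have hs2 : 0 ≤ Real.sin y * Real.cos z + Real.cos y * Real.sin z := by
    rw [← Real.sin_add]; exact Real.sin_nonneg_of_nonneg_of_le_pi (by linarith) (by linarith)
  have hcsy := Real.sin_sq_add_cos_sq y
  have hcsy' : Real.sin y ^ 2 ≤ y ^ 2 := by
    have := Real.sin_le hy0.le
    gcongr
  obtain ⟨m, hm⟩ : ∃ m, m = Real.cos y ^ 2 / Real.cos z := ⟨_, rfl⟩
  obtain ⟨r, hr⟩ : ∃ r, r = 1 / 2 + Real.cos y * Real.sin z / (2 * (Real.sin y * Real.cos z)) :=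
    ⟨_, rfl⟩
  have hd : 0 < 2 * (Real.sin y * Real.cos z) := by positivity
  -- The sampled multiple must have parity `s`: this is `g` itself for one value of `s`, regardless
  -- of `x`, and a neighbour chosen by `x` for the other.
  have hG (s x : Bool) : ∃ G : ℤ, (2 : ℤ) ∣ G - s.toNat ∧
      G = if s = decide (g % 2 = 1) then g else if x then g + 1 else g - 1 := by
    refine ⟨_, ?_, rfl⟩
    by_cases h : g % 2 = 1 <;> cases s <;> cases x <;> simp [h] <;> omega
  choose G hG1 hG2 using hG
  choose t ht1 ht2 using fun s x => exists_bitAngle_exp b (G s x) s (hG1 s x)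
  refine ⟨r, m, t, ?_, ?_, ?_, ?_, ?_, ht1, ?_⟩
  · rw [hr, ← sub_nonneg]
    have : 1 / 2 + Real.cos y * Real.sin z / (2 * (Real.sin y * Real.cos z)) - 0 =
      (Real.sin y * Real.cos z + Real.cos y * Real.sin z) / (2 * (Real.sin y * Real.cos z)) := by
      field_simp
      ring
    rw [this]; positivity
  · rw [hr, ← sub_nonneg]
    have : 1 - (1 / 2 + Real.cos y * Real.sin z / (2 * (Real.sin y * Real.cos z))) =
      (Real.sin y * Real.cos z - Real.cos y * Real.sin z) / (2 * (Real.sin y * Real.cos z)) := by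
      field_simp
      ring
    rw [this]; positivity
  · rw [hm, div_le_one hcz]
    nlinarith [Real.cos_le_one y]
  · rw [hm]; positivity
  · have : Real.cos y ^ 2 ≤ m := by
      rw [hm, le_div_iff₀ hcz]
      nlinarith [Real.cos_le_one z, sq_nonneg (Real.cos y)]
    rw [hh]
    nlinarith
  · have key : ((1 / 2 : ℝ) : ℂ) * Complex.exp ((2 * y * g : ℝ) * Complex.I) +
        (((r / 2 : ℝ) : ℂ) * Complex.exp ((2 * y * (g + 1 : ℤ) : ℝ) * Complex.I) +
        (((1 - r) / 2 : ℝ) : ℂ) * Complex.exp ((2 * y * (g - 1 : ℤ) : ℝ) * Complex.I)) =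
          m * Complex.exp (2 * Real.pi * Complex.I * θ) := by
      have e1 : 2 * Real.pi * Complex.I * θ = (2 * y * g : ℝ) * Complex.I + z * Complex.I := by
        rw [hz, hy]
        push_cast
        field_simp
        ring
      have e2 : (((2 * y * (g + 1 : ℤ) : ℝ)) : ℂ) * Complex.I =
          (2 * y * g : ℝ) * Complex.I + (2 * y : ℝ) * Complex.I := by push_cast; ring
      have e3 : (((2 * y * (g - 1 : ℤ) : ℝ)) : ℂ) * Complex.I =
          (2 * y * g : ℝ) * Complex.I + (-(2 * y) : ℝ) * Complex.I := by push_cast; ring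
      rw [e1, e2, e3, Complex.exp_add, Complex.exp_add, Complex.exp_add]
      have e4 : ((1 / 2 : ℝ) : ℂ) + (((r / 2 : ℝ) : ℂ) * Complex.exp ((2 * y : ℝ) * Complex.I) +
          (((1 - r) / 2 : ℝ) : ℂ) * Complex.exp ((-(2 * y) : ℝ) * Complex.I)) =
          m * Complex.exp (z * Complex.I) := by
        have c2 : Real.cos (2 * y) = 2 * Real.cos y ^ 2 - 1 := Real.cos_two_mul y
        have s2 : Real.sin (2 * y) = 2 * Real.sin y * Real.cos y := Real.sin_two_mul y
        apply Complex.ext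
        · simp only [Complex.add_re, Complex.re_ofReal_mul, Complex.exp_ofReal_mul_I_re,
            Complex.ofReal_re, Real.cos_neg, c2, hm]
          field_simp
          ring
        · simp only [Complex.add_im, Complex.im_ofReal_mul, Complex.exp_ofReal_mul_I_im,
            Complex.ofReal_im, Real.sin_neg, s2, hm, hr]
          field_simp
          ring
      rw [mul_left_comm (m : ℂ), ← e4]
      ring
    rw [← key]
    simp only [ht2, hh, Fintype.sum_bool, hG2]
    by_cases h : g % 2 = 1 <;> simp [h] <;> ring

end Rounding

/-! ### Averages of products -/

section Average

open scoped Matrix.Norms.L2Operator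

/-- Marginalization: under a product distribution, a function of one coordinate averages over that
coordinate alone. -/
lemma sum_prod_mul_apply {ι X : Type} [Fintype ι] [DecidableEq ι] [Fintype X]
    (w : ι → X → ℂ) (hw : ∀ i, ∑ x, w i x = 1) (i : ι) (F : X → ℂ) :
    ∑ f : ι → X, (∏ j, w j (f j)) * F (f i) = ∑ x, w i x * F x := by
  have h := Finset.prod_univ_sum (fun _ : ι => (Finset.univ : Finset X))
    (fun j x => w j x * if j = i then F x else 1)
  rw [Fintype.piFinset_univ] at h
  have e1 (f : ι → X) : ∏ j, (w j (f j) * if j = i then F (f j) else 1) =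
      (∏ j, w j (f j)) * F (f i) := by
    rw [Finset.prod_mul_distrib]
    congr 1
    simp
  simp only [e1] at h
  rw [← h, Finset.prod_eq_single i]
  · simp
  · intro j _ hj
    simp [hj, hw]
  · simp

/-- The mean of an ordered product of independent, possibly noncommuting factors is the product of
the means. -/
lemma sum_prod_smul_prod_ofFn {R X : Type} [Ring R] [Algebra ℂ R] [Fintype X] {n : ℕ}
    (p : Fin n → X → ℂ) (A : Fin n → X → R) :
    ∑ ω : Fin n → X, (∏ k, p k (ω k)) • (List.ofFn fun k => A k (ω k)).prod =
      (List.ofFn fun k => ∑ x, p k x • A k x).prod := by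
  induction n with
  | zero => simp
  | succ n ih =>
    rw [List.ofFn_succ, List.prod_cons, ← ih, ← (Fin.consEquiv fun _ => X).sum_comp,
      Fintype.sum_prod_type, Finset.sum_mul]
    refine Finset.sum_congr rfl fun x _ => ?_
    rw [Finset.mul_sum]
    refine Finset.sum_congr rfl fun ω _ => ?_
    simp [List.ofFn_succ, Fin.prod_univ_succ, Fin.consEquiv, smul_smul, mul_comm]

/-- Telescoping: with contractive factors the errors add up. -/
lemma norm_prod_ofFn_sub_le {R : Type} [NormedRing R] (h1 : ‖(1 : R)‖ ≤ 1) {n : ℕ}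
    {A B : Fin n → R} {δ : ℝ} (hA : ∀ k, ‖A k‖ ≤ 1) (hB : ∀ k, ‖B k‖ ≤ 1)
    (h : ∀ k, ‖A k - B k‖ ≤ δ) :
    ‖(List.ofFn A).prod‖ ≤ 1 ∧ ‖(List.ofFn A).prod - (List.ofFn B).prod‖ ≤ n * δ := by
  induction n with
  | zero => simpa using h1
  | succ n ih =>
    obtain ⟨i1, i2⟩ := ih (fun k => hA k.succ) (fun k => hB k.succ) fun k => h k.succ
    have hδ : 0 ≤ δ := (norm_nonneg _).trans (h 0)
    simp only [List.ofFn_succ, List.prod_cons]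
    refine ⟨(norm_mul_le _ _).trans (mul_le_one₀ (hA 0) (norm_nonneg _) i1), ?_⟩
    have e (a b x y : R) : a * x - b * y = (a - b) * x + b * (x - y) := by noncomm_ring
    rw [e]
    refine (norm_add_le _ _).trans ?_
    have := (norm_mul_le (A 0 - B 0) (List.ofFn fun k => A k.succ).prod).trans
      (mul_le_mul (h 0) i1 (norm_nonneg _) hδ)
    have := (norm_mul_le (B 0) ((List.ofFn fun k => A k.succ).prod -
      (List.ofFn fun k => B k.succ).prod)).trans
      (mul_le_mul (hB 0) i2 (norm_nonneg _) zero_le_one)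
    push_cast
    linarith

end Average

/-! ### Randomized rounding of a table of angles -/

section Ensemble

open scoped Matrix.Norms.L2Operator

variable {c n : ℕ} {W : Type} [Fintype W] [DecidableEq W]

lemma norm_phase (α : ℝ) (x : Bool) :
    ‖Complex.exp (2 * Real.pi * Complex.I * α * (if x then -1 else 1))‖ = 1 := by
  rw [show 2 * Real.pi * Complex.I * α * (if x then -1 else 1) =
    ((2 * Real.pi * α * (if x then -1 else 1) : ℝ) : ℂ) * Complex.I by
      cases x <;> push_cast <;> simp <;> ring]
  exact Complex.norm_exp_ofReal_mul_I _

lemma muxRotation_mem_unitaryGroup (θ : Fin c → ℝ) :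
    muxRotation W θ ∈ unitaryGroup (Sys c W) ℂ := by
  rw [mem_unitaryGroup_iff', star_eq_conjTranspose, muxRotation, diagonal_conjTranspose,
    diagonal_mul_diagonal, ← diagonal_one]
  congr 1
  ext s
  rw [Pi.star_apply, Complex.star_def, Complex.conj_mul', norm_phase]
  norm_num

lemma muxGate_mem_unitaryGroup (θ : Fin n → Fin c → ℝ)
    {V : Fin n → Matrix (Bool × W) (Bool × W) ℂ} (hV : ∀ k, V k ∈ unitaryGroup (Bool × W) ℂ) :
    muxGate θ V ∈ unitaryGroup (Sys c W) ℂ := by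
  refine Submonoid.list_prod_mem _ fun A hA => ?_
  obtain ⟨k, rfl⟩ := List.mem_ofFn.1 hA
  exact mul_mem (muxRotation_mem_unitaryGroup _) (kronecker_mem_unitary (one_mem _) (hV k))

/-- Since `m` is real, complex conjugation yields the case `Z = -1` with the same weights; one
random angle serves both eigenvalues. -/
lemma phase_sum_eq {ι : Type} [Fintype ι] {w α : ι → ℝ} {m θ : ℝ}
    (h : ∑ i, (w i : ℂ) * Complex.exp (2 * Real.pi * Complex.I * α i) =
      m * Complex.exp (2 * Real.pi * Complex.I * θ)) (x : Bool) :
    ∑ i, (w i : ℂ) * Complex.exp (2 * Real.pi * Complex.I * α i * (if x then -1 else 1)) =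
      m * Complex.exp (2 * Real.pi * Complex.I * θ * (if x then -1 else 1)) := by
  cases x
  · simpa using h
  · have := congrArg (starRingEnd ℂ) h
    simpa [← Complex.exp_conj, map_sum, map_ofNat] using this

/-- The mean of factor `k` is the target factor with its phases multiplied by `m k j`, at operator
distance `max (1 - m k j)`. Independence over `k`, telescoping and the factor `2` for mixtures give
`2 · n (π/2^b)²/4`. -/
theorem exists_ensemble {b : ℕ} (hb : 1 ≤ b) (θ : Fin n → Fin c → ℝ) :
    ∃ (N : ℕ) (p : Fin N → ℝ) (f : Fin N → Fin n → Bool) (t : Fin N → Fin n → Fin c → ℕ),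
      (∀ i, 0 ≤ p i) ∧ ∑ i, p i = 1 ∧ (∀ i k j, t i k j < 2 ^ b) ∧
      ∀ (W : Type) [Fintype W] [DecidableEq W] (V : Fin n → Matrix (Bool × W) (Bool × W) ℂ),
        (∀ k, V k ∈ unitaryGroup (Bool × W) ℂ) →
          diamondDist (conjBy (muxGate θ V)) (fun ρ => ∑ i, (p i : ℂ) •
            conjBy (muxGate (fun k j => bitAngle b (f i k) (t i k j)) V) ρ) ≤
              ENNReal.ofReal (n * (Real.pi / 2 ^ b) ^ 2 / 2) := by
  choose r m t hr0 hr1 hm1 hm0 hm ht hsum using fun k j => exists_rounding b hb (θ k j)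
  -- Randomness of one rotation: the shared parity bit, and one biased bit for each control value.
  let X := Bool × (Fin c → Bool)
  obtain ⟨w, hw⟩ : ∃ w : Fin n → Fin c → Bool → ℝ,
    w = fun k j x => if x then r k j else 1 - r k j := ⟨_, rfl⟩
  have hw0 (k j x) : 0 ≤ w k j x := by
    rw [hw]
    cases x
    · simpa using hr1 k j
    · simpa using hr0 k j
  have hw1 (k j) : ∑ x, w k j x = 1 := by simp [hw]
  -- The factor `1/2` is the fair parity coin; the biased bits are independent of it and of each
  -- other.
  obtain ⟨q, hq⟩ : ∃ q : Fin n → X → ℝ, q = fun k x => (∏ j, w k j (x.2 j)) / 2 := ⟨_, rfl⟩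
  have hq0 (k x) : 0 ≤ q k x := by
    rw [hq]
    exact div_nonneg (Finset.prod_nonneg fun j _ => hw0 _ _ _) zero_le_two
  have hwp (k) : ∑ y : Fin c → Bool, ∏ j, w k j (y j) = 1 := by
    have := Finset.prod_univ_sum (fun _ : Fin c => (Finset.univ : Finset Bool)) (w k)
    rw [Fintype.piFinset_univ] at this
    rw [← this]
    exact Finset.prod_eq_one fun j _ => hw1 k j
  have hq1 (k) : ∑ x, q k x = 1 := by
    simp only [hq, X, Fintype.sum_prod_type, Fintype.sum_bool, ← Finset.sum_div, hwp]
    norm_num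
  let e := Fintype.equivFin (Fin n → X)
  have hp1 : ∑ i, ∏ k, q k (e.symm i k) = 1 := by
    rw [e.symm.sum_comp fun ω : Fin n → X => ∏ k, q k (ω k)]
    have := Finset.prod_univ_sum (fun _ : Fin n => (Finset.univ : Finset X)) q
    rw [Fintype.piFinset_univ] at this
    rw [← this]
    exact Finset.prod_eq_one fun k _ => hq1 k
  refine ⟨_, fun i => ∏ k, q k (e.symm i k), fun i k => (e.symm i k).1,
    fun i k j => t k j (e.symm i k).1 ((e.symm i k).2 j),
    fun i => Finset.prod_nonneg fun k _ => hq0 _ _, hp1, fun i k j => ht _ _ _ _, ?_⟩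
  intro W _ _ V hV
  have hp0 (i) : 0 ≤ ∏ k, q k (e.symm i k) := Finset.prod_nonneg fun k _ => hq0 _ _
  refine (diamondDist_mixture_le (muxGate_mem_unitaryGroup θ hV)
    (fun i => muxGate_mem_unitaryGroup _ hV) hp0 hp1).trans (ENNReal.ofReal_le_ofReal ?_)
  obtain ⟨Vt, hVt⟩ : ∃ Vt : Fin n → Matrix (Sys c W) (Sys c W) ℂ,
    Vt = fun k => (1 : Matrix (Fin c) (Fin c) ℂ) ⊗ₖ V k := ⟨_, rfl⟩
  have hVt1 (k) : ‖Vt k‖ ≤ 1 := by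
    rw [hVt]
    exact l2_opNorm_le_one_of_unitary (kronecker_mem_unitary (one_mem _) (hV k))
  -- The averaged operator is diagonal, and its entry at control value `j` involves only the parity
  -- and the `j`-th biased bit. The dependence between different `j` through the shared parity is
  -- therefore invisible.
  have hsum' (k : Fin n) : ∑ x : X, (q k x : ℂ) •
      (muxRotation W (fun j => bitAngle b x.1 (t k j x.1 (x.2 j))) * Vt k) =
      diagonal (fun s : Sys c W => (m k s.1 : ℂ) *
        Complex.exp (2 * Real.pi * Complex.I * θ k s.1 * (if s.2.1 then -1 else 1))) * Vt k := by
    simp only [← Matrix.smul_mul]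
    rw [← Finset.sum_mul]
    congr 1
    ext s s'
    by_cases hs : s = s'
    · subst hs
      simp only [Matrix.sum_apply, Matrix.smul_apply, muxRotation, diagonal_apply_eq, smul_eq_mul]
      rw [Fintype.sum_prod_type]
      have hj := hsum k s.1
      rw [← Fintype.sum_prod_type'
        (f := fun s' x => (((if x then r k s.1 else 1 - r k s.1) / 2 : ℝ) : ℂ) *
        Complex.exp (2 * Real.pi * Complex.I * bitAngle b s' (t k s.1 s' x)))] at hj
      rw [← phase_sum_eq (w := fun z : Bool × Bool => (if z.2 then r k s.1 else 1 - r k s.1) / 2)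
        hj s.2.1, Fintype.sum_prod_type]
      refine Finset.sum_congr rfl fun s' _ => ?_
      have := sum_prod_mul_apply (fun j x => (w k j x : ℂ))
        (fun j => by rw [← Complex.ofReal_sum, hw1, Complex.ofReal_one]) s.1 (fun x =>
          Complex.exp (2 * Real.pi * Complex.I * bitAngle b s' (t k s.1 s' x) *
            (if s.2.1 then -1 else 1)) / 2)
      simp only [hq, hw] at this ⊢
      convert this using 1
      · refine Finset.sum_congr rfl fun y _ => ?_
        push_cast
        ring
      · refine Finset.sum_congr rfl fun y _ => ?_
        push_cast
        ring
    · simp [Matrix.sum_apply, muxRotation, diagonal_apply_ne _ hs]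
  have hM : ∑ i, ((∏ k, q k (e.symm i k) : ℝ) : ℂ) •
      muxGate (fun k j => bitAngle b (e.symm i k).1 (t k j (e.symm i k).1 ((e.symm i k).2 j))) V =
      (List.ofFn fun k => diagonal (fun s : Sys c W => (m k s.1 : ℂ) *
        Complex.exp (2 * Real.pi * Complex.I * θ k s.1 * (if s.2.1 then -1 else 1))) *
          Vt k).prod := by
    simp only [← hsum']
    rw [← sum_prod_smul_prod_ofFn, ← e.symm.sum_comp]
    simp only [Complex.ofReal_prod, muxGate, hVt]
  rw [hM]
  have hδ (k : Fin n) : ‖muxRotation W (θ k) * Vt k - diagonal (fun s : Sys c W => (m k s.1 : ℂ) *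
      Complex.exp (2 * Real.pi * Complex.I * θ k s.1 * (if s.2.1 then -1 else 1))) * Vt k‖ ≤
        (Real.pi / 2 ^ b) ^ 2 / 4 := by
    rw [← sub_mul, muxRotation, diagonal_sub]
    refine (l2_opNorm_mul _ _).trans ((mul_le_of_le_one_right (norm_nonneg _) (hVt1 k)).trans ?_)
    rw [l2_opNorm_diagonal]
    refine (pi_norm_le_iff_of_nonneg (by positivity)).2 fun s => ?_
    rw [← one_sub_mul, norm_mul, norm_phase, mul_one, ← Complex.ofReal_one, ← Complex.ofReal_sub,
      Complex.norm_real, Real.norm_of_nonneg (sub_nonneg.2 (hm1 _ _))]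
    exact hm k s.1
  have hA (k : Fin n) : ‖muxRotation W (θ k) * Vt k‖ ≤ 1 :=
    (l2_opNorm_mul _ _).trans (mul_le_one₀
      (l2_opNorm_le_one_of_unitary (muxRotation_mem_unitaryGroup _)) (norm_nonneg _) (hVt1 k))
  have hB (k : Fin n) : ‖diagonal (fun s : Sys c W => (m k s.1 : ℂ) *
      Complex.exp (2 * Real.pi * Complex.I * θ k s.1 * (if s.2.1 then -1 else 1))) * Vt k‖ ≤ 1 := by
    refine (l2_opNorm_mul _ _).trans (mul_le_one₀ ?_ (norm_nonneg _) (hVt1 k))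
    rw [l2_opNorm_diagonal]
    refine (pi_norm_le_iff_of_nonneg zero_le_one).2 fun s => ?_
    rw [norm_mul, norm_phase, mul_one, Complex.norm_real, Real.norm_of_nonneg (hm0 _ _)]
    exact hm1 _ _
  have := (norm_prod_ofFn_sub_le (l2_opNorm_le_one_of_unitary (one_mem _)) hA hB hδ).2
  have e1 : (List.ofFn fun k => muxRotation W (θ k) * Vt k).prod = muxGate θ V := by
    rw [muxGate, hVt]
  rw [e1] at this
  linarith

end Ensemble

/-! ### Precision and cost -/

section Parameters

lemma le_four_pow_bitsFor {n : ℕ} (hn : 1 ≤ n) {ε : ℝ} (hε : 0 < ε) :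
    n * Real.pi ^ 2 / (2 * ε) ≤ 4 ^ bitsFor n ε := by
  have hn' : (0 : ℝ) < n := by exact_mod_cast hn
  have hpos : 0 < n * Real.pi ^ 2 / (2 * ε) := by positivity
  have h := Nat.le_ceil (1 / 2 * Real.logb 2 (n * Real.pi ^ 2 / (2 * ε)))
  have h2 : Real.logb 2 (n * Real.pi ^ 2 / (2 * ε)) ≤ ((2 * bitsFor n ε : ℕ) : ℝ) := by
    rw [bitsFor]
    push_cast
    linarith
  rw [Real.logb_le_iff_le_rpow (by norm_num) hpos, Real.rpow_natCast, pow_mul] at h2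
  norm_num at h2 ⊢
  exact h2

lemma one_le_bitsFor {n : ℕ} (hn : 1 ≤ n) {ε : ℝ} (hε : 0 < ε) (hε1 : ε < 1) :
    1 ≤ bitsFor n ε := by
  have h := le_four_pow_bitsFor hn hε
  have hn' : (1 : ℝ) ≤ n := by exact_mod_cast hn
  by_contra hb
  rw [Nat.lt_one_iff.1 (not_le.1 hb), pow_zero, div_le_one (by positivity)] at h
  nlinarith [Real.pi_gt_three]

/-- With `L = log₂ (n/ε) ≥ 1` and `π²/2 ≤ 8`, the rounded-up value is at most `(L + 3)/2 + 1 ≤ 3 L`.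
-/
lemma bitsFor_le {n : ℕ} (hn : 1 ≤ n) {ε : ℝ} (hε : 0 < ε) (h2 : 2 ≤ n / ε) :
    (bitsFor n ε : ℝ) ≤ 3 * Real.logb 2 (n / ε) := by
  have hL : 1 ≤ Real.logb 2 (n / ε) := by
    rw [Real.le_logb_iff_rpow_le (by norm_num) (by linarith), Real.rpow_one]
    exact h2
  have h8 : Real.logb 2 (n * Real.pi ^ 2 / (2 * ε)) ≤ Real.logb 2 (n / ε) + 3 := by
    have e : n * Real.pi ^ 2 / (2 * ε) = n / ε * (Real.pi ^ 2 / 2) := by field_simp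
    rw [e, Real.logb_mul (by linarith) (by positivity)]
    gcongr
    rw [Real.logb_le_iff_le_rpow (by norm_num) (by positivity)]
    have := Real.pi_lt_four
    norm_num
    nlinarith [Real.pi_pos]
  have h0 : 0 ≤ Real.logb 2 (n * Real.pi ^ 2 / (2 * ε)) := by
    have hn' : (0 : ℝ) < n := by exact_mod_cast hn
    refine Real.logb_nonneg (by norm_num) ?_
    have e : n * Real.pi ^ 2 / (2 * ε) = n / ε * (Real.pi ^ 2 / 2) := by field_simp
    rw [e]
    nlinarith [Real.pi_gt_three]
  have := Nat.ceil_lt_add_one (by positivity : 0 ≤ 1 / 2 * Real.logb 2 (n * Real.pi ^ 2 / (2 * ε)))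
  rw [bitsFor]
  linarith

lemma clog_sub_le_ceilLog {c : ℕ} (hc : 1 ≤ c) (u : ℕ) : Nat.clog 2 c - u ≤ ceilLog c (2 ^ u) := by
  rw [Nat.sub_le_iff_le_add]
  refine Nat.clog_le_of_le_pow ?_
  have hc' : (0 : ℝ) < c := by exact_mod_cast hc
  have h : Real.logb 2 ((c : ℝ) / (2 ^ u : ℕ)) ≤ ceilLog c (2 ^ u) := Nat.le_ceil _
  rw [Real.logb_le_iff_le_rpow (by norm_num) (by positivity), Real.rpow_natCast,
    div_le_iff₀ (by positivity)] at h
  rw [pow_add]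
  exact_mod_cast h

/-- Balancing `c / 2^u` against `2^u X` suggests `2^u ≈ √(c / X)`. If `X > c` this forces `u = 0`,
where the swap term `(2^u - 1) X` vanishes. -/
lemma exists_block_size {c X : ℕ} (hc : 1 ≤ c) (hX : 1 ≤ X) :
    ∃ u : ℕ, 2 ^ u ≤ c ∧ ((c ⌈/⌉ 2 ^ u : ℕ) : ℝ) ≤ 2 * √(c * X) + 1 ∧
      (((2 ^ u - 1) * X : ℕ) : ℝ) ≤ √(c * X) := by
  -- Base `4` gives the square root: `4^u ≤ c / X < 4^(u+1)` unless the quotient is `0`, in which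
  -- case the logarithm is `0` by convention.
  obtain ⟨u, hu⟩ : ∃ u, u = Nat.log 4 (c / X) := ⟨_, rfl⟩
  have hlt : c / X < 4 ^ (u + 1) := by
    rw [hu]; exact Nat.lt_pow_succ_log_self (by norm_num) _
  have hlt' : c < 4 ^ (u + 1) * X := (Nat.div_lt_iff_lt_mul hX).1 hlt
  have e4 : 4 ^ u = 2 ^ u * 2 ^ u := by rw [← mul_pow]; norm_num
  have hle : u = 0 ∨ 4 ^ u * X ≤ c := by
    by_cases h : c / X = 0
    · left; rw [hu, h]; rfl
    · right
      rw [← Nat.le_div_iff_mul_le hX, hu]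
      exact Nat.pow_log_le_self 4 h
  have hp : 0 < 2 ^ u := by positivity
  refine ⟨u, ?_, ?_, ?_⟩
  · rcases hle with h | h
    · simpa [h] using hc
    · rw [e4] at h
      nlinarith [Nat.mul_le_mul hp hX, Nat.zero_le (2 ^ u * 2 ^ u * (X - 1))]
  · have h1 : (c ⌈/⌉ 2 ^ u) * 2 ^ u ≤ c + 2 ^ u := by
      rw [Nat.ceilDiv_eq_add_pred_div]
      exact (Nat.div_mul_le_self _ _).trans (by omega)
    have h2 : (c : ℝ) ≤ 2 * √(c * X) * 2 ^ u := by
      refine le_of_sq_le_sq ?_ (by positivity)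
      rw [mul_pow, mul_pow, Real.sq_sqrt (by positivity)]
      have : (c : ℝ) ≤ 4 * (2 ^ u) ^ 2 * X := by
        rw [pow_succ, e4] at hlt'
        have h3 : c ≤ 4 * (2 ^ u) ^ 2 * X := by nlinarith
        exact_mod_cast h3
      nlinarith [(Nat.cast_nonneg c : (0 : ℝ) ≤ c)]
    have h3 : ((c ⌈/⌉ 2 ^ u : ℕ) : ℝ) * 2 ^ u ≤ c + 2 ^ u := by exact_mod_cast h1
    have hp' : (0 : ℝ) < 2 ^ u := by positivity
    refine le_of_mul_le_mul_right ?_ hp'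
    linarith
  · rcases hle with h | h
    · rw [h, pow_zero, Nat.sub_self, Nat.zero_mul, Nat.cast_zero]
      positivity
    · refine Real.le_sqrt_of_sq_le ?_
      have h1 : ((2 ^ u - 1) * X) ^ 2 ≤ c * X := by
        calc _ ≤ (2 ^ u * X) ^ 2 := by gcongr; omega
          _ = 4 ^ u * X * X := by rw [e4]; ring
          _ ≤ c * X := by gcongr
      exact_mod_cast h1

end Parameters

/-! ### Combining the ensemble with the circuits -/

/-- The three ancilla bounds are the needs of the lookup, of the sign repair, and of the rotations
with their carries. These phases of a block follow each other, so `a` only has to dominate each one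
separately. -/
theorem implementable {c n k u u' a : ℕ} (hc : 1 ≤ c) (hn : 1 ≤ n) (hk : 1 ≤ k) {ε : ℝ}
    (hε : 0 < ε) (hε1 : ε < 1) (hu : 2 ^ u ≤ c) (hu' : 2 ^ u' ≤ c)
    (ha : 2 ^ u * (k * bitsFor n ε) + (Nat.clog 2 c - u) ≤ a)
    (ha' : 2 ^ u' + (Nat.clog 2 c - u') ≤ a) (hab : k * bitsFor n ε + bitsFor n ε ≤ a)
    (θ : Fin n → Fin c → ℝ) :
    Implementable θ ε (bitsFor n ε) a (n * bitsFor n ε + (n ⌈/⌉ k) *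
      (c ⌈/⌉ 2 ^ u + c ⌈/⌉ 2 ^ u' + (2 ^ u - 1) * (k * bitsFor n ε) + 2 ^ u')) := by
  have hb := one_le_bitsFor hn hε hε1
  have h4 := le_four_pow_bitsFor hn hε
  generalize bitsFor n ε = b at *
  obtain ⟨N, p, f, t, hp, hp1, ht, herr⟩ := exists_ensemble hb θ
  choose C hC1 hC2 hC3 using fun i => exists_circuit hc hk hb hu hu' ha ha' hab
    (fun k j => bitAngle b (f i k) (t i k j)) (f i) fun k j => ⟨t i k j, ht i k j, rfl⟩
  refine ⟨⟨N, p, fun i k j => bitAngle b (f i k) (t i k j), C⟩,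
    ⟨hp, hp1, fun i k => ⟨f i k, fun j => ⟨t i k j, ht i k j, rfl⟩⟩, hC1,
      fun W _ _ V _ i ρ => hC3 i W V ρ, fun W _ _ V hV =>
        (herr W V hV).trans (ENNReal.ofReal_le_ofReal ?_)⟩, hC2⟩
  -- The choice of `b` says `n π² / (2 ε) ≤ 4^b`, which is the required `n (π/2^b)²/2 ≤ ε`.
  have e : (4 : ℝ) ^ b = (2 ^ b) ^ 2 := by rw [← pow_mul, mul_comm, pow_mul]; norm_num
  rw [div_le_iff₀ (by positivity), e] at h4
  rw [div_pow, div_le_iff₀ (by positivity), ← mul_div_assoc, div_le_iff₀ (by positivity)]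
  linarith

end QMux

theorem mainTheorem4 :
    -- the minimal Toffoli count
    (∃ C : ℝ, 0 < C ∧ ∀ (c n : ℕ), 1 ≤ c → 1 ≤ n → ∀ (θ : Fin n → Fin c → ℝ) (ε : ℝ),
      0 < ε → ε < 1 → 2 ≤ n / ε →
        ∃ a T : ℕ,
          (T : ℝ) ≤ n * (QMux.bitsFor n ε : ℝ) + C * √(c * n * Real.logb 2 (n / ε)) ∧
          QMux.Implementable θ ε (QMux.bitsFor n ε) a T) ∧
    -- the trade-off between Toffoli gates and qubits
    (∀ (c n : ℕ), 1 ≤ c → 1 ≤ n → ∀ (θ : Fin n → Fin c → ℝ) (ε : ℝ), 0 < ε → ε < 1 →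
      ∀ k l l' b : ℕ, 1 ≤ k → k ≤ n →
        (∃ u : ℕ, l = 2 ^ u) → l ≤ c → (∃ u : ℕ, l' = 2 ^ u) → l' ≤ c →
        b = QMux.bitsFor n ε →
          QMux.Implementable θ ε b
            (k * b + max (max (QMux.ceilLog c l + (l - 1) * (k * b)) (QMux.ceilLog c l' + l')) b)
            (n * b + (n ⌈/⌉ k) * ((c ⌈/⌉ l) + (c ⌈/⌉ l') + (l - 1) * (k * b) + l'))) := by
  -- With `R = √(c n b)`, the terms beyond `n b` are at most `(2R + 1) + (2R + 1) + R + (R + 1) ≤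
  -- 9R`, and `R ≤ 2 √(c n log₂ (n/ε))` because `b ≤ 3 log₂ (n/ε)`; hence `9 · 2`.
  refine ⟨⟨18, by norm_num, fun c n hc hn θ ε hε hε1 h2 => ?_⟩, ?_⟩
  · have hb := QMux.one_le_bitsFor hn hε hε1
    have hbL := QMux.bitsFor_le hn hε h2
    -- A row of the lookup table has `n b` bits, all rotations being in one block; the sign repair
    -- has rows of one bit, hence size `1` below.
    obtain ⟨u, hu1, hu2, hu3⟩ := QMux.exists_block_size hc (Nat.mul_le_mul hn hb)
    obtain ⟨u', hu1', hu2', hu3'⟩ := QMux.exists_block_size hc le_rfl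
    refine ⟨_, _, ?_, QMux.implementable hc hn hn hε hε1 hu1 hu1'
      ((Nat.le_add_right _ _).trans (Nat.le_add_right _ _))
      ((Nat.le_add_left _ _).trans (Nat.le_add_right _ _)) (Nat.le_add_left _ _) θ⟩
    have hnn : n ⌈/⌉ n = 1 := by
      rw [Nat.ceilDiv_eq_add_pred_div, Nat.div_eq_of_lt_le] <;> omega
    rw [hnn, one_mul]
    generalize QMux.bitsFor n ε = b at *
    have hc' : (1 : ℝ) ≤ c := by exact_mod_cast hc
    have hX : (1 : ℝ) ≤ ((n * b : ℕ) : ℝ) := by exact_mod_cast Nat.mul_le_mul hn hb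
    have hs : √(c * ((n * b : ℕ) : ℝ)) ≤ 2 * √(c * n * Real.logb 2 (n / ε)) := by
      refine Real.sqrt_le_iff.2 ⟨by positivity, ?_⟩
      have h0 : 0 ≤ c * n * Real.logb 2 (n / ε) := by
        have : 0 ≤ Real.logb 2 (n / ε) := Real.logb_nonneg (by norm_num) (by linarith)
        positivity
      rw [mul_pow, Real.sq_sqrt h0]
      have : (c * n : ℝ) * b ≤ (c * n) * (3 * Real.logb 2 (n / ε)) := by gcongr
      push_cast
      nlinarith
    have h1 : 1 ≤ √(c * ((n * b : ℕ) : ℝ)) := Real.one_le_sqrt.2 (by nlinarith)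
    have hcs : √(c * ((1 : ℕ) : ℝ)) ≤ √(c * ((n * b : ℕ) : ℝ)) := by
      gcongr
      exact_mod_cast Nat.mul_le_mul hn hb
    have h3 : ((2 ^ u' : ℕ) : ℝ) = (((2 ^ u' - 1) * 1 : ℕ) : ℝ) + 1 := by
      have : 2 ^ u' = (2 ^ u' - 1) * 1 + 1 := by have := Nat.two_pow_pos u'; omega
      exact_mod_cast this
    rw [Nat.cast_add, Nat.cast_add, Nat.cast_add, Nat.cast_add, Nat.cast_mul n b, h3]
    linarith
  · rintro c n hc hn θ ε hε hε1 k _ _ b hk - ⟨u, rfl⟩ hu ⟨u', rfl⟩ hu' rfl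
    have h1 := QMux.clog_sub_le_ceilLog hc u
    have h2 := QMux.clog_sub_le_ceilLog hc u'
    have hkb : 1 ≤ k * QMux.bitsFor n ε := Nat.mul_le_mul hk (QMux.one_le_bitsFor hn hε hε1)
    -- One of the `2 ^ u` candidate registers is the data register counted as `k * b` outside the
    -- maximum.
    have h3 : 2 ^ u * (k * QMux.bitsFor n ε) =
        (2 ^ u - 1) * (k * QMux.bitsFor n ε) + k * QMux.bitsFor n ε := by
      rw [← Nat.succ_mul, Nat.succ_eq_add_one, Nat.sub_add_cancel Nat.one_le_two_pow]
    exact QMux.implementable hc hn hk hε hε1 hu hu' (by omega) (by omega) (by omega) θ
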